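/- Let $\mathbb D^2=\{z\in\mathbb C:|z|<1\}$, let $h_0=\frac{4}{(1-|z|^2)^2}|dz|^2$ be the Poincaré metric, and let $PSL_2(\mathbb R)$ act on $\mathbb D^2$ through the Cayley transform. Let $\epsilon>0$ and let $h$ be a smooth, complete conformal metric on $\mathbb D^2$ which is bounded, i.e. $h\le C h_0$ for some constant $C>1$; denote its Gaussian curvature by $K_h$. Let $(S_n)_n$ be a sequence of closed, oriented, connected surfaces of genus at least $2$, and let $\rho_n:\pi_1(S_n)\to PSL_2(\mathbb R)$ be Fuchsian (faithful and discrete) representations such that $\rho_n$ has a fundamental domain in $\mathbb D^2$ containing the closed hyperbolic disk $B_H(0,\tau_n)$ centered at $0$ of radius $\tau_n$, where $(\tau_n)_n$ strictly increases to $\infty$. (1) If $K_h\in[-1/\epsilon,0]$ on $\mathbb D^2$, then there are $\epsilon'>0$ and, for each $n$, a smooth, complete, $\rho_n$-invariant conformal metric $h_n$ on $\mathbb D^2$ with $K_{h_n}\in[-1/\epsilon',0]$, such that $h_n\to h$ smoothly, uniformly on compact subsets of $\mathbb D^2$ (all derivatives of the densities with respect to $|dz|^2$ converge uniformly on compact subsets).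 (2) If $K_h\in[-1+\epsilon,1/\epsilon]$ on $\mathbb D^2$, then there are $\epsilon'>0$ and, for each $n$, a smooth, complete, $\rho_n$-invariant conformal metric $h_n$ on $\mathbb D^2$ with $K_{h_n}\in[-1+\epsilon',1/\epsilon']$, such that $h_n\to h$ smoothly, uniformly on compact subsets of $\mathbb D^2$. In both parts $\epsilon'$ does not depend on $n$. -/

import Mathlib

open Set Filter Topology MeasureTheory
open scoped ENNReal ContDiff MatrixGroups commutatorElement

noncomputable section

/-- The open unit disk `𝔻² = {z ∈ ℂ : |z| < 1}`. -/
def unitDisk : Set ℂ := Metric.ball 0 1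

/-- A smooth conformal metric `h = lam(z) |dz|²` on the unit disk, given by its smooth positive
density `lam` (the values of `density` outside the disk play no role). -/
structure ConformalMetric where
  density : ℂ → ℝ
  smooth : ContDiffOn ℝ ∞ density unitDisk
  pos : ∀ z ∈ unitDisk, 0 < density z

/-- The Poincaré metric `h₀ = 4 |dz|² / (1 - |z|²)²`. -/
def poincareMetric : ConformalMetric where
  density z := 4 / (1 - ‖z‖ ^ 2) ^ 2
  smooth := by
    refine ContDiffOn.div contDiffOn_const
      ((contDiffOn_const.sub (contDiff_norm_sq ℝ).contDiffOn).pow 2) ?_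
    intro z hz
    have h1 : ‖z‖ < 1 := by simpa [unitDisk] using hz
    have h2 : 0 < 1 - ‖z‖ ^ 2 := by nlinarith [norm_nonneg z]
    positivity
  pos := by
    intro z hz
    have h1 : ‖z‖ < 1 := by simpa [unitDisk] using hz
    have h2 : 0 < 1 - ‖z‖ ^ 2 := by nlinarith [norm_nonneg z]
    positivity

namespace ConformalMetric

/-- The Gaussian curvature of `lam |dz|²`, namely `K = -Δ(log lam) / (2 lam)`, where
`Δ = ∂ₓₓ + ∂ᵧᵧ`. -/
def curvature (h : ConformalMetric) (z : ℂ) : ℝ :=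
  -(Laplacian.laplacian (fun w : ℂ => Real.log (h.density w)) z) / (2 * h.density z)

/-- The length, for `h`, of the path `c` restricted to `[0, 1]`. -/
def pathLength (h : ConformalMetric) (c : ℝ → ℂ) : ℝ≥0∞ :=
  ∫⁻ t in Icc (0 : ℝ) 1,
    ENNReal.ofReal (Real.sqrt (h.density (c t)) * ‖derivWithin c (Icc 0 1) t‖)

/-- The Riemannian distance of `h`: the infimum of the lengths of the `C¹` paths in the disk that
join the two points. -/
def riemDist (h : ConformalMetric) (z w : ℂ) : ℝ≥0∞ :=
  ⨅ (c : ℝ → ℂ) (_ : ContDiffOn ℝ 1 c (Icc 0 1) ∧ MapsTo c (Icc 0 1) unitDisk ∧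
    c 0 = z ∧ c 1 = w), h.pathLength c

/-- `h` is complete: every Cauchy sequence for the Riemannian distance converges in the disk. -/
def IsCompleteMetric (h : ConformalMetric) : Prop :=
  ∀ x : ℕ → ℂ, (∀ n, x n ∈ unitDisk) →
    (∀ δ : ℝ≥0∞, 0 < δ → ∃ N, ∀ m ≥ N, ∀ n ≥ N, h.riemDist (x m) (x n) < δ) →
    ∃ p ∈ unitDisk, Tendsto (fun n => h.riemDist (x n) p) atTop (𝓝 0)

/-- `h` is bounded: `h ≤ C h₀` on the disk for some constant `C > 1`. -/
def IsBoundedMetric (h : ConformalMetric) : Prop :=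
  ∃ C : ℝ, 1 < C ∧ ∀ z ∈ unitDisk, h.density z ≤ C * poincareMetric.density z

/-- `hn → h` smoothly, uniformly on compact subsets of the disk: all derivatives, of every order,
of the densities converge uniformly on every compact subset of the disk. -/
def SmoothlyConverges (hn : ℕ → ConformalMetric) (h : ConformalMetric) : Prop :=
  ∀ K : Set ℂ, IsCompact K → K ⊆ unitDisk → ∀ k : ℕ,
    TendstoUniformlyOn (fun n z => iteratedFDeriv ℝ k (hn n).density z)
      (fun z => iteratedFDeriv ℝ k h.density z) atTop K

end ConformalMetric

/-- The closed hyperbolic disk `B_H(0, τ)` in the unit disk. -/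
def closedHypDisk (τ : ℝ) : Set ℂ :=
  {z | z ∈ unitDisk ∧ poincareMetric.riemDist 0 z ≤ ENNReal.ofReal τ}

/-- The action of `A = (a, b; c, d) ∈ SL(2, ℝ)` on the unit disk: the Möbius map
`z ↦ (α z + β) / (β̄ z + ᾱ)` with `α = ((a + d) + i (b - c)) / 2`, `β = ((a - d) - i (b + c)) / 2`,
which is the conjugate, by the Cayley transform, of the action of `A` on the upper half-plane
(see `diskMobius_cayley`). -/
def diskMobius (A : SL(2, ℝ)) (z : ℂ) : ℂ :=
  let α : ℂ := (((A 0 0 + A 1 1 : ℝ) : ℂ) + ((A 0 1 - A 1 0 : ℝ) : ℂ) * Complex.I) / 2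
  let β : ℂ := (((A 0 0 - A 1 1 : ℝ) : ℂ) - ((A 0 1 + A 1 0 : ℝ) : ℂ) * Complex.I) / 2
  (α * z + β) / ((starRingEnd ℂ) β * z + (starRingEnd ℂ) α)

/-- The Cayley transform from the upper half-plane to the unit disk. -/
def cayley (w : ℂ) : ℂ := (w - Complex.I) / (w + Complex.I)

theorem diskMobius_cayley (A : SL(2, ℝ)) (w : UpperHalfPlane) :
    diskMobius A (cayley (w : ℂ)) = cayley ((A • w : UpperHalfPlane) : ℂ) := by
  have hw : (w : ℂ) + Complex.I ≠ 0 := by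
    intro h
    have := congrArg Complex.im h
    simp at this
    linarith [w.im_pos]
  have hAw : ((A • w : UpperHalfPlane) : ℂ) + Complex.I ≠ 0 := by
    intro h
    have := congrArg Complex.im h
    simp only [Complex.add_im, Complex.I_im, Complex.zero_im, UpperHalfPlane.coe_im] at this
    linarith [(A • w).im_pos]
  have hd : (A 1 0 : ℂ) * w + A 1 1 ≠ 0 := by
    have := UpperHalfPlane.denom_ne_zero (A : GL (Fin 2) ℝ) w
    simpa [UpperHalfPlane.denom] using this
  have e : ((A • w : UpperHalfPlane) : ℂ) = ((A 0 0 : ℂ) * w + A 0 1) / ((A 1 0 : ℂ) * w + A 1 1) := by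
    rw [UpperHalfPlane.coe_specialLinearGroup_apply]; simp
  rw [e] at hAw ⊢
  have hI := Complex.I_sq
  have hq : (A 0 0 : ℂ) * w + A 0 1 + Complex.I * ((A 1 0 : ℂ) * w + A 1 1) ≠ 0 := by
    intro h
    apply hAw
    rw [div_add' _ _ _ hd, h, zero_div]
  simp only [diskMobius, cayley, map_div₀, map_add, map_sub, map_mul, Complex.conj_ofReal, Complex.conj_I, map_ofNat]
  push_cast
  have n1 : (((A 0 0 : ℂ) - A 1 1 - (A 0 1 + A 1 0) * -Complex.I) / 2 * ((w - Complex.I) / (w + Complex.I)) + ((A 0 0 : ℂ) + A 1 1 + (A 0 1 - A 1 0) * -Complex.I) / 2) =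
    ((A 0 0 : ℂ) * w + A 0 1 + Complex.I * ((A 1 0 : ℂ) * w + A 1 1)) / (w + Complex.I) := by
    field_simp
    linear_combination (-(2:ℂ) * A 0 1) * hI
  have n2 : (((A 0 0 : ℂ) + A 1 1 + (A 0 1 - A 1 0) * Complex.I) / 2 * ((w - Complex.I) / (w + Complex.I)) + ((A 0 0 : ℂ) - A 1 1 - (A 0 1 + A 1 0) * Complex.I) / 2) =
    ((A 0 0 : ℂ) * w + A 0 1 - Complex.I * ((A 1 0 : ℂ) * w + A 1 1)) / (w + Complex.I) := by
    field_simp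
    linear_combination (-(2:ℂ) * A 0 1) * hI
  rw [n1, n2, div_add' _ _ _ hd, div_sub' hd, div_div_div_cancel_right₀ hw,
    div_div_div_cancel_right₀ hd]
  simp only [mul_comm]

theorem diskMobius_mul_center (A Z : SL(2, ℝ)) (hZ : Z ∈ Subgroup.center SL(2, ℝ)) :
    diskMobius (A * Z) = diskMobius A := by
  obtain ⟨r, hr, hrZ⟩ := Matrix.SpecialLinearGroup.mem_center_iff.mp hZ
  have hr0 : (r : ℂ) ≠ 0 := by
    intro h
    rw [Complex.ofReal_eq_zero] at h
    simp [h] at hr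
  have hmul : ∀ i j, (A * Z) i j = r * A i j := by
    intro i j
    simp [Matrix.SpecialLinearGroup.coe_mul, ← hrZ, mul_comm]
  funext z
  simp only [diskMobius, hmul]
  refine Eq.trans ?_ (mul_div_mul_left _ _ hr0)
  congr 1 <;> simp <;> ring

/-- The action of `PSL(2, ℝ)` on the unit disk. -/
def diskAct (g : PSL(2, ℝ)) : ℂ → ℂ :=
  Quotient.liftOn' g diskMobius (by
    intro A B hAB
    have h := diskMobius_mul_center A (A⁻¹ * B) (QuotientGroup.leftRel_apply.mp hAB)
    rw [← h, mul_inv_cancel_left])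

/-- The fundamental group of the closed oriented surface of genus `g`, in its standard presentation
`⟨a₁, b₁, …, a_g, b_g | [a₁, b₁] ⋯ [a_g, b_g]⟩`. -/
abbrev SurfaceGroup (g : ℕ) : Type :=
  PresentedGroup ({(List.ofFn fun i : Fin g =>
    ⁅FreeGroup.of (Sum.inl i : Fin g ⊕ Fin g), FreeGroup.of (Sum.inr i : Fin g ⊕ Fin g)⁆).prod} :
      Set (FreeGroup (Fin g ⊕ Fin g)))

/-- A representation in `PSL(2, ℝ)` is Fuchsian if it is faithful with discrete image. -/
def IsFuchsianRep {Γ : Type*} [Group Γ] (ρ : Γ →* PSL(2, ℝ)) : Prop :=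
  Function.Injective ρ ∧ DiscreteTopology ρ.range

/-- `P` is a fundamental domain of `ρ` in the unit disk: a closed region (the closure, in the disk,
of a nonempty open set, here its interior) whose translates cover the disk and have pairwise
disjoint interiors. -/
structure IsFundDomain {Γ : Type*} [Group Γ] (ρ : Γ →* PSL(2, ℝ)) (P : Set ℂ) : Prop where
  interior_nonempty : (interior P).Nonempty
  eq_closure : P = closure (interior P) ∩ unitDisk
  covers : ∀ z ∈ unitDisk, ∃ γ : Γ, ∃ w ∈ P, diskAct (ρ γ) w = z
  disjoint : ∀ γ : Γ, γ ≠ 1 → Disjoint (interior P) (diskAct (ρ γ) '' interior P)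

/-- `h` is `ρ`-invariant: `ρ(γ)^* h = h` for all `γ`. -/
def ConformalMetric.IsInvariant {Γ : Type*} [Group Γ] (h : ConformalMetric)
    (ρ : Γ →* PSL(2, ℝ)) : Prop :=
  ∀ γ : Γ, ∀ z ∈ unitDisk,
    h.density (diskAct (ρ γ) z) * ‖deriv (diskAct (ρ γ)) z‖ ^ 2 = h.density z

end

/-!
Write a conformal metric as `e ^ v h₀`, with `h₀` the Poincaré metric. Its curvature is
`-(Δ v / λ₀ + 2) / (2 e ^ v)`, where `λ₀` is the density of `h₀`, so the two curvature conditions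
are inequalities for `Δ v / λ₀`, and invariance of the metric is invariance of `v`. It therefore
suffices to modify `v` outside a large ball into a constant, with control of the curvature that does
not depend on the ball, and to spread the result with the group: a function that is constant outside
a ball contained in a fundamental domain extends to an invariant one
(`exists_equivariant_extension`).

The modification is `v + σ (q - v)`, for a large constant `q` and a function `σ` that increases very
slowly from `0` to `1`. The slow variable is the potential `-log (1 - |z|²)`, whose Laplacian is
exactly `λ₀` and whose gradient for `h₀` has norm at most one. In the Laplacian of `v + σ (q - v)`,
the error `-2 ⟨∇σ, ∇v⟩` is absorbed by the first order part of the positive term `(q - v) Δσ` as soon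
as `q - v` exceeds a multiple of the gradient of `v`; this keeps nonpositive curvature without any
loss where `σ` is small, because `σ` satisfies `σ'' ≥ -C σ` there
(`laplacian_interpolation_bounds`). For the condition `K ≥ -1 + ε` a large `q` makes `e ^ v` grow
fast enough.

This needs bounds for `v`, `∇v` and `Δv` in the geometry of `h₀`
(`ConformalMetric.exists_logRatio_bounds`). The upper bound for `v` is the hypothesis that `h` is
bounded, and then `Δv` is bounded because the curvature is. The gradient bound is an interior
estimate, proved by comparison with a barrier on half of a square. The lower bound for `v` is where
completeness enters (`bddAbove_of_isCompleteMetric`). Put `w = -v`. If `w` is very large at a point,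
the Harnack inequality keeps it large on a ball of definite hyperbolic size, where `Δw ≥ λ₀`, so that
by the maximum principle `w` increases by a definite amount within that ball. Iteration gives a
sequence along which `w` tends to infinity while its successive `h`-distances decrease
geometrically, which contradicts completeness.
-/

/-! ### The Laplacian of products, compositions and pullbacks -/

section LaplacianCalculus

open Laplacian InnerProductSpace

/-- The inner product of the gradients of two functions on the plane. -/
noncomputable def gradInner (f g : ℂ → ℝ) (z : ℂ) : ℝ :=
  fderiv ℝ f z 1 * fderiv ℝ g z 1 + fderiv ℝ f z Complex.I * fderiv ℝ g z Complex.I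

theorem ContDiffAt.differentiableAt_fderiv {f : ℂ → ℝ} {z : ℂ} (hf : ContDiffAt ℝ 2 f z) :
    DifferentiableAt ℝ (fderiv ℝ f) z :=
  (hf.fderiv_right (m := 1) (by norm_num)).differentiableAt (by norm_num)

theorem ContDiffAt.eventually_differentiableAt {f : ℂ → ℝ} {z : ℂ} (hf : ContDiffAt ℝ 2 f z) :
    ∀ᶠ y in 𝓝 z, DifferentiableAt ℝ f y :=
  (hf.eventually (by simp)).mono fun _ h => h.differentiableAt (by norm_num)

theorem laplacian_eq_fderiv_fderiv (f : ℂ → ℝ) (z : ℂ) :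
    laplacian f z = fderiv ℝ (fderiv ℝ f) z 1 1 + fderiv ℝ (fderiv ℝ f) z Complex.I Complex.I := by
  rw [laplacian_eq_iteratedFDeriv_complexPlane]
  simp [iteratedFDeriv_two_apply]

theorem ContDiffAt.hasFDerivAt_fderiv_apply {f : ℂ → ℝ} {z : ℂ} (hf : ContDiffAt ℝ 2 f z) (e : ℂ) :
    HasFDerivAt (fun y => fderiv ℝ f y e) ((fderiv ℝ (fderiv ℝ f) z).flip e) z := by
  have := hf.differentiableAt_fderiv.hasFDerivAt.clm_apply (hasFDerivAt_const e z)
  simpa using this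

theorem ContDiffAt.laplacian_eq {f : ℂ → ℝ} {z : ℂ} (hf : ContDiffAt ℝ 2 f z) :
    laplacian f z = fderiv ℝ (fun y => fderiv ℝ f y 1) z 1 +
      fderiv ℝ (fun y => fderiv ℝ f y Complex.I) z Complex.I := by
  rw [laplacian_eq_fderiv_fderiv, (hf.hasFDerivAt_fderiv_apply 1).fderiv,
    (hf.hasFDerivAt_fderiv_apply Complex.I).fderiv]
  simp

theorem ContDiffAt.laplacian_mul {f g : ℂ → ℝ} {z : ℂ} (hf : ContDiffAt ℝ 2 f z)
    (hg : ContDiffAt ℝ 2 g z) :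
    laplacian (fun y => f y * g y) z =
      f z * laplacian g z + g z * laplacian f z + 2 * gradInner f g z := by
  have key : ∀ e : ℂ, fderiv ℝ (fun y => fderiv ℝ (fun y => f y * g y) y e) z e =
      f z * fderiv ℝ (fun y => fderiv ℝ g y e) z e + g z * fderiv ℝ (fun y => fderiv ℝ f y e) z e
        + 2 * (fderiv ℝ f z e * fderiv ℝ g z e) := by
    intro e
    have h1 : (fun y => fderiv ℝ (fun y => f y * g y) y e) =ᶠ[𝓝 z]
        fun y => f y * fderiv ℝ g y e + g y * fderiv ℝ f y e := by
      filter_upwards [hf.eventually_differentiableAt, hg.eventually_differentiableAt] with y h1 h2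
      rw [fderiv_fun_mul h1 h2]
      simp
    have df := (hf.differentiableAt (by norm_num)).hasFDerivAt
    have dg := (hg.differentiableAt (by norm_num)).hasFDerivAt
    have h2 := ((df.mul (hg.hasFDerivAt_fderiv_apply e)).add
      (dg.mul (hf.hasFDerivAt_fderiv_apply e))).congr_of_eventuallyEq h1
    rw [h2.fderiv, (hf.hasFDerivAt_fderiv_apply e).fderiv, (hg.hasFDerivAt_fderiv_apply e).fderiv]
    simp
    ring
  rw [(hf.mul hg).laplacian_eq, hf.laplacian_eq, hg.laplacian_eq, key, key, gradInner]
  ring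

theorem ContDiffAt.laplacian_comp {φ : ℝ → ℝ} {f : ℂ → ℝ} {z : ℂ} (hφ : ContDiffAt ℝ 2 φ (f z))
    (hf : ContDiffAt ℝ 2 f z) :
    laplacian (fun y => φ (f y)) z =
      deriv (deriv φ) (f z) * gradInner f f z + deriv φ (f z) * laplacian f z := by
  have e1 : ∀ᶠ t in 𝓝 (f z), DifferentiableAt ℝ φ t :=
    (hφ.eventually (by simp)).mono fun _ h => h.differentiableAt (by norm_num)
  have dφ : DifferentiableAt ℝ (deriv φ) (f z) :=
    (hφ.derivWithin (m := 1) (by norm_num)).differentiableAt (by norm_num)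
  have df := (hf.differentiableAt (by norm_num)).hasFDerivAt
  have key : ∀ e : ℂ, fderiv ℝ (fun y => fderiv ℝ (fun y => φ (f y)) y e) z e =
      deriv (deriv φ) (f z) * (fderiv ℝ f z e * fderiv ℝ f z e) +
        deriv φ (f z) * fderiv ℝ (fun y => fderiv ℝ f y e) z e := by
    intro e
    have h1 : (fun y => fderiv ℝ (fun y => φ (f y)) y e) =ᶠ[𝓝 z]
        fun y => deriv φ (f y) * fderiv ℝ f y e := by
      filter_upwards [hf.continuousAt.eventually e1, hf.eventually_differentiableAt] with y h1 h2
      have h3 := (h1.hasDerivAt.comp_hasFDerivAt y h2.hasFDerivAt).fderiv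
      simp only [Function.comp_def] at h3
      rw [h3]
      simp
    have h2 := ((dφ.hasDerivAt.comp_hasFDerivAt z df).mul
      (hf.hasFDerivAt_fderiv_apply e)).congr_of_eventuallyEq h1
    rw [h2.fderiv, (hf.hasFDerivAt_fderiv_apply e).fderiv]
    simp
    ring
  rw [ContDiffAt.laplacian_eq (f := fun y => φ (f y)) (hφ.comp z hf), hf.laplacian_eq, key, key,
    gradInner]
  ring

/-- The Laplacian transforms conformally under a holomorphic change of variable. -/
theorem ContDiffAt.laplacian_comp_holomorphic {f : ℂ → ℝ} {φ : ℂ → ℂ} {z : ℂ}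
    (hf : ContDiffAt ℝ 2 f (φ z)) (hφ : AnalyticAt ℂ φ z) :
    laplacian (fun y => f (φ y)) z = ‖deriv φ z‖ ^ 2 * laplacian f (φ z) := by
  have dφ : HasFDerivAt φ ((ContinuousLinearMap.toSpanSingleton ℂ (deriv φ z)).restrictScalars ℝ) z :=
    hφ.differentiableAt.hasDerivAt.hasFDerivAt.restrictScalars ℝ
  have dφ' : HasFDerivAt (deriv φ)
      ((ContinuousLinearMap.toSpanSingleton ℂ (deriv (deriv φ) z)).restrictScalars ℝ) z :=
    hφ.deriv.differentiableAt.hasDerivAt.hasFDerivAt.restrictScalars ℝ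
  set D := fderiv ℝ (fderiv ℝ f) (φ z)
  have key : ∀ e : ℂ, fderiv ℝ (fun y => fderiv ℝ (fun y => f (φ y)) y e) z e =
      fderiv ℝ f (φ z) (e * (e * deriv (deriv φ) z)) + D (e * deriv φ z) (e * deriv φ z) := by
    intro e
    have h1 : (fun y => fderiv ℝ (fun y => f (φ y)) y e) =ᶠ[𝓝 z]
        fun y => (fderiv ℝ f (φ y)) (e * deriv φ y) := by
      filter_upwards [hφ.continuousAt.eventually hf.eventually_differentiableAt,
        hφ.eventually_analyticAt] with y h1 h2
      have h3 : HasFDerivAt φ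
          ((ContinuousLinearMap.toSpanSingleton ℂ (deriv φ y)).restrictScalars ℝ) y :=
        h2.differentiableAt.hasDerivAt.hasFDerivAt.restrictScalars ℝ
      have h4 := (h1.hasFDerivAt.comp y h3).fderiv
      simp only [Function.comp_def] at h4
      rw [h4]
      simp
    have h2 := ((hf.differentiableAt_fderiv.hasFDerivAt.comp z dφ).clm_apply
      (dφ'.const_mul e)).congr_of_eventuallyEq h1
    rw [h2.fderiv]
    simp [D]
  have hc : ContDiffAt ℝ 2 φ z := (hφ.contDiffAt (n := 2)).restrict_scalars ℝ
  rw [ContDiffAt.laplacian_eq (f := fun y => f (φ y)) (hf.comp z hc), key, key,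
    laplacian_eq_fderiv_fderiv]
  set a := deriv φ z
  have e1 : (1 : ℂ) * a = a.re • (1 : ℂ) + a.im • Complex.I := by
    apply Complex.ext <;> simp
  have e2 : Complex.I * a = (-a.im) • (1 : ℂ) + a.re • Complex.I := by
    apply Complex.ext <;> simp
  have e3 : Complex.I * (Complex.I * deriv (deriv φ) z) = -(1 * (1 * deriv (deriv φ) z)) := by
    rw [← mul_assoc, Complex.I_mul_I]; simp
  rw [e1, e2, e3, map_neg, ← Complex.normSq_eq_norm_sq, Complex.normSq_apply]
  simp only [map_add, map_smul, add_apply, smul_apply, smul_eq_mul]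
  change _ = _ * (D 1 1 + D Complex.I Complex.I)
  ring

end LaplacianCalculus

/-! ### The second derivative test -/

section SecondDerivativeTest

theorem IsLocalMax.deriv_deriv_nonpos {g : ℝ → ℝ} {t : ℝ} (hg : ContinuousAt g t)
    (h : IsLocalMax g t) : deriv (deriv g) t ≤ 0 := by
  by_contra! hpos
  have hmin := isLocalMin_of_deriv_deriv_pos hpos h.deriv_eq_zero hg
  -- `g` is constant near `t`
  have hc : g =ᶠ[𝓝 t] fun _ => g t := by
    filter_upwards [h, hmin] with s h1 h2
    exact le_antisymm h1 h2
  have := hc.deriv.deriv_eq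
  simp at this
  linarith

theorem IsLocalMax.laplacian_nonpos {f : ℂ → ℝ} {z : ℂ} (hf : ContDiffAt ℝ 2 f z)
    (h : IsLocalMax f z) : Laplacian.laplacian f z ≤ 0 := by
  have key : ∀ e : ℂ, fderiv ℝ (fun y => fderiv ℝ f y e) z e ≤ 0 := by
    intro e
    set L : ℝ → ℂ := fun t => z + t • e
    have hL : ∀ t, HasDerivAt L e t := fun t => by
      simpa [L] using ((hasDerivAt_id t).smul_const e).const_add z
    have hL0 : L 0 = z := by simp [L]
    have hLc : ContinuousAt L 0 := (hL 0).continuousAt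
    have hLt : Tendsto L (𝓝 0) (𝓝 z) := by simpa [hL0] using hLc.tendsto
    have h1 : deriv (fun t => f (L t)) =ᶠ[𝓝 0] fun t => fderiv ℝ f (L t) e := by
      filter_upwards [hLt.eventually hf.eventually_differentiableAt] with t ht
      exact (ht.hasFDerivAt.comp_hasDerivAt t (hL t)).deriv
    have h2 : HasDerivAt (fun t => fderiv ℝ f (L t) e)
        (fderiv ℝ (fun y => fderiv ℝ f y e) z e) 0 := by
      have h3 : HasFDerivAt (fun y => fderiv ℝ f y e) (fderiv ℝ (fun y => fderiv ℝ f y e) z)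
          (L 0) := by
        rw [hL0]
        exact (hf.hasFDerivAt_fderiv_apply e).differentiableAt.hasFDerivAt
      exact h3.comp_hasDerivAt 0 (hL 0)
    have h4 : IsLocalMax (fun t => f (L t)) 0 := by
      have := hLt.eventually h
      simpa [IsLocalMax, IsMaxFilter, hL0] using this
    have h5 : ContinuousAt (fun t => f (L t)) 0 := by
      refine ContinuousAt.comp ?_ hLc
      rw [hL0]; exact hf.continuousAt
    have := h4.deriv_deriv_nonpos h5
    rwa [h1.deriv_eq, h2.deriv] at this
  rw [hf.laplacian_eq]
  linarith [key 1, key Complex.I]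

/-- The weak maximum principle, for functions of positive Laplacian. -/
theorem exists_frontier_le_of_laplacian_pos {u : ℂ → ℝ} {U : Set ℂ} (hU : IsOpen U)
    (hb : Bornology.IsBounded U) (hu : ContinuousOn u (closure U))
    (hu2 : ∀ z ∈ U, ContDiffAt ℝ 2 u z) (hpos : ∀ z ∈ U, 0 < Laplacian.laplacian u z)
    {z : ℂ} (hz : z ∈ closure U) : ∃ y ∈ frontier U, u z ≤ u y := by
  obtain ⟨y, hy, hmax⟩ := hb.isCompact_closure.exists_isMaxOn ⟨z, hz⟩ hu
  refine ⟨y, ⟨hy, fun hyU => ?_⟩, hmax hz⟩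
  rw [hU.interior_eq] at hyU
  have hloc : IsLocalMax u y := by
    filter_upwards [hU.mem_nhds hyU] with x hx using hmax (subset_closure hx)
  exact absurd (hloc.laplacian_nonpos (hu2 y hyU)) (not_le.mpr (hpos y hyU))

end SecondDerivativeTest

/-! ### The hyperbolic potential -/

section HyperbolicPotential

/-- The function `-log (1 - |z|²)`, an exhaustion of the disk whose Laplacian is the density of the
Poincaré metric and whose gradient is bounded for that metric. -/
noncomputable def hypPotential (z : ℂ) : ℝ := -Real.log (1 - ‖z‖ ^ 2)

theorem isOpen_unitDisk : IsOpen unitDisk := Metric.isOpen_ball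

theorem mem_unitDisk_iff {z : ℂ} : z ∈ unitDisk ↔ ‖z‖ < 1 := by simp [unitDisk]

theorem one_sub_norm_sq_pos {z : ℂ} (hz : z ∈ unitDisk) : 0 < 1 - ‖z‖ ^ 2 := by
  have h1 : ‖z‖ < 1 := mem_unitDisk_iff.mp hz
  nlinarith [norm_nonneg z]

theorem contDiff_one_sub_norm_sq {n : WithTop ℕ∞} : ContDiff ℝ n fun z : ℂ => 1 - ‖z‖ ^ 2 :=
  contDiff_const.sub (contDiff_norm_sq ℝ)

theorem contDiffOn_hypPotential {n : WithTop ℕ∞} : ContDiffOn ℝ n hypPotential unitDisk :=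
  (contDiff_one_sub_norm_sq.contDiffOn.log fun _ hz => (one_sub_norm_sq_pos hz).ne').neg

theorem contDiffAt_hypPotential {n : WithTop ℕ∞} {z : ℂ} (hz : z ∈ unitDisk) :
    ContDiffAt ℝ n hypPotential z :=
  contDiffOn_hypPotential.contDiffAt (isOpen_unitDisk.mem_nhds hz)

theorem fderiv_one_sub_norm_sq (z e : ℂ) :
    fderiv ℝ (fun y : ℂ => 1 - ‖y‖ ^ 2) z e = -(2 * inner ℝ z e) := by
  have h := (hasStrictFDerivAt_norm_sq z).hasFDerivAt.const_sub (1 : ℝ)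
  rw [h.fderiv, neg_apply, smul_apply, innerSL_apply_apply, nsmul_eq_mul, Nat.cast_ofNat]

theorem gradInner_one_sub_norm_sq (z : ℂ) :
    gradInner (fun y : ℂ => 1 - ‖y‖ ^ 2) (fun y : ℂ => 1 - ‖y‖ ^ 2) z = 4 * ‖z‖ ^ 2 := by
  rw [gradInner, fderiv_one_sub_norm_sq, fderiv_one_sub_norm_sq, ← Complex.normSq_eq_norm_sq,
    Complex.normSq_apply, Complex.inner, Complex.inner]
  simp
  ring

theorem laplacian_one_sub_norm_sq (z : ℂ) :
    Laplacian.laplacian (fun y : ℂ => (1 : ℝ) - ‖y‖ ^ 2) z = -4 := by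
  have key : ∀ e : ℂ, fderiv ℝ (fun y => fderiv ℝ (fun y : ℂ => 1 - ‖y‖ ^ 2) y e) z e =
      -(2 * inner ℝ e e) := by
    intro e
    simp only [fderiv_one_sub_norm_sq]
    have h : HasFDerivAt (fun y : ℂ => -(2 * inner ℝ y e)) (-((2 : ℝ) • innerSL ℝ e)) z := by
      have := ((innerSL ℝ e).hasFDerivAt (x := z)).const_mul 2 |>.neg
      simp only [innerSL_apply_apply, Pi.neg_def] at this
      simpa only [real_inner_comm e] using this
    rw [h.fderiv]
    simp
  rw [contDiff_one_sub_norm_sq.contDiffAt.laplacian_eq, key, key, Complex.inner, Complex.inner]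
  simp
  norm_num

theorem poincareMetric_density (z : ℂ) : poincareMetric.density z = 4 / (1 - ‖z‖ ^ 2) ^ 2 := rfl

theorem poincareMetric_density_pos {z : ℂ} (hz : z ∈ unitDisk) : 0 < poincareMetric.density z :=
  poincareMetric.pos z hz

theorem laplacian_hypPotential {z : ℂ} (hz : z ∈ unitDisk) :
    Laplacian.laplacian hypPotential z = poincareMetric.density z := by
  have h0 := one_sub_norm_sq_pos hz
  have hlog : ContDiffAt ℝ 2 (fun t => -Real.log t) (1 - ‖z‖ ^ 2) :=
    (Real.contDiffAt_log.mpr h0.ne').neg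
  have h := hlog.laplacian_comp (f := fun y : ℂ => 1 - ‖y‖ ^ 2)
    contDiff_one_sub_norm_sq.contDiffAt
  have d1 : deriv (fun t => -Real.log t) = fun t => -t⁻¹ := by
    funext t; simp
  have d2 : deriv (deriv (fun t => -Real.log t)) = fun t => (t ^ 2)⁻¹ := by
    rw [d1]; funext t; simp
  change Laplacian.laplacian (fun y : ℂ => -Real.log (1 - ‖y‖ ^ 2)) z = _
  rw [h, d2, d1, gradInner_one_sub_norm_sq, laplacian_one_sub_norm_sq, poincareMetric_density]
  field_simp
  ring

theorem fderiv_hypPotential {z : ℂ} (hz : z ∈ unitDisk) (e : ℂ) :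
    fderiv ℝ hypPotential z e = 2 * inner ℝ z e / (1 - ‖z‖ ^ 2) := by
  have h0 := one_sub_norm_sq_pos hz
  have hN : HasFDerivAt (fun y : ℂ => 1 - ‖y‖ ^ 2) (fderiv ℝ (fun y : ℂ => 1 - ‖y‖ ^ 2) z) z :=
    (contDiff_one_sub_norm_sq.differentiable (n := 1) (by norm_num) z).hasFDerivAt
  have h := (hN.log h0.ne').neg
  change fderiv ℝ (fun y : ℂ => -Real.log (1 - ‖y‖ ^ 2)) z e = _
  have h' := h.fderiv
  simp only [Pi.neg_def] at h'
  rw [h']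
  simp only [neg_apply, smul_apply, fderiv_one_sub_norm_sq, smul_eq_mul]
  field_simp

theorem gradInner_hypPotential {z : ℂ} (hz : z ∈ unitDisk) :
    gradInner hypPotential hypPotential z = ‖z‖ ^ 2 * poincareMetric.density z := by
  have h0 := one_sub_norm_sq_pos hz
  rw [gradInner, fderiv_hypPotential hz, fderiv_hypPotential hz, poincareMetric_density,
    ← Complex.normSq_eq_norm_sq, Complex.inner, Complex.inner]
  rw [← Complex.normSq_eq_norm_sq] at h0
  field_simp
  rw [Complex.normSq_apply]
  simp
  ring

theorem sqrt_poincareMetric_density {z : ℂ} (hz : z ∈ unitDisk) :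
    √(poincareMetric.density z) = 2 / (1 - ‖z‖ ^ 2) := by
  have h0 := one_sub_norm_sq_pos hz
  rw [poincareMetric_density, show (4 : ℝ) / (1 - ‖z‖ ^ 2) ^ 2 = (2 / (1 - ‖z‖ ^ 2)) ^ 2 by
    rw [div_pow]; norm_num, Real.sqrt_sq (by positivity)]

theorem norm_fderiv_hypPotential_le {z : ℂ} (hz : z ∈ unitDisk) :
    ‖fderiv ℝ hypPotential z‖ ≤ √(poincareMetric.density z) := by
  have h0 := one_sub_norm_sq_pos hz
  have h1 := mem_unitDisk_iff.mp hz
  refine ContinuousLinearMap.opNorm_le_bound _ (Real.sqrt_nonneg _) fun e => ?_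
  rw [fderiv_hypPotential hz, sqrt_poincareMetric_density hz, norm_div, Real.norm_of_nonneg h0.le,
    div_mul_eq_mul_div]
  gcongr
  rw [norm_mul, Real.norm_ofNat]
  gcongr
  calc ‖inner ℝ z e‖ ≤ ‖z‖ * ‖e‖ := norm_inner_le_norm z e
    _ ≤ 1 * ‖e‖ := by gcongr
    _ = ‖e‖ := one_mul _

theorem hypPotential_nonneg {z : ℂ} (hz : z ∈ unitDisk) : 0 ≤ hypPotential z := by
  have h0 := one_sub_norm_sq_pos hz
  have := Real.log_nonpos h0.le (by nlinarith [norm_nonneg z])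
  rw [hypPotential]; linarith

theorem poincareMetric_density_eq_exp {z : ℂ} (hz : z ∈ unitDisk) :
    Real.log (poincareMetric.density z) = Real.log 4 + 2 * hypPotential z := by
  have h0 := one_sub_norm_sq_pos hz
  rw [poincareMetric_density, Real.log_div (by norm_num) (by positivity), Real.log_pow,
    hypPotential]
  push_cast
  ring

end HyperbolicPotential

/-! ### Interior estimates for functions of bounded Laplacian -/

section InteriorEstimates

open Laplacian

theorem ContDiffAt.laplacian_comp_continuousLinearMap {f : ℂ → ℝ} {z : ℂ} (L : ℂ →L[ℝ] ℂ)
    (hf : ContDiffAt ℝ 2 f (L z)) :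
    laplacian (fun y => f (L y)) z = fderiv ℝ (fderiv ℝ f) (L z) (L 1) (L 1) +
      fderiv ℝ (fderiv ℝ f) (L z) (L Complex.I) (L Complex.I) := by
  have key : ∀ e : ℂ, fderiv ℝ (fun y => fderiv ℝ (fun y => f (L y)) y e) z e =
      fderiv ℝ (fderiv ℝ f) (L z) (L e) (L e) := by
    intro e
    have h1 : (fun y => fderiv ℝ (fun y => f (L y)) y e) =ᶠ[𝓝 z]
        fun y => fderiv ℝ f (L y) (L e) := by
      filter_upwards [L.continuous.continuousAt.eventually hf.eventually_differentiableAt] with y h1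
      have h2 := (h1.hasFDerivAt.comp y L.hasFDerivAt).fderiv
      simp only [Function.comp_def] at h2
      rw [h2]
      simp
    have h2 := ((hf.hasFDerivAt_fderiv_apply (L e)).comp z L.hasFDerivAt).congr_of_eventuallyEq h1
    rw [h2.fderiv]
    simp
  rw [ContDiffAt.laplacian_eq (f := fun y => f (L y)) (hf.comp z L.contDiff.contDiffAt), key, key]

theorem laplacian_comp_re (φ : ℝ → ℝ) (hφ : ContDiff ℝ 2 φ) (z : ℂ) :
    laplacian (fun y : ℂ => φ y.re) z = deriv (deriv φ) z.re := by
  have hc : ContDiff ℝ 2 (fun y : ℂ => y.re) := Complex.reCLM.contDiff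
  have hd : ∀ y e : ℂ, fderiv ℝ (fun y : ℂ => y.re) y e = e.re := fun y e =>
    DFunLike.congr_fun (Complex.reCLM.hasFDerivAt (x := y)).fderiv e
  rw [hφ.contDiffAt.laplacian_comp (f := fun y : ℂ => y.re) hc.contDiffAt, gradInner,
    hc.contDiffAt.laplacian_eq]
  simp [hd]

theorem laplacian_comp_im (φ : ℝ → ℝ) (hφ : ContDiff ℝ 2 φ) (z : ℂ) :
    laplacian (fun y : ℂ => φ y.im) z = deriv (deriv φ) z.im := by
  have hc : ContDiff ℝ 2 (fun y : ℂ => y.im) := Complex.imCLM.contDiff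
  have hd : ∀ y e : ℂ, fderiv ℝ (fun y : ℂ => y.im) y e = e.im := fun y e =>
    DFunLike.congr_fun (Complex.imCLM.hasFDerivAt (x := y)).fderiv e
  rw [hφ.contDiffAt.laplacian_comp (f := fun y : ℂ => y.im) hc.contDiffAt, gradInner,
    hc.contDiffAt.laplacian_eq]
  simp [hd]

theorem deriv_deriv_quadratic (a b : ℝ) (t : ℝ) :
    deriv (deriv fun s : ℝ => a * s ^ 2 + b * s) t = 2 * a := by
  have h1 : deriv (fun s : ℝ => a * s ^ 2 + b * s) = fun s => a * (2 * s) + b := by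
    funext s
    have := ((hasDerivAt_pow 2 s).const_mul a).add ((hasDerivAt_id s).const_mul b)
    have := this.deriv
    simp only [Pi.add_def, id] at this
    rw [this]; simp
  rw [h1]
  have := (((hasDerivAt_id t).const_mul 2).const_mul a).add_const b
  have := this.deriv
  simp only [id] at this
  rw [this]; ring

/-- The interior gradient estimate, one-sided and in one direction: the odd part of `u` under
reflection in the imaginary axis is compared with a quadratic barrier on half of a square. -/
theorem fderiv_one_le_of_abs_laplacian_le {u : ℂ → ℝ} {M N : ℝ}
    (hu : ∀ z, ‖z‖ < 1 → ContDiffAt ℝ 2 u z) (hM : ∀ z, ‖z‖ < 1 → |u z| ≤ M)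
    (hN : ∀ z, ‖z‖ < 1 → |laplacian u z| ≤ N) : fderiv ℝ u 0 1 ≤ 4 * M + N + 1 := by
  have hM0 : 0 ≤ M := (abs_nonneg _).trans (hM 0 (by simp))
  have hN0 : 0 ≤ N := (abs_nonneg _).trans (hN 0 (by simp))
  -- the reflection in the imaginary axis
  set L : ℂ →L[ℝ] ℂ := -(Complex.conjCLE : ℂ →L[ℝ] ℂ)
  have hLapp : ∀ z, L z = -(starRingEnd ℂ) z := fun z => by simp [L]
  have hLn : ∀ z, ‖L z‖ = ‖z‖ := fun z => by rw [hLapp]; simp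
  set φ : ℂ → ℝ := fun z => (1 / 2 : ℝ) * u z + (-(1 / 2) : ℝ) * u (L z)
  set a : ℝ := -(4 * M + (N + 1) / 2)
  set b : ℝ := 4 * M + (N + 1) / 4
  set ψ : ℂ → ℝ := fun z => (a * z.re ^ 2 + b * z.re) + (4 * M * z.im ^ 2 + 0 * z.im)
  set U : Set ℂ := Ioo (0 : ℝ) (1 / 2) ×ℂ Ioo (-(1 / 2) : ℝ) (1 / 2)
  have hcl : closure U = Icc (0 : ℝ) (1 / 2) ×ℂ Icc (-(1 / 2) : ℝ) (1 / 2) := by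
    rw [Complex.closure_reProdIm, closure_Ioo (by norm_num), closure_Ioo (by norm_num)]
  have hnorm : ∀ z ∈ closure U, ‖z‖ < 1 := by
    intro z hz
    rw [hcl, Complex.mem_reProdIm] at hz
    obtain ⟨⟨h1, h2⟩, h3, h4⟩ := hz
    rw [← sq_lt_one_iff₀ (norm_nonneg z), ← Complex.normSq_eq_norm_sq, Complex.normSq_apply]
    nlinarith
  have hUo : IsOpen U := isOpen_Ioo.reProdIm isOpen_Ioo
  have hUb : Bornology.IsBounded U :=
    (Metric.isBounded_ball (x := (0 : ℂ)) (r := 1)).subset fun z hz => by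
      simpa using hnorm z (subset_closure hz)
  have hφc : ∀ z, ‖z‖ < 1 → ContDiffAt ℝ 2 φ z := fun z hz =>
    (contDiffAt_const.mul (hu z hz)).add (contDiffAt_const.mul
      ((hu (L z) (by rwa [hLn])).comp z L.contDiff.contDiffAt))
  have hqc : ∀ a b : ℝ, ContDiff ℝ 2 fun s : ℝ => a * s ^ 2 + b * s := fun a b => by fun_prop
  have hψc : ContDiff ℝ 2 ψ :=
    ((hqc a b).comp Complex.reCLM.contDiff).add ((hqc (4 * M) 0).comp Complex.imCLM.contDiff)
  have hψlap : ∀ z, laplacian ψ z = -(N + 1) := by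
    intro z
    have h := (((hqc a b).comp Complex.reCLM.contDiff).contDiffAt (x := z)).laplacian_add
      (((hqc (4 * M) 0).comp Complex.imCLM.contDiff).contDiffAt (x := z))
    have h1 := laplacian_comp_re _ (hqc a b) z
    have h2 := laplacian_comp_im _ (hqc (4 * M) 0) z
    rw [deriv_deriv_quadratic] at h1 h2
    have : laplacian ψ z = 2 * a + 2 * (4 * M) := by
      rw [← h1, ← h2]; exact h
    rw [this]; simp only [a]; ring
  have hφlap : ∀ z, ‖z‖ < 1 → -N ≤ laplacian φ z := by
    intro z hz
    have hz' : ‖L z‖ < 1 := by rwa [hLn]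
    have huL : ContDiffAt ℝ 2 (fun y => u (L y)) z := (hu (L z) hz').comp z L.contDiff.contDiffAt
    have h := (contDiffAt_const.mul (hu z hz)).laplacian_add
      (f₁ := fun y => (1 / 2 : ℝ) * u y) (f₂ := fun y => (-(1 / 2) : ℝ) * u (L y))
      (contDiffAt_const.mul huL)
    have h1 := InnerProductSpace.laplacian_smul (1 / 2 : ℝ) (hu z hz)
    have h2 := InnerProductSpace.laplacian_smul (-(1 / 2) : ℝ) huL
    have h3 := (hu (L z) hz').laplacian_comp_continuousLinearMap L
    have h4 := laplacian_eq_fderiv_fderiv u (L z)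
    have e1 : L 1 = -1 := by simp [hLapp]
    have e2 : L Complex.I = Complex.I := by simp [hLapp]
    rw [e1, e2] at h3
    simp only [map_neg, neg_apply, neg_neg] at h3
    rw [← h4] at h3
    have : laplacian φ z = (1 / 2) * laplacian u z + (-(1 / 2)) * laplacian u (L z) := by
      rw [← h3]
      simp only [smul_eq_mul] at h1 h2
      rw [← h1, ← h2]; exact h
    rw [this]
    have := abs_le.mp (hN z hz)
    have := abs_le.mp (hN _ hz')
    linarith
  have hle : ∀ z ∈ closure U, φ z ≤ ψ z := by
    intro z hz
    obtain ⟨y, hy, hzy⟩ := exists_frontier_le_of_laplacian_pos (u := φ - ψ) hUo hUb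
      (fun y hy => ((hφc y (hnorm y hy)).sub hψc.contDiffAt).continuousAt.continuousWithinAt)
      (fun y hy => (hφc y (hnorm y (subset_closure hy))).sub hψc.contDiffAt)
      (fun y hy => by
        have hy' := hnorm y (subset_closure hy)
        rw [(hφc y hy').laplacian_sub hψc.contDiffAt, hψlap]
        linarith [hφlap y hy']) hz
    suffices h : φ y ≤ ψ y by
      simp only [Pi.sub_apply] at hzy; linarith
    obtain ⟨hyc, hyU⟩ := hy
    rw [hUo.interior_eq] at hyU
    have hy1 := hnorm y hyc
    rw [hcl, Complex.mem_reProdIm] at hyc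
    obtain ⟨⟨h1, h2⟩, h3, h4⟩ := hyc
    by_cases h0 : y.re = 0
    · have : L y = y := by
        rw [hLapp]; apply Complex.ext <;> simp [h0]
      have hφ0 : φ y = 0 := by simp only [φ, this]; ring
      rw [hφ0]
      simp only [ψ, h0]
      nlinarith [mul_nonneg hM0 (sq_nonneg y.im)]
    · have hφM : φ y ≤ M := by
        have := abs_le.mp (hM y hy1)
        have := abs_le.mp (hM (L y) (by rwa [hLn]))
        simp only [φ]; linarith
      refine hφM.trans ?_
      have hψ : ψ y = 4 * M * (y.im ^ 2 + y.re * (1 - y.re)) + (N + 1) / 2 * (y.re * (1 / 2 - y.re)) := by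
        simp only [ψ, a, b]; ring
      have hr : 0 ≤ (N + 1) / 2 * (y.re * (1 / 2 - y.re)) :=
        mul_nonneg (by linarith) (mul_nonneg h1 (by linarith))
      suffices h : 1 / 4 ≤ y.im ^ 2 + y.re * (1 - y.re) by
        rw [hψ]; nlinarith
      by_cases h5 : y.re = 1 / 2
      · rw [h5]; nlinarith [sq_nonneg y.im]
      · have h6 : y.im = -(1 / 2) ∨ y.im = 1 / 2 := by
          by_contra! hcon
          exact hyU ⟨⟨lt_of_le_of_ne h1 (Ne.symm h0), lt_of_le_of_ne h2 h5⟩,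
            lt_of_le_of_ne h3 (Ne.symm hcon.1), lt_of_le_of_ne h4 hcon.2⟩
        have : y.im ^ 2 = 1 / 4 := by rcases h6 with h | h <;> rw [h] <;> norm_num
        nlinarith
  -- compare the derivatives at the origin along the real axis
  have hg : HasDerivAt (fun t : ℝ => φ t - ψ t) (fderiv ℝ u 0 1 - b) 0 := by
    have hof : HasDerivAt (fun t : ℝ => (t : ℂ)) 1 0 := Complex.ofRealCLM.hasDerivAt
    have hu0 : HasFDerivAt u (fderiv ℝ u 0) ((0 : ℝ) : ℂ) := by
      simpa using ((hu 0 (by simp)).differentiableAt (by norm_num)).hasFDerivAt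
    have hu0' : HasFDerivAt u (fderiv ℝ u 0) (L ((0 : ℝ) : ℂ)) := by
      simpa using ((hu 0 (by simp)).differentiableAt (by norm_num)).hasFDerivAt
    have h1 := hu0.comp_hasDerivAt (0 : ℝ) hof
    have h2 := hu0'.comp_hasDerivAt (0 : ℝ) (L.hasFDerivAt.comp_hasDerivAt (0 : ℝ) hof)
    have h3 : HasDerivAt (fun t : ℝ => a * t ^ 2 + b * t) b 0 := by
      have := ((hasDerivAt_pow 2 (0 : ℝ)).const_mul a).fun_add
        ((hasDerivAt_id (0 : ℝ)).const_mul b)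
      simpa only [id, mul_zero, mul_one, zero_add, Nat.cast_ofNat, pow_one, Nat.add_one_sub_one]
        using this
    have h4 := ((h1.const_mul (1 / 2)).add (h2.const_mul (-(1 / 2)))).sub h3
    have e1 : L 1 = -1 := by simp [hLapp]
    rw [e1, map_neg] at h4
    refine (h4.congr_deriv (by ring)).congr_of_eventuallyEq (Eventually.of_forall fun t => ?_)
    simp [φ, ψ]
  have hslope := hg.hasDerivWithinAt (s := Ioi 0)
  rw [hasDerivWithinAt_iff_tendsto_slope' (by simp)] at hslope
  have hle0 : fderiv ℝ u 0 1 - b ≤ 0 := by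
    refine le_of_tendsto hslope ?_
    filter_upwards [Ioo_mem_nhdsGT (show (0 : ℝ) < 1 / 2 by norm_num)] with t ht
    have h1 := hle (t : ℂ) (by
      rw [hcl, Complex.mem_reProdIm]
      simpa using ⟨ht.1.le, by linarith [ht.2]⟩)
    have h0 : φ ((0 : ℝ) : ℂ) - ψ ((0 : ℝ) : ℂ) = 0 := by
      simp [φ, ψ]
    rw [slope_def_field, h0]
    exact div_nonpos_of_nonpos_of_nonneg (by linarith) (by linarith [ht.1])
  simp only [b] at hle0
  linarith

theorem abs_fderiv_le_of_abs_laplacian_le {u : ℂ → ℝ} {M N : ℝ}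
    (hu : ∀ z, ‖z‖ < 1 → ContDiffAt ℝ 2 u z) (hM : ∀ z, ‖z‖ < 1 → |u z| ≤ M)
    (hN : ∀ z, ‖z‖ < 1 → |laplacian u z| ≤ N) : |fderiv ℝ u 0 1| ≤ 4 * M + N + 1 := by
  refine abs_le'.mpr ⟨fderiv_one_le_of_abs_laplacian_le hu hM hN, ?_⟩
  have h := fderiv_one_le_of_abs_laplacian_le (u := -u) (fun z hz => (hu z hz).neg)
    (fun z hz => by simpa using hM z hz) (fun z hz => by
      rw [InnerProductSpace.laplacian_neg]; simpa using hN z hz)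
  rw [fderiv_neg] at h
  simpa using h

end InteriorEstimates

/-! ### Mean values and the Harnack inequality -/

section MeanValue

open Laplacian

/-- The point of polar coordinates `(r, θ)` around `c`. -/
noncomputable def polarPoint (c : ℂ) (p : ℝ × ℝ) : ℂ := c + p.1 * Complex.exp (p.2 * Complex.I)

theorem contDiff_exp_mul_I : ContDiff ℝ 2 fun p : ℝ × ℝ => Complex.exp (p.2 * Complex.I) :=
  ((Complex.ofRealCLM.contDiff.comp contDiff_snd).mul contDiff_const).cexp

theorem contDiff_polarPoint (c : ℂ) : ContDiff ℝ 2 (polarPoint c) :=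
  contDiff_const.add ((Complex.ofRealCLM.contDiff.comp contDiff_fst).mul contDiff_exp_mul_I)

theorem norm_polarPoint_sub (c : ℂ) (p : ℝ × ℝ) : ‖polarPoint c p - c‖ = |p.1| := by
  simp [polarPoint, Complex.norm_exp_ofReal_mul_I]

theorem hasFDerivAt_exp_mul_I (p : ℝ × ℝ) :
    ∃ E' : ℝ × ℝ →L[ℝ] ℂ, HasFDerivAt (fun p : ℝ × ℝ => Complex.exp (p.2 * Complex.I)) E' p ∧
      E' (1, 0) = 0 ∧ E' (0, 1) = Complex.I * Complex.exp (p.2 * Complex.I) := by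
  have h1 : HasFDerivAt (fun p : ℝ × ℝ => (p.2 : ℂ) * Complex.I)
      ((Complex.ofRealCLM.comp (ContinuousLinearMap.snd ℝ ℝ ℝ)).smulRight Complex.I) p := by
    exact ((Complex.ofRealCLM.comp (ContinuousLinearMap.snd ℝ ℝ ℝ)).smulRight
      Complex.I).hasFDerivAt (x := p)
  refine ⟨_, h1.cexp, ?_, ?_⟩
  · simp
  · simp [mul_comm]

theorem hasFDerivAt_polarPoint (c : ℂ) (p : ℝ × ℝ) :
    ∃ P' : ℝ × ℝ →L[ℝ] ℂ, HasFDerivAt (polarPoint c) P' p ∧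
      P' (1, 0) = Complex.exp (p.2 * Complex.I) ∧
      P' (0, 1) = p.1 * (Complex.I * Complex.exp (p.2 * Complex.I)) := by
  obtain ⟨E', hE, h1, h2⟩ := hasFDerivAt_exp_mul_I p
  have h3 : HasFDerivAt (fun p : ℝ × ℝ => (p.1 : ℂ))
      (Complex.ofRealCLM.comp (ContinuousLinearMap.fst ℝ ℝ ℝ)) p :=
    (Complex.ofRealCLM.comp (ContinuousLinearMap.fst ℝ ℝ ℝ)).hasFDerivAt
  refine ⟨_, (h3.mul hE).const_add c, ?_, ?_⟩
  · simp [h1]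
  · simp [h2]

variable {u : ℂ → ℝ} {c : ℂ} {R N : ℝ}

/-- The divergence theorem on a disk, in polar coordinates. -/
theorem radial_flux_eq (hu : ∀ z ∈ Metric.ball c R, ContDiffAt ℝ 2 u z) {r : ℝ} (hr0 : 0 ≤ r)
    (hr : r < R) :
    ∫ θ in (-Real.pi)..Real.pi,
        r * fderiv ℝ u (polarPoint c (r, θ)) (Complex.exp (θ * Complex.I)) =
      ∫ s in (0 : ℝ)..r, ∫ θ in (-Real.pi)..Real.pi, s * laplacian u (polarPoint c (s, θ)) := by
  have hmem : ∀ p : ℝ × ℝ, p ∈ uIcc 0 r ×ˢ uIcc (-Real.pi) Real.pi →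
      polarPoint c p ∈ Metric.ball c R := by
    rintro p ⟨hp, -⟩
    rw [uIcc_of_le hr0] at hp
    rw [mem_ball_iff_norm, norm_polarPoint_sub, abs_of_nonneg hp.1]
    exact hp.2.trans_lt hr
  set E : ℝ × ℝ → ℂ := fun p => Complex.exp (p.2 * Complex.I)
  set F : ℝ × ℝ → ℝ := fun p => p.1 * fderiv ℝ u (polarPoint c p) (E p)
  set G : ℝ × ℝ → ℝ := fun p => fderiv ℝ u (polarPoint c p) (Complex.I * E p)
  have hDu : ∀ p : ℝ × ℝ, p ∈ uIcc 0 r ×ˢ uIcc (-Real.pi) Real.pi →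
      ContDiffAt ℝ 1 (fun p => fderiv ℝ u (polarPoint c p)) p := fun p hp =>
    ((hu _ (hmem p hp)).fderiv_right (m := 1) (by norm_num)).comp p
      ((contDiff_polarPoint c).of_le (by norm_num)).contDiffAt
  have hE : ContDiff ℝ 1 E := contDiff_exp_mul_I.of_le (by norm_num)
  have hF : ∀ p : ℝ × ℝ, p ∈ uIcc 0 r ×ˢ uIcc (-Real.pi) Real.pi → ContDiffAt ℝ 1 F p :=
    fun p hp => contDiffAt_fst.mul ((hDu p hp).clm_apply hE.contDiffAt)
  have hG : ∀ p : ℝ × ℝ, p ∈ uIcc 0 r ×ˢ uIcc (-Real.pi) Real.pi → ContDiffAt ℝ 1 G p :=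
    fun p hp => (hDu p hp).clm_apply (contDiffAt_const.mul hE.contDiffAt)
  have hdiv : ∀ p : ℝ × ℝ, p ∈ uIcc 0 r ×ˢ uIcc (-Real.pi) Real.pi →
      fderiv ℝ F p (1, 0) + fderiv ℝ G p (0, 1) = p.1 * laplacian u (polarPoint c p) := by
    intro p hp
    obtain ⟨E', hE', e1, e2⟩ := hasFDerivAt_exp_mul_I p
    obtain ⟨P', hP', p1, p2⟩ := hasFDerivAt_polarPoint c p
    have hD := (hu _ (hmem p hp)).differentiableAt_fderiv.hasFDerivAt.comp p hP'
    have h1 := ((hasFDerivAt_fst (𝕜 := ℝ) (p := p)).mul (hD.clm_apply hE')).fderiv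
    have h2 := (hD.clm_apply (hE'.const_mul Complex.I)).fderiv
    have h1' : fderiv ℝ F p = _ := h1
    have h2' : fderiv ℝ G p = _ := h2
    rw [h1', h2', laplacian_eq_fderiv_fderiv]
    set D := fderiv ℝ (fderiv ℝ u) (polarPoint c p)
    set x := Complex.exp (p.2 * Complex.I)
    have hx : x = (Real.cos p.2) • (1 : ℂ) + (Real.sin p.2) • Complex.I := by
      simp only [x]; rw [Complex.exp_mul_I]; simp
    have hIx : Complex.I * x = (-Real.sin p.2) • (1 : ℂ) + (Real.cos p.2) • Complex.I := by
      rw [hx]; apply Complex.ext <;> simp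
    have hIIx : Complex.I * (Complex.I * x) = -x := by
      rw [← mul_assoc, Complex.I_mul_I]; simp
    have hs : (p.1 : ℂ) * (Complex.I * x) = p.1 • (Complex.I * x) := by simp
    simp only [add_apply, smul_apply, ContinuousLinearMap.comp_apply, Function.comp,
      ContinuousLinearMap.flip_apply, e1, e2, p1, p2, map_zero, ContinuousLinearMap.coe_fst',
      smul_eq_mul, zero_add, mul_one, hs, hIIx, map_neg, map_smul]
    change p.1 * D x x + fderiv ℝ u (polarPoint c p) x +
      (-fderiv ℝ u (polarPoint c p) x + p.1 * D (Complex.I * x) (Complex.I * x)) = _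
    rw [hIx, hx]
    simp only [map_add, map_smul, add_apply, smul_apply, smul_eq_mul]
    linear_combination (p.1 * (D 1 1 + D Complex.I Complex.I)) * (Real.sin_sq_add_cos_sq p.2)
  have hsub : Ioo (min 0 r) (max 0 r) ×ˢ Ioo (min (-Real.pi) Real.pi) (max (-Real.pi) Real.pi) ⊆
      uIcc 0 r ×ˢ uIcc (-Real.pi) Real.pi :=
    prod_mono Ioo_subset_Icc_self Ioo_subset_Icc_self
  have hcomp : IsCompact (uIcc 0 r ×ˢ uIcc (-Real.pi) Real.pi) := isCompact_uIcc.prod isCompact_uIcc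
  have h := integral2_divergence_prod_of_hasFDerivAt F G (fderiv ℝ F) (fderiv ℝ G) 0 (-Real.pi)
    r Real.pi (fun p hp => (hF p hp).continuousAt.continuousWithinAt)
    (fun p hp => (hG p hp).continuousAt.continuousWithinAt)
    (fun p hp => ((hF p (hsub hp)).differentiableAt (by norm_num)).hasFDerivAt)
    (fun p hp => ((hG p (hsub hp)).differentiableAt (by norm_num)).hasFDerivAt)
    (ContinuousOn.integrableOn_compact hcomp fun p hp =>
      ((((hF p hp).fderiv_right (m := 0) (by norm_num)).continuousAt.clm_apply
        continuousAt_const).add (((hG p hp).fderiv_right (m := 0) (by norm_num)).continuousAt.clm_apply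
        continuousAt_const)).continuousWithinAt)
  have hper : ∀ s : ℝ, G (s, Real.pi) = G (s, -Real.pi) := by
    intro s
    have : Complex.exp (-(Real.pi * Complex.I)) = Complex.exp (Real.pi * Complex.I) := by
      rw [Complex.exp_neg, Complex.exp_pi_mul_I]; norm_num
    simp [G, E, polarPoint, this]
  simp only [hper, sub_self, zero_add] at h
  have hF0 : ∀ θ : ℝ, F (0, θ) = 0 := fun θ => by simp [F]
  simp only [hF0, intervalIntegral.integral_zero, sub_zero] at h
  change ∫ θ in (-Real.pi)..Real.pi, F (r, θ) = _
  rw [← h]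
  refine intervalIntegral.integral_congr fun s hs => intervalIntegral.integral_congr fun θ hθ => ?_
  exact hdiv (s, θ) ⟨hs, hθ⟩

theorem ContinuousOn.intervalIntegrable_intervalIntegral {K : ℝ × ℝ → ℝ} {a b a' b' : ℝ}
    (hab : a ≤ b) (hab' : a' ≤ b') (hK : ContinuousOn K (uIcc a b ×ˢ uIcc a' b')) :
    IntervalIntegrable (fun s => ∫ θ in a'..b', K (s, θ)) volume a b := by
  have h : IntegrableOn K (Ioc a b ×ˢ Ioc a' b') := by
    refine (hK.integrableOn_compact (isCompact_uIcc.prod isCompact_uIcc)).mono_set ?_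
    rw [uIcc_of_le hab, uIcc_of_le hab']
    exact prod_mono Ioc_subset_Icc_self Ioc_subset_Icc_self
  rw [IntegrableOn, Measure.volume_eq_prod, ← Measure.prod_restrict] at h
  rw [intervalIntegrable_iff_integrableOn_Ioc_of_le hab]
  simp only [intervalIntegral.integral_of_le hab']
  exact h.integral_prod_left

theorem continuousOn_polar (hu : ContinuousOn u (Metric.ball c R)) {r : ℝ} (hr0 : 0 ≤ r)
    (hr : r < R) :
    ContinuousOn (fun p => u (polarPoint c p)) (uIcc 0 r ×ˢ uIcc (-Real.pi) Real.pi) := by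
  refine hu.comp (contDiff_polarPoint c).continuous.continuousOn ?_
  rintro p ⟨hp, -⟩
  rw [uIcc_of_le hr0] at hp
  rw [mem_ball_iff_norm, norm_polarPoint_sub, abs_of_nonneg hp.1]
  exact hp.2.trans_lt hr

/-- The mean value inequality on circles. -/
theorem circle_integral_le (hu : ∀ z ∈ Metric.ball c R, ContDiffAt ℝ 2 u z)
    (hN : ∀ z ∈ Metric.ball c R, laplacian u z ≤ N) {r : ℝ} (hr0 : 0 ≤ r) (hr : r < R) :
    ∫ θ in (-Real.pi)..Real.pi, u (polarPoint c (r, θ)) ≤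
      2 * Real.pi * u c + Real.pi * N * r ^ 2 / 2 := by
  have hpi := Real.pi_pos
  have hpi' : -Real.pi ≤ Real.pi := by linarith
  set E : ℝ × ℝ → ℂ := fun p => Complex.exp (p.2 * Complex.I)
  have hE : Continuous E := contDiff_exp_mul_I.continuous
  have hmem : ∀ s : ℝ, 0 ≤ s → s < R → ∀ θ : ℝ, polarPoint c (s, θ) ∈ Metric.ball c R := by
    intro s hs0 hs θ
    rw [mem_ball_iff_norm, norm_polarPoint_sub, abs_of_nonneg hs0]
    exact hs
  have hD : ContinuousOn (fun z => fderiv ℝ u z) (Metric.ball c R) := fun z hz =>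
    (hu z hz).differentiableAt_fderiv.continuousAt.continuousWithinAt
  have hL : ContinuousOn (laplacian u) (Metric.ball c R) := by
    intro z hz
    have h2 : ContinuousAt (fderiv ℝ (fderiv ℝ u)) z :=
      (((hu z hz).fderiv_right (m := 1) (by norm_num)).fderiv_right (m := 0)
        (by norm_num)).continuousAt
    have h3 : laplacian u = fun z => fderiv ℝ (fderiv ℝ u) z 1 1 +
        fderiv ℝ (fderiv ℝ u) z Complex.I Complex.I := funext (laplacian_eq_fderiv_fderiv u)
    rw [h3]
    exact (((h2.clm_apply continuousAt_const).clm_apply continuousAt_const).add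
      ((h2.clm_apply continuousAt_const).clm_apply continuousAt_const)).continuousWithinAt
  have hcomp : ∀ s : ℝ, 0 ≤ s → s < R → IsCompact (uIcc 0 s ×ˢ uIcc (-Real.pi) Real.pi) :=
    fun s _ _ => isCompact_uIcc.prod isCompact_uIcc
  have hpolD : ∀ s : ℝ, 0 ≤ s → s < R → ContinuousOn
      (fun p => fderiv ℝ u (polarPoint c p) (E p)) (uIcc 0 s ×ˢ uIcc (-Real.pi) Real.pi) := by
    intro s hs0 hs
    refine ContinuousOn.clm_apply (hD.comp (contDiff_polarPoint c).continuous.continuousOn ?_)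
      hE.continuousOn
    rintro p ⟨hp, -⟩
    rw [uIcc_of_le hs0] at hp
    exact hmem p.1 hp.1 (hp.2.trans_lt hs) p.2
  have hslice : ∀ {K : ℝ × ℝ → ℝ} {s t : ℝ}, 0 ≤ t → t ≤ s →
      ContinuousOn K (uIcc 0 s ×ˢ uIcc (-Real.pi) Real.pi) →
      IntervalIntegrable (fun θ => K (t, θ)) volume (-Real.pi) Real.pi := by
    intro K s t h0 h1 hK
    refine ContinuousOn.intervalIntegrable ?_
    refine hK.comp (by fun_prop) fun θ hθ => ⟨?_, hθ⟩
    rw [uIcc_of_le (h0.trans h1)]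
    exact ⟨h0, h1⟩
  -- the flux through the circle of radius `s`
  have hflux : ∀ s : ℝ, 0 < s → s < R →
      ∫ θ in (-Real.pi)..Real.pi, fderiv ℝ u (polarPoint c (s, θ)) (E (s, θ)) ≤
        Real.pi * N * s := by
    intro s hs0 hs
    have h1 := radial_flux_eq hu hs0.le hs
    rw [intervalIntegral.integral_const_mul] at h1
    have hK : ContinuousOn (fun p : ℝ × ℝ => p.1 * laplacian u (polarPoint c p))
        (uIcc 0 s ×ˢ uIcc (-Real.pi) Real.pi) :=
      continuousOn_fst.mul (continuousOn_polar hL hs0.le hs)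
    have h2 : ∫ t in (0 : ℝ)..s, ∫ θ in (-Real.pi)..Real.pi, t * laplacian u (polarPoint c (t, θ)) ≤
        ∫ t in (0 : ℝ)..s, 2 * Real.pi * N * t := by
      refine intervalIntegral.integral_mono_on hs0.le
        (hK.intervalIntegrable_intervalIntegral hs0.le hpi')
        (Continuous.intervalIntegrable (by fun_prop) _ _) fun t ht => ?_
      calc _ ≤ ∫ θ in (-Real.pi)..Real.pi, t * N := by
            refine intervalIntegral.integral_mono_on hpi' (hslice ht.1 ht.2 hK)
              (by simp) fun θ hθ => ?_
            exact mul_le_mul_of_nonneg_left (hN _ (hmem t ht.1 (ht.2.trans_lt hs) θ)) ht.1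
        _ = _ := by simp; ring
    rw [← h1, intervalIntegral.integral_const_mul, integral_id] at h2
    have h3 : s * (∫ θ in (-Real.pi)..Real.pi, fderiv ℝ u (polarPoint c (s, θ)) (E (s, θ))) ≤
        s * (Real.pi * N * s) := by
      refine h2.trans (le_of_eq ?_)
      ring
    exact le_of_mul_le_mul_left h3 hs0
  -- integrate the flux over the radius
  have hDp : ∀ p : ℝ × ℝ, p.1 ∈ Icc 0 r →
      ∃ P' : ℝ × ℝ →L[ℝ] ℝ, HasFDerivAt (fun p => u (polarPoint c p)) P' p ∧
        P' (1, 0) = fderiv ℝ u (polarPoint c p) (E p) := by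
    intro p hp
    obtain ⟨P', h1, h2, -⟩ := hasFDerivAt_polarPoint c p
    refine ⟨_, ((hu _ (hmem p.1 hp.1 (hp.2.trans_lt hr) p.2)).differentiableAt
      (by norm_num)).hasFDerivAt.comp p h1, ?_⟩
    simp [h2, E]
  have hdiv := integral2_divergence_prod_of_hasFDerivAt (fun p => u (polarPoint c p)) (fun _ => 0)
    (fderiv ℝ (fun p => u (polarPoint c p))) (fun _ => 0) 0 (-Real.pi) r Real.pi
    (continuousOn_polar (fun z hz => (hu z hz).continuousAt.continuousWithinAt) hr0 hr)
    continuousOn_const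
    (fun p hp => by
      rw [min_eq_left hr0, max_eq_right hr0] at hp
      obtain ⟨P', h1, -⟩ := hDp p (Ioo_subset_Icc_self hp.1)
      exact h1.differentiableAt.hasFDerivAt)
    (fun p hp => hasFDerivAt_const _ _)
    (((hpolD r hr0 hr).integrableOn_compact (hcomp r hr0 hr)).congr_fun (fun p hp => by
      rw [uIcc_of_le hr0] at hp
      obtain ⟨P', h1, h2⟩ := hDp p hp.1
      simp [h1.fderiv, h2])
      (measurableSet_uIcc.prod measurableSet_uIcc))
  simp only [intervalIntegral.integral_zero, sub_zero, zero_add] at hdiv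
  have hc0 : ∀ θ : ℝ, polarPoint c (0, θ) = c := fun θ => by simp [polarPoint]
  simp only [hc0, intervalIntegral.integral_const] at hdiv
  have hle : ∫ s in (0 : ℝ)..r, ∫ θ in (-Real.pi)..Real.pi,
      (fderiv ℝ (fun p => u (polarPoint c p)) (s, θ) (1, 0) + (0 : ℝ × ℝ →L[ℝ] ℝ) (0, 1)) ≤
        ∫ s in (0 : ℝ)..r, Real.pi * N * s := by
    have heq : ∀ s ∈ uIcc 0 r, ∫ θ in (-Real.pi)..Real.pi,
        (fderiv ℝ (fun p => u (polarPoint c p)) (s, θ) (1, 0) + (0 : ℝ × ℝ →L[ℝ] ℝ) (0, 1)) =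
        ∫ θ in (-Real.pi)..Real.pi, fderiv ℝ u (polarPoint c (s, θ)) (E (s, θ)) := by
      intro s hs
      rw [uIcc_of_le hr0] at hs
      refine intervalIntegral.integral_congr fun θ _ => ?_
      obtain ⟨P', h1, h2⟩ := hDp (s, θ) hs
      simp [h1.fderiv, h2]
    rw [intervalIntegral.integral_congr heq]
    refine intervalIntegral.integral_mono_on_of_le_Ioo hr0
      ((hpolD r hr0 hr).intervalIntegrable_intervalIntegral hr0 hpi')
      (Continuous.intervalIntegrable (by fun_prop) _ _) fun s hs => ?_
    exact hflux s hs.1 (hs.2.trans hr)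
  rw [hdiv, intervalIntegral.integral_const_mul, integral_id] at hle
  simp only [smul_eq_mul] at hle
  linarith

/-- The mean value inequality on disks. -/
theorem ball_integral_le (hu : ∀ z ∈ Metric.ball c R, ContDiffAt ℝ 2 u z)
    (hN : ∀ z ∈ Metric.ball c R, laplacian u z ≤ N) {r : ℝ} (hr0 : 0 ≤ r) (hr : r < R) :
    ∫ z in Metric.ball c r, u z ≤ Real.pi * r ^ 2 * u c + Real.pi * N * r ^ 4 / 8 := by
  have hpi := Real.pi_pos
  have hpi' : -Real.pi ≤ Real.pi := by linarith
  have huc : ContinuousOn u (Metric.ball c R) :=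
    fun z hz => (hu z hz).continuousAt.continuousWithinAt
  have hK : ContinuousOn (fun p : ℝ × ℝ => p.1 * u (polarPoint c p))
      (uIcc 0 r ×ˢ uIcc (-Real.pi) Real.pi) :=
    continuousOn_fst.mul (continuousOn_polar huc hr0 hr)
  have h1 : ∫ z in Metric.ball c r, u z =
      ∫ s in (0 : ℝ)..r, ∫ θ in (-Real.pi)..Real.pi, s * u (polarPoint c (s, θ)) := by
    have e1 : ∫ z in Metric.ball c r, u z =
        ∫ z, (Metric.ball (0 : ℂ) r).indicator (fun z => u (c + z)) z := by
      rw [← integral_indicator measurableSet_ball, ← integral_add_left_eq_self _ c]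
      refine integral_congr_ae (Eventually.of_forall fun z => ?_)
      simp [indicator]
    rw [e1, ← Complex.integral_comp_polarCoord_symm]
    have e2 : ∀ p ∈ polarCoord.target, p.1 • (Metric.ball (0 : ℂ) r).indicator
        (fun z => u (c + z)) (Complex.polarCoord.symm p) =
        (Ioo 0 r ×ˢ Ioo (-Real.pi) Real.pi).indicator (fun p => p.1 * u (polarPoint c p)) p := by
      intro p hp
      rw [polarCoord_target] at hp
      have hp0 : 0 < p.1 := hp.1
      have e3 : Complex.polarCoord.symm p = p.1 * Complex.exp (p.2 * Complex.I) := by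
        rw [Complex.polarCoord_symm_apply, Complex.exp_mul_I]
        simp
      have e4 : Complex.polarCoord.symm p ∈ Metric.ball (0 : ℂ) r ↔
          p ∈ Ioo 0 r ×ˢ Ioo (-Real.pi) Real.pi := by
        rw [mem_ball_zero_iff, Complex.norm_polarCoord_symm, abs_of_pos hp0]
        exact ⟨fun h => ⟨⟨hp0, h⟩, hp.2⟩, fun h => h.1.2⟩
      by_cases h : Complex.polarCoord.symm p ∈ Metric.ball (0 : ℂ) r
      · rw [indicator_of_mem h, indicator_of_mem (e4.mp h), e3, polarPoint, smul_eq_mul]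
      · rw [indicator_of_notMem h, indicator_of_notMem (fun h' => h (e4.mpr h')), smul_zero]
    rw [setIntegral_congr_fun polarCoord.open_target.measurableSet e2,
      setIntegral_indicator (measurableSet_Ioo.prod measurableSet_Ioo), polarCoord_target,
      inter_eq_right.mpr (prod_mono Ioo_subset_Ioi_self subset_rfl), Measure.volume_eq_prod,
      setIntegral_prod]
    · rw [intervalIntegral.integral_of_le hr0, integral_Ioc_eq_integral_Ioo]
      simp only [intervalIntegral.integral_of_le hpi', integral_Ioc_eq_integral_Ioo]
    · rw [← Measure.volume_eq_prod]
      refine (hK.integrableOn_compact (isCompact_uIcc.prod isCompact_uIcc)).mono_set ?_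
      rw [uIcc_of_le hr0, uIcc_of_le hpi']
      exact prod_mono Ioo_subset_Icc_self Ioo_subset_Icc_self
  have h2 : ∫ s in (0 : ℝ)..r, ∫ θ in (-Real.pi)..Real.pi, s * u (polarPoint c (s, θ)) ≤
      ∫ s in (0 : ℝ)..r, ((2 * Real.pi * u c) * s + (Real.pi * N / 2) * s ^ 3) := by
    refine intervalIntegral.integral_mono_on hr0
      (hK.intervalIntegrable_intervalIntegral hr0 hpi')
      (Continuous.intervalIntegrable (by fun_prop) _ _) fun s hs => ?_
    rw [intervalIntegral.integral_const_mul]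
    have := mul_le_mul_of_nonneg_left (circle_integral_le hu hN hs.1 (hs.2.trans_lt hr)) hs.1
    refine this.trans (le_of_eq ?_)
    ring
  rw [h1]
  refine h2.trans (le_of_eq ?_)
  rw [intervalIntegral.integral_add (Continuous.intervalIntegrable (by fun_prop) _ _)
    (Continuous.intervalIntegrable (by fun_prop) _ _), intervalIntegral.integral_const_mul,
    intervalIntegral.integral_const_mul, integral_id, integral_pow]
  norm_num
  ring

/-- The Harnack inequality for nonnegative functions of bounded Laplacian on the unit disk. -/
theorem harnack_of_abs_laplacian_le {u : ℂ → ℝ} {N : ℝ}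
    (hu : ∀ z, ‖z‖ < 1 → ContDiffAt ℝ 2 u z) (h0 : ∀ z, ‖z‖ < 1 → 0 ≤ u z)
    (hN : ∀ z, ‖z‖ < 1 → |laplacian u z| ≤ N) {z : ℂ} (hz : ‖z‖ ≤ 1 / 4) :
    9 * u 0 ≤ 25 * u z + 2 * N := by
  have hpi := Real.pi_pos
  have hN0 : 0 ≤ N := (abs_nonneg _).trans (hN 0 (by simp))
  have hin : ∀ y ∈ Metric.ball z (3 / 4 : ℝ), ‖y‖ < 1 := by
    intro y hy
    rw [mem_ball_iff_norm] at hy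
    linarith [norm_le_norm_sub_add y z]
  have h1 := ball_integral_le (u := u) (c := z) (R := 3 / 4) (N := N) (r := 5 / 8)
    (fun y hy => hu y (hin y hy)) (fun y hy => (abs_le.mp (hN y (hin y hy))).2) (by norm_num)
    (by norm_num)
  have h2 := ball_integral_le (u := -u) (c := 0) (R := 1) (N := N) (r := 3 / 8)
    (fun y hy => (hu y (by simpa using hy)).neg)
    (fun y hy => by
      rw [InnerProductSpace.laplacian_neg]
      have := (abs_le.mp (hN y (by simpa using hy))).1
      simp only [Pi.neg_apply]
      linarith) (by norm_num) (by norm_num)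
  simp only [Pi.neg_apply, integral_neg] at h2
  have h3 : ∫ y in Metric.ball (0 : ℂ) (3 / 8), u y ≤ ∫ y in Metric.ball z (5 / 8), u y := by
    refine setIntegral_mono_set ?_ ?_ (LE.le.eventuallyLE ?_)
    · refine IntegrableOn.mono_set (ContinuousOn.integrableOn_compact
        (isCompact_closedBall z (5 / 8)) fun y hy => ?_) Metric.ball_subset_closedBall
      refine (hu y (hin y ?_)).continuousAt.continuousWithinAt
      exact Metric.closedBall_subset_ball (by norm_num) hy
    · refine (ae_restrict_iff' measurableSet_ball).mpr (Eventually.of_forall fun y hy => ?_)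
      exact h0 y (hin y (Metric.ball_subset_ball (by norm_num) hy))
    · refine Metric.ball_subset_ball' ?_
      rw [dist_zero_left]
      linarith
  have h4 : Real.pi * (9 * u 0) ≤ Real.pi * (25 * u z + 2 * N) := by
    nlinarith [mul_nonneg hpi.le hN0]
  exact le_of_mul_le_mul_left h4 hpi

end MeanValue

/-! ### Riemannian distance and completeness -/

namespace ConformalMetric

variable {h : ConformalMetric} {z w : ℂ}

theorem riemDist_le_pathLength {c : ℝ → ℂ} (hc : ContDiffOn ℝ 1 c (Icc 0 1))
    (hm : MapsTo c (Icc 0 1) unitDisk) (h0 : c 0 = z) (h1 : c 1 = w) :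
    h.riemDist z w ≤ h.pathLength c :=
  iInf₂_le c ⟨hc, hm, h0, h1⟩

theorem riemDist_le_of_segment {B : ℝ} (hD : segment ℝ z w ⊆ unitDisk)
    (hB : ∀ y ∈ segment ℝ z w, √(h.density y) ≤ B) :
    h.riemDist z w ≤ ENNReal.ofReal (B * ‖w - z‖) := by
  set c : ℝ → ℂ := fun t => z + t • (w - z)
  have hcs : ∀ t ∈ Icc (0 : ℝ) 1, c t ∈ segment ℝ z w := by
    intro t ht
    rw [segment_eq_image']
    exact ⟨t, ht, rfl⟩
  have hc : ContDiff ℝ 1 c := by fun_prop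
  have hd : ∀ t ∈ Icc (0 : ℝ) 1, derivWithin c (Icc 0 1) t = w - z := by
    intro t ht
    have : HasDerivAt c (w - z) t := by
      simpa [c] using ((hasDerivAt_id t).smul_const (w - z)).const_add z
    exact this.hasDerivWithinAt.derivWithin (uniqueDiffOn_Icc zero_lt_one t ht)
  refine (riemDist_le_pathLength hc.contDiffOn (fun t ht => hD (hcs t ht)) (by simp [c])
    (by simp [c])).trans ?_
  calc h.pathLength c ≤ ∫⁻ t in Icc (0 : ℝ) 1, ENNReal.ofReal (B * ‖w - z‖) := by
        refine setLIntegral_mono measurable_const fun t ht => ENNReal.ofReal_le_ofReal ?_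
        rw [hd t ht]
        exact mul_le_mul_of_nonneg_right (hB _ (hcs t ht)) (norm_nonneg _)
    _ = ENNReal.ofReal (B * ‖w - z‖) := by simp

/-- A function whose gradient has norm at most one for `h` is `1`-Lipschitz for the distance. -/
theorem ofReal_abs_sub_le_riemDist {ψ : ℂ → ℝ} (hψ : ContDiffOn ℝ 1 ψ unitDisk)
    (hle : ∀ y ∈ unitDisk, ‖fderiv ℝ ψ y‖ ≤ √(h.density y)) :
    ENNReal.ofReal |ψ w - ψ z| ≤ h.riemDist z w := by
  refine le_iInf₂ fun c ⟨hc, hm, h0, h1⟩ => ?_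
  have hcomp : ContDiffOn ℝ 1 (ψ ∘ c) (Icc 0 1) := hψ.comp hc hm
  have h2 := enorm_sub_le_lintegral_derivWithin_Icc_of_contDiffOn_Icc hcomp zero_le_one
  rw [Function.comp, Function.comp, h0, h1, Real.enorm_eq_ofReal_abs] at h2
  refine h2.trans (setLIntegral_mono' measurableSet_Icc fun t ht => ?_)
  have hψd : HasFDerivAt ψ (fderiv ℝ ψ (c t)) (c t) :=
    ((hψ.contDiffAt (isOpen_unitDisk.mem_nhds (hm ht))).differentiableAt (by norm_num)).hasFDerivAt
  have hcd : HasDerivWithinAt c (derivWithin c (Icc 0 1) t) (Icc 0 1) t :=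
    (hc.differentiableOn (by norm_num) t ht).hasDerivWithinAt
  rw [(hψd.comp_hasDerivWithinAt t hcd).derivWithin (uniqueDiffOn_Icc zero_lt_one t ht),
    Real.enorm_eq_ofReal_abs]
  refine ENNReal.ofReal_le_ofReal ?_
  refine ((fderiv ℝ ψ (c t)).le_opNorm _).trans ?_
  exact mul_le_mul_of_nonneg_right (hle _ (hm ht)) (norm_nonneg _)

/-- The length of a path does not increase under a monotone reparametrization. -/
theorem lintegral_comp_le_pathLength {c : ℝ → ℂ} (hc : ContDiffOn ℝ 1 c (Icc 0 1)) {φ : ℝ → ℝ}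
    (hφ : Differentiable ℝ φ) (hmono : Monotone φ) (hm : ∀ t, φ t ∈ Icc (0 : ℝ) 1) (a b : ℝ) :
    ∫⁻ t in Icc a b, ENNReal.ofReal (√(h.density (c (φ t))) * ‖deriv (fun t => c (φ t)) t‖) ≤
      h.pathLength c := by
  set G : ℝ → ℝ≥0∞ := fun s =>
    ENNReal.ofReal (√(h.density (c s)) * ‖derivWithin c (Icc 0 1) s‖)
  have hd : ∀ t, deriv (fun t => c (φ t)) t = deriv φ t • derivWithin c (Icc 0 1) (φ t) := by
    intro t
    have h1 : HasDerivWithinAt c (derivWithin c (Icc 0 1) (φ t)) (Icc 0 1) (φ t) :=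
      (hc.differentiableOn (by norm_num) _ (hm t)).hasDerivWithinAt
    have h2 := (hφ t).hasDerivAt.hasDerivWithinAt (s := univ)
    have h3 := h1.scomp t h2 (fun s _ => hm s)
    rw [hasDerivWithinAt_univ] at h3
    exact h3.deriv
  have hG : ∀ t, ENNReal.ofReal (√(h.density (c (φ t))) * ‖deriv (fun t => c (φ t)) t‖) =
      ENNReal.ofReal (deriv φ t) * G (φ t) := by
    intro t
    rw [hd, norm_smul, Real.norm_of_nonneg (hmono.deriv_nonneg),
      ← ENNReal.ofReal_mul hmono.deriv_nonneg]
    congr 1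
    ring
  simp only [hG]
  rw [← lintegral_image_eq_lintegral_deriv_mul_of_monotoneOn measurableSet_Icc
    (fun t _ => (hφ t).hasDerivAt.hasDerivWithinAt) (hmono.monotoneOn _) G]
  exact lintegral_mono_set (by rintro _ ⟨t, -, rfl⟩; exact hm t)

/-- The triangle inequality. Two `C¹` paths are joined after a reparametrization that makes them
stationary at their common endpoint. -/
theorem riemDist_triangle (z w y : ℂ) : h.riemDist z y ≤ h.riemDist z w + h.riemDist w y := by
  have key : ∀ c₁ : {c : ℝ → ℂ // ContDiffOn ℝ 1 c (Icc 0 1) ∧ MapsTo c (Icc 0 1) unitDisk ∧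
      c 0 = z ∧ c 1 = w}, ∀ c₂ : {c : ℝ → ℂ // ContDiffOn ℝ 1 c (Icc 0 1) ∧
      MapsTo c (Icc 0 1) unitDisk ∧ c 0 = w ∧ c 1 = y},
      h.riemDist z y ≤ h.pathLength c₁ + h.pathLength c₂ := by
    rintro ⟨c₁, hc₁, hm₁, h₁0, h₁1⟩ ⟨c₂, hc₂, hm₂, h₂0, h₂1⟩
    set φ₁ : ℝ → ℝ := fun t => Real.smoothTransition (2 * t)
    set φ₂ : ℝ → ℝ := fun t => Real.smoothTransition (2 * t - 1)
    have hφ₁ : ContDiff ℝ 1 φ₁ := Real.smoothTransition.contDiff.comp (by fun_prop)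
    have hφ₂ : ContDiff ℝ 1 φ₂ := Real.smoothTransition.contDiff.comp (by fun_prop)
    have hI₁ : ∀ t, φ₁ t ∈ Icc (0 : ℝ) 1 := fun t =>
      ⟨Real.smoothTransition.nonneg _, Real.smoothTransition.le_one _⟩
    have hI₂ : ∀ t, φ₂ t ∈ Icc (0 : ℝ) 1 := fun t =>
      ⟨Real.smoothTransition.nonneg _, Real.smoothTransition.le_one _⟩
    have hmono₁ : Monotone φ₁ := Real.smoothTransition.monotone.comp
      fun a b hab => by linarith
    have hmono₂ : Monotone φ₂ := Real.smoothTransition.monotone.comp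
      fun a b hab => by linarith
    set c : ℝ → ℂ := fun t => c₁ (φ₁ t) + c₂ (φ₂ t) - w
    have hl : ∀ t ≤ 1 / 2, c t = c₁ (φ₁ t) := by
      intro t ht
      have : φ₂ t = 0 := Real.smoothTransition.zero_of_nonpos (by linarith)
      simp [c, this, h₂0]
    have hr : ∀ t, 1 / 2 ≤ t → c t = c₂ (φ₂ t) := by
      intro t ht
      have : φ₁ t = 1 := Real.smoothTransition.one_of_one_le (by linarith)
      simp [c, this, h₁1]
    have hcc : ContDiff ℝ 1 c :=
      ((hc₁.comp_contDiff hφ₁ hI₁).add (hc₂.comp_contDiff hφ₂ hI₂)).sub contDiff_const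
    have hmaps : MapsTo c (Icc 0 1) unitDisk := by
      intro t _
      rcases le_total t (1 / 2) with ht | ht
      · rw [hl t ht]; exact hm₁ (hI₁ t)
      · rw [hr t ht]; exact hm₂ (hI₂ t)
    refine (riemDist_le_pathLength hcc.contDiffOn hmaps ?_ ?_).trans ?_
    · rw [hl 0 (by norm_num)]; simp [φ₁, h₁0]
    · rw [hr 1 (by norm_num)]
      simp [φ₂, show (2 : ℝ) - 1 = 1 by norm_num, h₂1]
    have hunion : Icc (0 : ℝ) 1 = Icc 0 (1 / 2) ∪ Icc (1 / 2) 1 :=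
      (Icc_union_Icc_eq_Icc (by norm_num) (by norm_num)).symm
    refine (lintegral_mono_set hunion.subset).trans
      ((lintegral_union_le _ _ _).trans (add_le_add ?_ ?_))
    · refine le_trans (le_of_eq ?_)
        (lintegral_comp_le_pathLength hc₁ (hφ₁.differentiable (by norm_num)) hmono₁ hI₁ 0 (1 / 2))
      rw [← restrict_Ioo_eq_restrict_Icc]
      refine setLIntegral_congr_fun measurableSet_Ioo fun t ht => ?_
      have e : c =ᶠ[𝓝 t] fun t => c₁ (φ₁ t) := by
        filter_upwards [Iio_mem_nhds ht.2] with s hs using hl s (le_of_lt hs)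
      rw [hl t ht.2.le,
        derivWithin_of_mem_nhds (Icc_mem_nhds ht.1 (by linarith [ht.2])), e.deriv_eq]
    · refine le_trans (le_of_eq ?_)
        (lintegral_comp_le_pathLength hc₂ (hφ₂.differentiable (by norm_num)) hmono₂ hI₂ (1 / 2) 1)
      rw [← restrict_Ioo_eq_restrict_Icc]
      refine setLIntegral_congr_fun measurableSet_Ioo fun t ht => ?_
      have e : c =ᶠ[𝓝 t] fun t => c₂ (φ₂ t) := by
        filter_upwards [Ioi_mem_nhds ht.1] with s hs using hr s (le_of_lt hs)
      rw [hr t ht.1.le,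
        derivWithin_of_mem_nhds (Icc_mem_nhds (by linarith [ht.1]) ht.2), e.deriv_eq]
  have h1 : ∀ a b : ℂ, h.riemDist a b = ⨅ c : {c : ℝ → ℂ // ContDiffOn ℝ 1 c (Icc 0 1) ∧
      MapsTo c (Icc 0 1) unitDisk ∧ c 0 = a ∧ c 1 = b}, h.pathLength c := fun a b => by
    rw [riemDist, iInf_subtype]
  rw [h1 z w, h1 w y]
  exact ENNReal.le_iInf_add_iInf fun c₁ c₂ => key c₁ c₂

theorem continuousOn_density : ContinuousOn h.density unitDisk := h.smooth.continuousOn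

theorem tendsto_riemDist_zero {x : ℕ → ℂ} {p : ℂ} (hp : p ∈ unitDisk)
    (hx : Tendsto x atTop (𝓝 p)) : Tendsto (fun n => h.riemDist (x n) p) atTop (𝓝 0) := by
  have hcont : ContinuousAt (fun y => √(h.density y)) p :=
    (h.continuousOn_density.continuousAt (isOpen_unitDisk.mem_nhds hp)).sqrt
  have hev : ∀ᶠ y in 𝓝 p, √(h.density y) < √(h.density p) + 1 ∧ y ∈ unitDisk :=
    (hcont.eventually_lt_const (by linarith)).and (isOpen_unitDisk.mem_nhds hp)
  obtain ⟨r, hr, hball⟩ := Metric.eventually_nhds_iff_ball.mp hev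
  set B := √(h.density p) + 1
  have hlim : Tendsto (fun n => ENNReal.ofReal (B * ‖p - x n‖)) atTop (𝓝 0) := by
    have h1 : Tendsto (fun n => B * ‖p - x n‖) atTop (𝓝 (B * ‖p - p‖)) :=
      ((tendsto_const_nhds.sub hx).norm).const_mul B
    rw [sub_self, norm_zero, mul_zero] at h1
    simpa using ENNReal.tendsto_ofReal h1
  refine tendsto_of_tendsto_of_tendsto_of_le_of_le' tendsto_const_nhds hlim
    (Eventually.of_forall fun _ => zero_le) ?_
  filter_upwards [hx.eventually (Metric.ball_mem_nhds p hr)] with n hn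
  have hseg : segment ℝ (x n) p ⊆ Metric.ball p r :=
    (convex_ball p r).segment_subset hn (Metric.mem_ball_self hr)
  exact riemDist_le_of_segment (fun y hy => (hball y (hseg hy)).2)
    fun y hy => (hball y (hseg hy)).1.le

/-- Convergence for the Riemannian distance implies convergence in the plane; a bump function
around the limit point serves as a Lipschitz function. -/
theorem tendsto_of_tendsto_riemDist {x : ℕ → ℂ} {p : ℂ} (hp : p ∈ unitDisk)
    (hx : Tendsto (fun n => h.riemDist (x n) p) atTop (𝓝 0)) : Tendsto x atTop (𝓝 p) := by
  rw [Metric.tendsto_nhds]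
  intro ε hε
  obtain ⟨r, hr, hball⟩ := Metric.nhds_basis_closedBall.mem_iff.mp (isOpen_unitDisk.mem_nhds hp)
  set s := min r ε
  have hs : 0 < s := lt_min hr hε
  have hsub : Metric.closedBall p s ⊆ unitDisk :=
    (Metric.closedBall_subset_closedBall (min_le_left _ _)).trans hball
  let f : ContDiffBump p := ⟨s / 2, s, by positivity, by linarith⟩
  have hfc : ContDiff ℝ 1 (f : ℂ → ℝ) := f.contDiff
  have hK : IsCompact (Metric.closedBall p s) := isCompact_closedBall p s
  obtain ⟨L, hL⟩ := (hK.image (hfc.continuous_fderiv (by norm_num)).norm).bddAbove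
  obtain ⟨y₀, hy₀, hmin⟩ := hK.exists_isMinOn ⟨p, Metric.mem_closedBall_self hs.le⟩
    ((h.continuousOn_density.mono hsub).sqrt)
  have hm : 0 < √(h.density y₀) := Real.sqrt_pos.mpr (h.pos _ (hsub hy₀))
  have hL0 : 0 ≤ L := (norm_nonneg _).trans (hL ⟨p, Metric.mem_closedBall_self hs.le, rfl⟩)
  set κ := √(h.density y₀) / (L + 1)
  have hκ : 0 < κ := by positivity
  have hlip : ∀ n, ENNReal.ofReal |κ * f p - κ * f (x n)| ≤ h.riemDist (x n) p := by
    intro n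
    refine ofReal_abs_sub_le_riemDist (ψ := fun y => κ * f y)
      (contDiff_const.mul hfc).contDiffOn fun y hy => ?_
    rw [fderiv_const_mul (hfc.differentiable (by norm_num) y), norm_smul,
      Real.norm_of_nonneg hκ.le]
    by_cases hyK : y ∈ Metric.closedBall p s
    · calc κ * ‖fderiv ℝ f y‖ ≤ κ * (L + 1) := by
            gcongr
            linarith [hL ⟨y, hyK, rfl⟩]
        _ = √(h.density y₀) := by simp only [κ]; field_simp
        _ ≤ √(h.density y) := hmin hyK
    · have : fderiv ℝ f y = 0 := by
        refine image_eq_zero_of_notMem_tsupport fun hmem => hyK ?_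
        have := tsupport_fderiv_subset ℝ hmem
        rwa [f.tsupport_eq] at this
      rw [this, norm_zero, mul_zero]
      exact Real.sqrt_nonneg _
  filter_upwards [hx.eventually_lt_const (ENNReal.ofReal_pos.mpr hκ)] with n hn
  by_contra hcon
  have hfx : f (x n) = 0 := by
    refine f.zero_of_le_dist ?_
    exact (min_le_right _ _).trans (not_lt.mp hcon)
  have h1 := (hlip n).trans_lt hn
  rw [hfx, f.one_of_mem_closedBall (Metric.mem_closedBall_self (by positivity)), mul_zero,
    sub_zero, mul_one, abs_of_pos hκ] at h1
  exact lt_irrefl _ h1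

/-- A metric bounded below by a multiple of the Poincaré metric is complete. -/
theorem isCompleteMetric_of_le {c : ℝ} (hc : 0 < c)
    (hle : ∀ z ∈ unitDisk, c * poincareMetric.density z ≤ h.density z) : h.IsCompleteMetric := by
  intro x hxD hcau
  have hsq : ∀ y ∈ unitDisk, √c * √(poincareMetric.density y) ≤ √(h.density y) := fun y hy => by
    rw [← Real.sqrt_mul hc.le]
    exact Real.sqrt_le_sqrt (hle y hy)
  have hsc : 0 < √c := Real.sqrt_pos.mpr hc
  have hlip : ∀ ψ : ℂ → ℝ, ContDiffOn ℝ 1 ψ unitDisk →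
      (∀ y ∈ unitDisk, ‖fderiv ℝ ψ y‖ ≤ √(poincareMetric.density y)) → ∀ z w,
      ENNReal.ofReal (√c * |ψ w - ψ z|) ≤ h.riemDist z w := by
    intro ψ hψ hle z w
    have := ofReal_abs_sub_le_riemDist (h := h) (z := z) (w := w) (ψ := fun y => √c * ψ y)
      (contDiffOn_const.mul hψ) fun y hy => by
        rw [fderiv_const_mul ((hψ.contDiffAt (isOpen_unitDisk.mem_nhds hy)).differentiableAt
          (by norm_num)), norm_smul, Real.norm_of_nonneg hsc.le]
        exact (mul_le_mul_of_nonneg_left (hle y hy) hsc.le).trans (hsq y hy)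
    rwa [← mul_sub, abs_mul, abs_of_pos hsc] at this
  have hone : ∀ y ∈ unitDisk, 1 ≤ √(poincareMetric.density y) := by
    intro y hy
    have h0 := one_sub_norm_sq_pos hy
    rw [sqrt_poincareMetric_density hy, le_div_iff₀ h0]
    nlinarith [norm_nonneg y]
  have hlipRe := hlip (fun y => y.re) Complex.reCLM.contDiff.contDiffOn fun y hy => by
    have : fderiv ℝ (fun y : ℂ => y.re) y = Complex.reCLM := Complex.reCLM.hasFDerivAt.fderiv
    rw [this]
    refine le_trans ?_ (hone y hy)
    exact ContinuousLinearMap.opNorm_le_bound _ zero_le_one fun e => by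
      simpa using Complex.abs_re_le_norm e
  have hlipIm := hlip (fun y => y.im) Complex.imCLM.contDiff.contDiffOn fun y hy => by
    have : fderiv ℝ (fun y : ℂ => y.im) y = Complex.imCLM := Complex.imCLM.hasFDerivAt.fderiv
    rw [this]
    refine le_trans ?_ (hone y hy)
    exact ContinuousLinearMap.opNorm_le_bound _ zero_le_one fun e => by
      simpa using Complex.abs_im_le_norm e
  have hlipF := hlip hypPotential contDiffOn_hypPotential fun y hy => norm_fderiv_hypPotential_le hy
  have hC : CauchySeq x := by
    rw [Metric.cauchySeq_iff]
    intro ε hε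
    obtain ⟨N, hN⟩ := hcau (ENNReal.ofReal (√c * (ε / 2))) (ENNReal.ofReal_pos.mpr (by positivity))
    refine ⟨N, fun m hm n hn => ?_⟩
    have hd := hN n hn m hm
    have h1 := lt_of_mul_lt_mul_left
      ((ENNReal.ofReal_lt_ofReal_iff (by positivity)).mp ((hlipRe _ _).trans_lt hd)) hsc.le
    have h2 := lt_of_mul_lt_mul_left
      ((ENNReal.ofReal_lt_ofReal_iff (by positivity)).mp ((hlipIm _ _).trans_lt hd)) hsc.le
    rw [Complex.dist_eq]
    refine (Complex.norm_le_abs_re_add_abs_im _).trans_lt ?_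
    rw [Complex.sub_re, Complex.sub_im]
    linarith
  obtain ⟨p, hp⟩ := cauchySeq_tendsto_of_complete hC
  obtain ⟨N, hN⟩ := hcau (ENNReal.ofReal √c) (ENNReal.ofReal_pos.mpr hsc)
  -- the sequence stays in a compact part of the disk, since the potential is bounded along it
  set F := hypPotential (x N) + 1
  have hbd : ∀ m ≥ N, Real.exp (-F) ≤ 1 - ‖x m‖ ^ 2 := by
    intro m hm
    have h0 := one_sub_norm_sq_pos (hxD m)
    have h1 := (hlipF _ _).trans_lt (hN N le_rfl m hm)
    have h2 := (ENNReal.ofReal_lt_ofReal_iff hsc).mp h1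
    have h3 : |hypPotential (x m) - hypPotential (x N)| < 1 := by
      by_contra! hcon
      nlinarith
    have h4 := (abs_lt.mp h3).2
    rw [← Real.le_log_iff_exp_le h0]
    simp only [F]
    have : hypPotential (x m) = -Real.log (1 - ‖x m‖ ^ 2) := rfl
    linarith
  have hpD : p ∈ unitDisk := by
    have hlim : Tendsto (fun m => 1 - ‖x m‖ ^ 2) atTop (𝓝 (1 - ‖p‖ ^ 2)) :=
      tendsto_const_nhds.sub (hp.norm.pow 2)
    have := ge_of_tendsto hlim (eventually_atTop.mpr ⟨N, hbd⟩)
    have h1 := Real.exp_pos (-F)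
    rw [mem_unitDisk_iff]
    by_contra! hcon
    nlinarith
  exact ⟨p, hpD, tendsto_riemDist_zero hpD hp⟩

end ConformalMetric

theorem mem_closedHypDisk_of_le {z : ℂ} {τ : ℝ} (hz : z ∈ unitDisk)
    (hτ : 2 / (1 - ‖z‖ ^ 2) ≤ τ) : z ∈ closedHypDisk τ := by
  have hseg : segment ℝ 0 z ⊆ Metric.closedBall (0 : ℂ) ‖z‖ :=
    (convex_closedBall _ _).segment_subset (by simp) (by simp)
  have hD : segment ℝ 0 z ⊆ unitDisk := fun y hy => by
    rw [mem_unitDisk_iff] at hz ⊢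
    exact (mem_closedBall_zero_iff.mp (hseg hy)).trans_lt hz
  have h0 := one_sub_norm_sq_pos hz
  refine ⟨hz, (ConformalMetric.riemDist_le_of_segment (B := 2 / (1 - ‖z‖ ^ 2)) hD
    fun y hy => ?_).trans (ENNReal.ofReal_le_ofReal ?_)⟩
  · rw [sqrt_poincareMetric_density (hD hy)]
    have := mem_closedBall_zero_iff.mp (hseg hy)
    gcongr
  · rw [sub_zero]
    have h1 := (mem_unitDisk_iff.mp hz).le
    have h2 : 0 ≤ 2 / (1 - ‖z‖ ^ 2) := by positivity
    nlinarith

/-! ### Estimates on the scale of the Poincaré metric -/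

section PoincareScale

open Laplacian

theorem norm_lt_of_norm_sub_lt {a y : ℂ} (hy : ‖y - a‖ < (1 - ‖a‖) / 2) :
    y ∈ unitDisk ∧ (1 - ‖a‖) / 2 ≤ 1 - ‖y‖ ^ 2 ∧ 1 - ‖y‖ ^ 2 ≤ 6 * ((1 - ‖a‖) / 2) := by
  have h1 := norm_le_norm_sub_add y a
  have h2 := norm_le_norm_sub_add a y
  rw [norm_sub_rev] at h2
  have h0 := norm_nonneg y
  have ha := norm_nonneg a
  have hy1 : ‖y‖ < 1 := by linarith [norm_nonneg (y - a)]
  refine ⟨mem_unitDisk_iff.mpr hy1, ?_, ?_⟩ <;> nlinarith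

/-- On the disk of radius `d = (1 - ‖a‖) / 2` around `a`, the Poincaré density is comparable to
`1 / d ^ 2`. -/
theorem poincareMetric_density_scale {a y : ℂ} (ha : a ∈ unitDisk)
    (hy : ‖y - a‖ < (1 - ‖a‖) / 2) :
    ((1 - ‖a‖) / 2) ^ 2 * poincareMetric.density y ≤ 4 ∧
      1 / 9 ≤ ((1 - ‖a‖) / 2) ^ 2 * poincareMetric.density y := by
  obtain ⟨hyD, h1, h2⟩ := norm_lt_of_norm_sub_lt hy
  have hd : 0 < (1 - ‖a‖) / 2 := by linarith [mem_unitDisk_iff.mp ha]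
  have h0 := one_sub_norm_sq_pos hyD
  rw [poincareMetric_density, mul_div_assoc', div_le_iff₀ (by positivity),
    le_div_iff₀ (by positivity)]
  constructor <;> nlinarith

theorem laplacian_comp_affine {V : ℂ → ℝ} {a b z : ℂ} (hV : ContDiffAt ℝ 2 V (a + b * z)) :
    laplacian (fun z => V (a + b * z)) z = ‖b‖ ^ 2 * laplacian V (a + b * z) := by
  have h := ContDiffAt.laplacian_comp_holomorphic (φ := fun z => a + b * z) hV (by fun_prop)
  have hd : deriv (fun z => a + b * z) z = b := by
    simp
  rw [hd] at h
  exact h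

theorem contDiffAt_comp_affine {V : ℂ → ℝ} {a b z : ℂ} (hV : ContDiffAt ℝ 2 V (a + b * z)) :
    ContDiffAt ℝ 2 (fun z => V (a + b * z)) z :=
  ContDiffAt.comp (g := V) (f := fun z => a + b * z) z hV (by fun_prop)

variable {v : ℂ → ℝ} {m N : ℝ}

/-- A bounded function with bounded Laplacian for the Poincaré metric has bounded gradient for it. -/
theorem abs_fderiv_le_sqrt_density (hv : ∀ z ∈ unitDisk, ContDiffAt ℝ 2 v z)
    (hm : ∀ z ∈ unitDisk, |v z| ≤ m)
    (hN : ∀ z ∈ unitDisk, |laplacian v z| ≤ N * poincareMetric.density z) {a : ℂ}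
    (ha : a ∈ unitDisk) {e : ℂ} (he : ‖e‖ = 1) :
    |fderiv ℝ v a e| ≤ 2 * (4 * m + 4 * N + 1) * √(poincareMetric.density a) := by
  have hm0 : 0 ≤ m := (abs_nonneg _).trans (hm a ha)
  have hN0 : 0 ≤ N := by
    have h1 := (abs_nonneg _).trans (hN a ha)
    exact nonneg_of_mul_nonneg_left h1 (poincareMetric_density_pos ha)
  have ha1 := mem_unitDisk_iff.mp ha
  set d := (1 - ‖a‖) / 2 with hd_def
  have hd : 0 < d := by simp only [d]; linarith
  set b : ℂ := d * e
  have hb : ‖b‖ = d := by simp [b, he, abs_of_pos hd]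
  have hin : ∀ z : ℂ, ‖z‖ < 1 → ‖(a + b * z) - a‖ < d := fun z hz => by
    rw [add_sub_cancel_left, norm_mul, hb]
    nlinarith
  have hinD : ∀ z : ℂ, ‖z‖ < 1 → a + b * z ∈ unitDisk := fun z hz =>
    (norm_lt_of_norm_sub_lt (hin z hz)).1
  have h := abs_fderiv_le_of_abs_laplacian_le (u := fun z => v (a + b * z)) (M := m) (N := 4 * N)
    (fun z hz => contDiffAt_comp_affine (hv _ (hinD z hz))) (fun z hz => hm _ (hinD z hz))
    (fun z hz => by
      rw [laplacian_comp_affine (hv _ (hinD z hz)), hb, abs_mul, abs_of_nonneg (by positivity)]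
      calc d ^ 2 * |laplacian v (a + b * z)| ≤ d ^ 2 * (N * poincareMetric.density (a + b * z)) := by
            gcongr; exact hN _ (hinD z hz)
        _ = N * (d ^ 2 * poincareMetric.density (a + b * z)) := by ring
        _ ≤ N * 4 := by
            gcongr; exact (poincareMetric_density_scale ha (hin z hz)).1
        _ = 4 * N := by ring)
  have hfd : fderiv ℝ (fun z => v (a + b * z)) 0 1 = d * fderiv ℝ v a e := by
    have h1 : HasFDerivAt v (fderiv ℝ v a) (a + b * 0) := by
      rw [mul_zero, add_zero]
      exact ((hv a ha).differentiableAt (by norm_num)).hasFDerivAt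
    have h2 : HasFDerivAt (fun z : ℂ => a + b * z)
        ((ContinuousLinearMap.toSpanSingleton ℂ b).restrictScalars ℝ) 0 := by
      have h3 : HasDerivAt (fun z : ℂ => a + b * z) b 0 := by
        simpa using ((hasDerivAt_id (0 : ℂ)).const_mul b).const_add a
      exact h3.hasFDerivAt.restrictScalars ℝ
    have h3 := (h1.comp (0 : ℂ) h2).fderiv
    simp only [Function.comp_def] at h3
    rw [h3]
    have hbe : b = d • e := by simp [b]
    rw [ContinuousLinearMap.comp_apply, ContinuousLinearMap.coe_restrictScalars',
      ContinuousLinearMap.toSpanSingleton_apply, one_smul, hbe, map_smul, smul_eq_mul]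
  rw [hfd, abs_mul, abs_of_pos hd] at h
  have h4 : 1 ≤ 2 * d * √(poincareMetric.density a) := by
    have h0 := one_sub_norm_sq_pos ha
    rw [sqrt_poincareMetric_density ha, mul_div_assoc', le_div_iff₀ h0]
    nlinarith [norm_nonneg a]
  have h5 : d * |fderiv ℝ v a e| ≤
      d * (2 * (4 * m + 4 * N + 1) * √(poincareMetric.density a)) := by
    calc d * |fderiv ℝ v a e| ≤ (4 * m + 4 * N + 1) * 1 := by linarith
      _ ≤ (4 * m + 4 * N + 1) * (2 * d * √(poincareMetric.density a)) := by gcongr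
      _ = _ := by ring
  exact le_of_mul_le_mul_left h5 hd

end PoincareScale

/-! ### A lower bound for complete metrics of bounded curvature -/

section LowerBound

open Laplacian

variable {h : ConformalMetric} {w : ℂ → ℝ} {m N W : ℝ}

/-- Where `w = log (h₀ / h)` is large, it increases by a definite amount along a segment that is
short for `h`: the Harnack inequality keeps `w` large near the point, and the maximum principle
provides the increase. -/
theorem exists_increase_of_large (hw : ∀ z ∈ unitDisk, ContDiffAt ℝ 2 w z)
    (hh : ∀ z ∈ unitDisk, h.density z = Real.exp (-w z) * poincareMetric.density z)
    (hm0 : 0 ≤ m) (hm : ∀ z ∈ unitDisk, -m ≤ w z)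
    (hN : ∀ z ∈ unitDisk, |laplacian w z| ≤ N * poincareMetric.density z)
    (hW : ∀ z ∈ unitDisk, W ≤ w z → poincareMetric.density z ≤ laplacian w z)
    {a : ℂ} (ha : a ∈ unitDisk) (hwa : 6 * m + 3 * N + 4 * |W| ≤ w a) :
    ∃ y ∈ unitDisk, w a + 1 / 1152 ≤ w y ∧
      h.riemDist a y ≤ ENNReal.ofReal (Real.exp (-(w a / 8))) ∧
      h.riemDist y a ≤ ENNReal.ofReal (Real.exp (-(w a / 8))) := by
  have hN0 : 0 ≤ N := by
    have h1 := (abs_nonneg _).trans (hN a ha)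
    exact nonneg_of_mul_nonneg_left h1 (poincareMetric_density_pos ha)
  have ha1 := mem_unitDisk_iff.mp ha
  set d := (1 - ‖a‖) / 2 with hd_def
  have hd : 0 < d := by simp only [d]; linarith
  have hb : ‖(d : ℂ)‖ = d := by simp [abs_of_pos hd]
  have hin : ∀ z : ℂ, ‖z‖ < 1 → ‖(a + d * z) - a‖ < d := fun z hz => by
    rw [add_sub_cancel_left, norm_mul, hb]
    nlinarith
  have hinD : ∀ z : ℂ, ‖z‖ < 1 → a + d * z ∈ unitDisk := fun z hz =>
    (norm_lt_of_norm_sub_lt (hin z hz)).1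
  have hlap : ∀ z : ℂ, ‖z‖ < 1 →
      laplacian (fun z => w (a + d * z)) z = d ^ 2 * laplacian w (a + d * z) := fun z hz => by
    rw [laplacian_comp_affine (hw _ (hinD z hz)), hb]
  have hlarge : ∀ z : ℂ, ‖z‖ ≤ 1 / 4 → w a / 4 ≤ w (a + d * z) := by
    intro z hz
    have hH := harnack_of_abs_laplacian_le (u := fun z => w (a + d * z) + m) (N := 4 * N)
      (fun z hz => (contDiffAt_comp_affine (hw _ (hinD z hz))).add contDiffAt_const)
      (fun z hz => by linarith [hm _ (hinD z hz)])
      (fun z hz => by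
        have h1 := (contDiffAt_comp_affine (hw _ (hinD z hz))).laplacian_add
          (contDiffAt_const (c := m))
        have h2 : laplacian (fun z => w (a + d * z) + m) z =
            laplacian (fun z => w (a + d * z)) z + laplacian (fun _ : ℂ => m) z := h1
        rw [h2, hlap z hz, InnerProductSpace.laplacian_const, Pi.zero_apply, add_zero, abs_mul,
          abs_of_nonneg (by positivity)]
        calc d ^ 2 * |laplacian w (a + d * z)|
            ≤ d ^ 2 * (N * poincareMetric.density (a + d * z)) := by
              gcongr; exact hN _ (hinD z hz)
          _ = N * (d ^ 2 * poincareMetric.density (a + d * z)) := by ring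
          _ ≤ N * 4 := by
              gcongr; exact (poincareMetric_density_scale ha (hin z hz)).1
          _ = 4 * N := by ring) hz
    simp only [mul_zero, add_zero] at hH
    linarith [abs_nonneg W]
  have hU : ∀ z : ℂ, ‖z‖ ≤ 1 / 4 → 1 / 9 ≤ laplacian (fun z => w (a + d * z)) z := by
    intro z hz
    have hz1 : ‖z‖ < 1 := by linarith
    rw [hlap z hz1]
    have h1 := hW _ (hinD z hz1) (by linarith [hlarge z hz, le_abs_self W])
    calc 1 / 9 ≤ d ^ 2 * poincareMetric.density (a + d * z) :=
          (poincareMetric_density_scale ha (hin z hz1)).2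
      _ ≤ _ := by gcongr
  -- subtract a small multiple of `‖z‖ ^ 2` and apply the maximum principle
  obtain ⟨z, hz, hza⟩ := exists_frontier_le_of_laplacian_pos
    (u := fun z => w (a + d * z) + (1 / 72 : ℝ) * ((1 : ℝ) - ‖z‖ ^ 2))
    (U := Metric.ball (0 : ℂ) (1 / 4)) Metric.isOpen_ball Metric.isBounded_ball
    (fun z hz => by
      rw [closure_ball _ (by norm_num), mem_closedBall_zero_iff] at hz
      exact ((contDiffAt_comp_affine (hw _ (hinD z (by linarith)))).add (contDiffAt_const.mul
        contDiff_one_sub_norm_sq.contDiffAt)).continuousAt.continuousWithinAt)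
    (fun z hz => by
      rw [mem_ball_zero_iff] at hz
      exact (contDiffAt_comp_affine (hw _ (hinD z (by linarith)))).add (contDiffAt_const.mul
        contDiff_one_sub_norm_sq.contDiffAt))
    (fun z hz => by
      rw [mem_ball_zero_iff] at hz
      have hc : ContDiffAt ℝ 2 (fun z : ℂ => (1 : ℝ) - ‖z‖ ^ 2) z :=
        contDiff_one_sub_norm_sq.contDiffAt
      have h1 := (contDiffAt_comp_affine (hw _ (hinD z (by linarith)))).laplacian_add
        (contDiffAt_const (c := (1 / 72 : ℝ)) |>.mul hc)
      have h2 : laplacian (fun z : ℂ => w (a + d * z) + (1 / 72 : ℝ) * ((1 : ℝ) - ‖z‖ ^ 2)) z =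
        laplacian (fun z => w (a + d * z)) z +
          laplacian (fun z : ℂ => (1 / 72 : ℝ) * ((1 : ℝ) - ‖z‖ ^ 2)) z := h1
      have h3 := InnerProductSpace.laplacian_smul (1 / 72 : ℝ) hc
      have h4 : laplacian (fun z : ℂ => (1 / 72 : ℝ) * ((1 : ℝ) - ‖z‖ ^ 2)) z =
        (1 / 72 : ℝ) • laplacian (fun z : ℂ => (1 : ℝ) - ‖z‖ ^ 2) z := h3
      rw [h2, h4, laplacian_one_sub_norm_sq]
      have := hU z hz.le
      norm_num at this ⊢
      linarith)
    (z := 0) (subset_closure (by simp))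
  rw [frontier_ball _ (by norm_num), mem_sphere_zero_iff_norm] at hz
  simp only [mul_zero, add_zero, norm_zero, hz] at hza
  have hz1 : ‖z‖ < 1 := by rw [hz]; norm_num
  have hseg : ∀ p ∈ segment ℝ a (a + d * z), ∃ t : ℂ, ‖t‖ ≤ 1 / 4 ∧ p = a + d * t := by
    intro p hp
    rw [segment_eq_image'] at hp
    obtain ⟨t, ht, rfl⟩ := hp
    refine ⟨t • z, ?_, ?_⟩
    · rw [norm_smul, Real.norm_of_nonneg ht.1, hz]
      linarith [ht.2]
    · simp; ring
  have hdens : ∀ p ∈ segment ℝ a (a + d * z),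
      p ∈ unitDisk ∧ √(h.density p) ≤ Real.exp (-(w a / 8)) * (2 / d) := by
    intro p hp
    obtain ⟨t, ht, rfl⟩ := hseg p hp
    have ht1 : ‖t‖ < 1 := by linarith
    have hD := hinD t ht1
    refine ⟨hD, ?_⟩
    have h0 := one_sub_norm_sq_pos hD
    rw [hh _ hD, Real.sqrt_mul (Real.exp_pos _).le, sqrt_poincareMetric_density hD,
      ← Real.exp_half]
    have h1 := (norm_lt_of_norm_sub_lt (hin t ht1)).2.1
    have h2 := hlarge t ht
    gcongr
    linarith
  have hlen : Real.exp (-(w a / 8)) * (2 / d) * ‖(a + d * z) - a‖ ≤ Real.exp (-(w a / 8)) := by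
    rw [add_sub_cancel_left, norm_mul, hb, hz]
    have : Real.exp (-(w a / 8)) * (2 / d) * (d * (1 / 4)) = Real.exp (-(w a / 8)) * (1 / 2) := by
      field_simp; norm_num
    rw [this]
    linarith [Real.exp_pos (-(w a / 8))]
  refine ⟨a + d * z, hinD z hz1, by norm_num at hza ⊢; linarith, ?_, ?_⟩
  · exact (ConformalMetric.riemDist_le_of_segment (fun p hp => (hdens p hp).1)
      fun p hp => (hdens p hp).2).trans (ENNReal.ofReal_le_ofReal hlen)
  · rw [segment_symm] at hdens
    refine (ConformalMetric.riemDist_le_of_segment (fun p hp => (hdens p hp).1)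
      fun p hp => (hdens p hp).2).trans (ENNReal.ofReal_le_ofReal ?_)
    rwa [norm_sub_rev]

theorem ConformalMetric.riemDist_self {h : ConformalMetric} {z : ℂ} (hz : z ∈ unitDisk) :
    h.riemDist z z = 0 := by
  have := h.riemDist_le_of_segment (z := z) (w := z) (B := √(h.density z)) (by simpa using hz)
    (by simp)
  simpa using this

/-- Points with geometrically decreasing successive distances form a Cauchy sequence. -/
theorem ConformalMetric.riemDist_le_geometric {h : ConformalMetric} {x : ℕ → ℂ} {q : ℝ}
    (hxD : ∀ n, x n ∈ unitDisk) (hq0 : 0 < q) (hq1 : q < 1)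
    (h1 : ∀ n, h.riemDist (x n) (x (n + 1)) ≤ ENNReal.ofReal (q ^ n))
    (h2 : ∀ n, h.riemDist (x (n + 1)) (x n) ≤ ENNReal.ofReal (q ^ n)) {k n : ℕ} (hkn : k ≤ n) :
    h.riemDist (x k) (x n) ≤ ENNReal.ofReal ((q ^ k - q ^ n) / (1 - q)) ∧
      h.riemDist (x n) (x k) ≤ ENNReal.ofReal ((q ^ k - q ^ n) / (1 - q)) := by
  induction n, hkn using Nat.le_induction with
  | base => simp [riemDist_self (hxD k)]
  | succ n hkn ih =>
    have hq : 0 < 1 - q := by linarith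
    have hpow : q ^ n ≤ q ^ k := pow_le_pow_of_le_one hq0.le hq1.le hkn
    have e : ENNReal.ofReal ((q ^ k - q ^ (n + 1)) / (1 - q)) =
        ENNReal.ofReal ((q ^ k - q ^ n) / (1 - q)) + ENNReal.ofReal (q ^ n) := by
      rw [← ENNReal.ofReal_add (div_nonneg (by linarith) hq.le) (by positivity)]
      congr 1
      field_simp
      ring
    rw [e]
    refine ⟨(riemDist_triangle _ (x n) _).trans (add_le_add ih.1 (h1 n)), ?_⟩
    exact ((riemDist_triangle _ (x n) _).trans (add_le_add (h2 n) ih.2)).trans_eq (add_comm _ _)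

/-- A complete metric which is bounded above by the Poincaré metric and has bounded curvature is
bounded below by it: otherwise a path of finite length would leave every compact set. -/
theorem bddAbove_of_isCompleteMetric (hcomp : h.IsCompleteMetric)
    (hw : ∀ z ∈ unitDisk, ContDiffAt ℝ 2 w z)
    (hh : ∀ z ∈ unitDisk, h.density z = Real.exp (-w z) * poincareMetric.density z)
    (hm0 : 0 ≤ m) (hm : ∀ z ∈ unitDisk, -m ≤ w z)
    (hN : ∀ z ∈ unitDisk, |laplacian w z| ≤ N * poincareMetric.density z)
    (hW : ∀ z ∈ unitDisk, W ≤ w z → poincareMetric.density z ≤ laplacian w z)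
    {a : ℂ} (ha : a ∈ unitDisk) : w a ≤ 6 * m + 3 * N + 4 * |W| := by
  by_contra! hcon
  set B := 6 * m + 3 * N + 4 * |W|
  have hN0 : 0 ≤ N := by
    have h1 := (abs_nonneg _).trans (hN a ha)
    exact nonneg_of_mul_nonneg_left h1 (poincareMetric_density_pos ha)
  have hB0 : 0 ≤ B := by positivity
  let S := {y : ℂ // y ∈ unitDisk ∧ B ≤ w y}
  have hstep : ∀ y : S, ∃ y' : S, w y + 1 / 1152 ≤ w y' ∧
      h.riemDist y y' ≤ ENNReal.ofReal (Real.exp (-(w y / 8))) ∧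
      h.riemDist y' y ≤ ENNReal.ofReal (Real.exp (-(w y / 8))) := by
    rintro ⟨y, hy, hBy⟩
    obtain ⟨y', hy', h1, h2⟩ := exists_increase_of_large hw hh hm0 hm hN hW hy hBy
    exact ⟨⟨y', hy', by linarith⟩, h1, h2⟩
  choose f hf1 hf2 hf3 using hstep
  let x : ℕ → S := fun n => f^[n] ⟨a, ha, hcon.le⟩
  have hx : ∀ n, x (n + 1) = f (x n) := fun n => Function.iterate_succ_apply' f n _
  have hxw : ∀ n : ℕ, (n : ℝ) * (1 / 1152) ≤ w (x n) := by
    intro n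
    induction n with
    | zero => simpa using hB0.trans (x 0).2.2
    | succ n ih =>
      rw [hx]
      push_cast
      linarith [hf1 (x n)]
  set q := Real.exp (-(1 / 1152 / 8))
  have hq0 : 0 < q := Real.exp_pos _
  have hq1 : q < 1 := by simp only [q]; rw [Real.exp_lt_one_iff]; norm_num
  have hxq : ∀ n : ℕ, Real.exp (-(w (x n) / 8)) ≤ q ^ n := by
    intro n
    rw [← Real.exp_nat_mul]
    refine Real.exp_le_exp.mpr ?_
    linarith [hxw n]
  have hgeo := fun k n => ConformalMetric.riemDist_le_geometric (h := h) (x := fun n => (x n : ℂ))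
    (k := k) (n := n) (fun n => (x n).2.1) hq0 hq1
    (fun n => by
      rw [hx]; exact (hf2 (x n)).trans (ENNReal.ofReal_le_ofReal (hxq n)))
    (fun n => by
      rw [hx]; exact (hf3 (x n)).trans (ENNReal.ofReal_le_ofReal (hxq n)))
  have hlim : Tendsto (fun k => ENNReal.ofReal (q ^ k / (1 - q))) atTop (𝓝 0) := by
    have h1 := (tendsto_pow_atTop_nhds_zero_of_lt_one hq0.le hq1).div_const (1 - q)
    rw [zero_div] at h1
    simpa using ENNReal.tendsto_ofReal h1
  obtain ⟨p, hp, hxp⟩ := hcomp (fun n => x n) (fun n => (x n).2.1) fun δ hδ => by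
    obtain ⟨K, hK⟩ := eventually_atTop.mp (hlim.eventually_lt_const hδ)
    have hbound : ∀ k ≥ K, ∀ n : ℕ, ENNReal.ofReal ((q ^ k - q ^ n) / (1 - q)) < δ := by
      intro k hk n
      refine (ENNReal.ofReal_le_ofReal ?_).trans_lt (hK k hk)
      have : 0 < 1 - q := by linarith
      gcongr
      linarith [pow_pos hq0 n]
    refine ⟨K, fun k hk n hn => ?_⟩
    rcases le_total k n with hkn | hkn
    · exact (hgeo k n hkn).1.trans_lt (hbound k hk n)
    · exact (hgeo n k hkn).2.trans_lt (hbound n hn k)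
  have hxt := ConformalMetric.tendsto_of_tendsto_riemDist hp hxp
  have hwt : Tendsto (fun n => w (x n)) atTop (𝓝 (w p)) := (hw p hp).continuousAt.tendsto.comp hxt
  refine not_tendsto_nhds_of_tendsto_atTop ?_ _ hwt
  exact tendsto_atTop_mono hxw (tendsto_natCast_atTop_atTop.atTop_mul_const (by norm_num))

end LowerBound

/-! ### Möbius transformations of the disk -/

section Mobius

open ComplexConjugate

/-- The Möbius map `z ↦ (α z + β) / (β̄ z + ᾱ)`. -/
noncomputable def mobius (α β z : ℂ) : ℂ := (α * z + β) / (conj β * z + conj α)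

/-- The entry `α` of the matrix of `SU(1, 1)` that corresponds to `A` under the Cayley transform. -/
noncomputable def coeffA (A : SL(2, ℝ)) : ℂ :=
  (((A 0 0 + A 1 1 : ℝ) : ℂ) + ((A 0 1 - A 1 0 : ℝ) : ℂ) * Complex.I) / 2

/-- The entry `β` of the matrix of `SU(1, 1)` that corresponds to `A` under the Cayley transform. -/
noncomputable def coeffB (A : SL(2, ℝ)) : ℂ :=
  (((A 0 0 - A 1 1 : ℝ) : ℂ) - ((A 0 1 + A 1 0 : ℝ) : ℂ) * Complex.I) / 2

theorem diskMobius_eq_mobius (A : SL(2, ℝ)) (z : ℂ) :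
    diskMobius A z = mobius (coeffA A) (coeffB A) z := rfl

theorem diskAct_mk (A : SL(2, ℝ)) :
    diskAct (QuotientGroup.mk A : PSL(2, ℝ)) = diskMobius A := rfl

theorem coeffA_re (A : SL(2, ℝ)) : (coeffA A).re = (A 0 0 + A 1 1) / 2 := by simp [coeffA]

theorem coeffA_im (A : SL(2, ℝ)) : (coeffA A).im = (A 0 1 - A 1 0) / 2 := by simp [coeffA]

theorem coeffB_re (A : SL(2, ℝ)) : (coeffB A).re = (A 0 0 - A 1 1) / 2 := by simp [coeffB]

theorem coeffB_im (A : SL(2, ℝ)) : (coeffB A).im = -(A 0 1 + A 1 0) / 2 := by simp [coeffB]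

theorem normSq_coeff_sub (A : SL(2, ℝ)) :
    Complex.normSq (coeffA A) - Complex.normSq (coeffB A) = 1 := by
  have h := A.det_coe
  rw [Matrix.det_fin_two] at h
  rw [Complex.normSq_apply, Complex.normSq_apply, coeffA_re, coeffA_im, coeffB_re, coeffB_im]
  linear_combination h

theorem coeffA_mul (A B : SL(2, ℝ)) :
    coeffA (A * B) = coeffA A * coeffA B + coeffB A * conj (coeffB B) := by
  apply Complex.ext <;>
  simp [coeffA_re, coeffA_im, coeffB_re, coeffB_im, Matrix.mul_apply, Fin.sum_univ_two] <;> ring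

theorem coeffB_mul (A B : SL(2, ℝ)) :
    coeffB (A * B) = coeffA A * coeffB B + coeffB A * conj (coeffA B) := by
  apply Complex.ext <;>
  simp [coeffA_re, coeffA_im, coeffB_re, coeffB_im, Matrix.mul_apply, Fin.sum_univ_two] <;> ring

variable {α β : ℂ}

theorem normSq_denom_sub (h : Complex.normSq α - Complex.normSq β = 1) (z : ℂ) :
    Complex.normSq (conj β * z + conj α) - Complex.normSq (α * z + β) = 1 - ‖z‖ ^ 2 := by
  rw [← Complex.normSq_eq_norm_sq]
  simp only [Complex.normSq_apply, Complex.add_re, Complex.mul_re, Complex.conj_re,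
    Complex.conj_im, Complex.add_im, Complex.mul_im] at h ⊢
  linear_combination (1 - (z.re * z.re + z.im * z.im)) * h

theorem mobius_denom_ne_zero (h : Complex.normSq α - Complex.normSq β = 1) {z : ℂ}
    (hz : z ∈ unitDisk) : conj β * z + conj α ≠ 0 := by
  intro h0
  have h1 := normSq_denom_sub h z
  rw [h0, map_zero] at h1
  linarith [one_sub_norm_sq_pos hz, Complex.normSq_nonneg (α * z + β)]

theorem one_sub_norm_mobius_sq (h : Complex.normSq α - Complex.normSq β = 1) {z : ℂ}
    (hz : z ∈ unitDisk) :
    1 - ‖mobius α β z‖ ^ 2 = (1 - ‖z‖ ^ 2) / ‖conj β * z + conj α‖ ^ 2 := by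
  have hd := mobius_denom_ne_zero h hz
  have hd' : ‖conj β * z + conj α‖ ≠ 0 := norm_ne_zero_iff.mpr hd
  rw [← normSq_denom_sub h z, mobius, norm_div, Complex.normSq_eq_norm_sq,
    Complex.normSq_eq_norm_sq, div_pow, sub_div, div_self (pow_ne_zero 2 hd')]

theorem mobius_mem_unitDisk (h : Complex.normSq α - Complex.normSq β = 1) {z : ℂ}
    (hz : z ∈ unitDisk) : mobius α β z ∈ unitDisk := by
  have h1 := one_sub_norm_mobius_sq h hz
  have hd := norm_pos_iff.mpr (mobius_denom_ne_zero h hz)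
  have h2 : 0 < 1 - ‖mobius α β z‖ ^ 2 := by
    rw [h1]; exact div_pos (one_sub_norm_sq_pos hz) (by positivity)
  rw [mem_unitDisk_iff, ← sq_lt_one_iff₀ (norm_nonneg _)]
  linarith

theorem analyticAt_mobius (h : Complex.normSq α - Complex.normSq β = 1) {z : ℂ}
    (hz : z ∈ unitDisk) : AnalyticAt ℂ (mobius α β) z := by
  refine AnalyticAt.div (f := fun z => α * z + β) (g := fun z => conj β * z + conj α)
    (by fun_prop) (by fun_prop) (mobius_denom_ne_zero h hz)

theorem norm_deriv_mobius (h : Complex.normSq α - Complex.normSq β = 1) {z : ℂ}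
    (hz : z ∈ unitDisk) : ‖deriv (mobius α β) z‖ = 1 / ‖conj β * z + conj α‖ ^ 2 := by
  have hd := mobius_denom_ne_zero h hz
  have h1 : HasDerivAt (fun z => α * z + β) α z := by
    simpa using ((hasDerivAt_id z).const_mul α).add_const β
  have h2 : HasDerivAt (fun z => conj β * z + conj α) (conj β) z := by
    simpa using ((hasDerivAt_id z).const_mul (conj β)).add_const (conj α)
  have h3 := (h1.fun_div h2 hd).deriv
  have h4 : α * (conj β * z + conj α) - (α * z + β) * conj β = 1 := by
    have e1 : α * conj α - β * conj β = 1 := by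
      rw [Complex.mul_conj, Complex.mul_conj]
      exact_mod_cast h
    linear_combination e1
  rw [h4] at h3
  change ‖deriv (fun z => (α * z + β) / (conj β * z + conj α)) z‖ = _
  rw [h3, norm_div, norm_one, norm_pow]

theorem density_mobius (h : Complex.normSq α - Complex.normSq β = 1) {z : ℂ}
    (hz : z ∈ unitDisk) :
    poincareMetric.density (mobius α β z) * ‖deriv (mobius α β) z‖ ^ 2 =
      poincareMetric.density z := by
  have hd := norm_pos_iff.mpr (mobius_denom_ne_zero h hz)
  have h0 := one_sub_norm_sq_pos hz
  rw [poincareMetric_density, poincareMetric_density, one_sub_norm_mobius_sq h hz,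
    norm_deriv_mobius h hz]
  field_simp

theorem norm_mobius_sub_sq_le (h : Complex.normSq α - Complex.normSq β = 1) {y z : ℂ}
    (hy : y ∈ unitDisk) (hz : z ∈ unitDisk) :
    ‖mobius α β y - mobius α β z‖ ^ 2 ≤ ‖y - z‖ ^ 2 / ((1 - ‖y‖ ^ 2) * (1 - ‖z‖ ^ 2)) := by
  have hdy := mobius_denom_ne_zero h hy
  have hdz := mobius_denom_ne_zero h hz
  have e1 : α * conj α - β * conj β = 1 := by
    rw [Complex.mul_conj, Complex.mul_conj]
    exact_mod_cast h
  have e2 : mobius α β y - mobius α β z =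
      (y - z) / ((conj β * y + conj α) * (conj β * z + conj α)) := by
    rw [mobius, mobius, div_sub_div _ _ hdy hdz]
    congr 1
    linear_combination (y - z) * e1
  have hny := norm_pos_iff.mpr hdy
  have hnz := norm_pos_iff.mpr hdz
  have h0y := one_sub_norm_sq_pos hy
  have h0z := one_sub_norm_sq_pos hz
  have e3 : ‖mobius α β y - mobius α β z‖ ^ 2 =
      ‖y - z‖ ^ 2 / ((1 - ‖y‖ ^ 2) * (1 - ‖z‖ ^ 2)) *
        ((1 - ‖mobius α β y‖ ^ 2) * (1 - ‖mobius α β z‖ ^ 2)) := by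
    rw [one_sub_norm_mobius_sq h hy, one_sub_norm_mobius_sq h hz, e2, norm_div, norm_mul]
    field_simp
  rw [e3]
  refine mul_le_of_le_one_right (by positivity) ?_
  have a1 := one_sub_norm_sq_pos (mobius_mem_unitDisk h hy)
  have a2 := one_sub_norm_sq_pos (mobius_mem_unitDisk h hz)
  nlinarith [sq_nonneg ‖mobius α β y‖, sq_nonneg ‖mobius α β z‖]

theorem exists_diskAct_eq_mobius (g : PSL(2, ℝ)) :
    ∃ α β : ℂ, Complex.normSq α - Complex.normSq β = 1 ∧ diskAct g = mobius α β := by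
  obtain ⟨A, rfl⟩ := QuotientGroup.mk_surjective g
  exact ⟨coeffA A, coeffB A, normSq_coeff_sub A, funext fun z => diskMobius_eq_mobius A z⟩

theorem diskAct_mem_unitDisk (g : PSL(2, ℝ)) {z : ℂ} (hz : z ∈ unitDisk) :
    diskAct g z ∈ unitDisk := by
  obtain ⟨α, β, h, e⟩ := exists_diskAct_eq_mobius g
  rw [e]; exact mobius_mem_unitDisk h hz

theorem analyticAt_diskAct (g : PSL(2, ℝ)) {z : ℂ} (hz : z ∈ unitDisk) :
    AnalyticAt ℂ (diskAct g) z := by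
  obtain ⟨α, β, h, e⟩ := exists_diskAct_eq_mobius g
  rw [e]; exact analyticAt_mobius h hz

theorem density_diskAct (g : PSL(2, ℝ)) {z : ℂ} (hz : z ∈ unitDisk) :
    poincareMetric.density (diskAct g z) * ‖deriv (diskAct g) z‖ ^ 2 =
      poincareMetric.density z := by
  obtain ⟨α, β, h, e⟩ := exists_diskAct_eq_mobius g
  rw [e]; exact density_mobius h hz

/-- The maps of the group are equicontinuous on the disk. -/
theorem norm_diskAct_sub_sq_le (g : PSL(2, ℝ)) {y z : ℂ} (hy : y ∈ unitDisk) (hz : z ∈ unitDisk) :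
    ‖diskAct g y - diskAct g z‖ ^ 2 ≤ ‖y - z‖ ^ 2 / ((1 - ‖y‖ ^ 2) * (1 - ‖z‖ ^ 2)) := by
  obtain ⟨α, β, h, e⟩ := exists_diskAct_eq_mobius g
  rw [e]; exact norm_mobius_sub_sq_le h hy hz

theorem diskAct_one (z : ℂ) : diskAct 1 z = z := by
  change diskMobius 1 z = z
  simp [diskMobius]

theorem diskAct_mul (g₁ g₂ : PSL(2, ℝ)) {z : ℂ} (hz : z ∈ unitDisk) :
    diskAct (g₁ * g₂) z = diskAct g₁ (diskAct g₂ z) := by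
  obtain ⟨A, rfl⟩ := QuotientGroup.mk_surjective g₁
  obtain ⟨B, rfl⟩ := QuotientGroup.mk_surjective g₂
  rw [← QuotientGroup.mk_mul, diskAct_mk, diskAct_mk, diskAct_mk, diskMobius_eq_mobius,
    diskMobius_eq_mobius, diskMobius_eq_mobius]
  have hB := mobius_denom_ne_zero (normSq_coeff_sub B) hz
  have hA := mobius_denom_ne_zero (normSq_coeff_sub A)
    (mobius_mem_unitDisk (normSq_coeff_sub B) hz)
  have hAB := mobius_denom_ne_zero (normSq_coeff_sub (A * B)) hz
  have hz' : mobius (coeffA B) (coeffB B) z * (conj (coeffB B) * z + conj (coeffA B)) =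
      coeffA B * z + coeffB B := div_mul_cancel₀ _ hB
  set y := mobius (coeffA B) (coeffB B) z
  rw [mobius, mobius, div_eq_div_iff hAB hA, coeffA_mul, coeffB_mul]
  simp only [map_add, map_mul, Complex.conj_conj]
  linear_combination (-(conj (coeffA A) * coeffA A) + coeffB A * conj (coeffB A)) * hz'

end Mobius

/-! ### Equivariant extension -/

section Extension

variable {Γ : Type*} [Group Γ] {ρ : Γ →* PSL(2, ℝ)}

/-- A function which is constant outside a ball contained in a fundamental domain extends from the
ball to an invariant function; near every point of the disk the extension is a translate of the
function. The margin between the two radii `r` and `r'` and the equicontinuity of the action make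
the union of the translates of the smaller ball closed. -/
theorem exists_equivariant_extension {r r' q : ℝ} (hr : r < r') {u : ℂ → ℝ}
    (hu : ∀ z ∈ unitDisk, r ≤ ‖z‖ → u z = q)
    (hdisj : ∀ γ : Γ, γ ≠ 1 →
      Disjoint (Metric.ball (0 : ℂ) r') (diskAct (ρ γ) '' Metric.ball 0 r')) :
    ∃ U : ℂ → ℝ, (∀ z ∈ unitDisk, ∃ γ : Γ, U =ᶠ[𝓝 z] fun y => u (diskAct (ρ γ) y)) ∧
      (∀ γ : Γ, ∀ z ∈ unitDisk, U (diskAct (ρ γ) z) = U z) ∧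
      ∀ z ∈ unitDisk, ‖z‖ < r' → U z = u z := by
  classical
  have huniq : ∀ z ∈ unitDisk, ∀ γ γ' : Γ, ‖diskAct (ρ γ) z‖ < r' → ‖diskAct (ρ γ') z‖ < r' →
      γ = γ' := by
    intro z hz γ γ' h1 h2
    by_contra hne
    have hne' : γ' * γ⁻¹ ≠ 1 := fun h => hne (mul_inv_eq_one.mp h).symm
    refine disjoint_left.mp (hdisj _ hne') (mem_ball_zero_iff.mpr h2)
      ⟨diskAct (ρ γ) z, mem_ball_zero_iff.mpr h1, ?_⟩
    rw [← diskAct_mul _ _ hz, ← map_mul, inv_mul_cancel_right]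
  let U : ℂ → ℝ := fun z =>
    if h : ∃ γ : Γ, ‖diskAct (ρ γ) z‖ < r' then u (diskAct (ρ h.choose) z) else q
  have hU : ∀ z ∈ unitDisk, ∀ γ : Γ, ‖diskAct (ρ γ) z‖ < r' → U z = u (diskAct (ρ γ) z) := by
    intro z hz γ hγ
    have h : ∃ γ : Γ, ‖diskAct (ρ γ) z‖ < r' := ⟨γ, hγ⟩
    simp only [U, dif_pos h]
    rw [huniq z hz _ γ h.choose_spec hγ]
  have hUq : ∀ z ∈ unitDisk, (∀ γ : Γ, r ≤ ‖diskAct (ρ γ) z‖) → U z = q := by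
    intro z hz hall
    by_cases h : ∃ γ : Γ, ‖diskAct (ρ γ) z‖ < r'
    · obtain ⟨γ, hγ⟩ := h
      rw [hU z hz γ hγ]
      exact hu _ (diskAct_mem_unitDisk _ hz) (hall γ)
    · simp only [U, dif_neg h]
  refine ⟨U, fun z hz => ?_, fun γ z hz => ?_, fun z hz hzr => ?_⟩
  · by_cases h : ∃ γ : Γ, ‖diskAct (ρ γ) z‖ < r'
    · obtain ⟨γ, hγ⟩ := h
      refine ⟨γ, ?_⟩
      have hc := (analyticAt_diskAct (ρ γ) hz).continuousAt.norm
      filter_upwards [hc.eventually_lt_const hγ, isOpen_unitDisk.mem_nhds hz] with y hy hyD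
      exact hU y hyD γ hy
    · refine ⟨1, ?_⟩
      simp only [not_exists, not_lt] at h
      have hc : ContinuousAt (fun y : ℂ => ‖y - z‖ ^ 2 / ((1 - ‖y‖ ^ 2) * (1 - ‖z‖ ^ 2))) z := by
        refine ContinuousAt.div (by fun_prop) (by fun_prop) ?_
        have := one_sub_norm_sq_pos hz
        positivity
      have h0 : (fun y : ℂ => ‖y - z‖ ^ 2 / ((1 - ‖y‖ ^ 2) * (1 - ‖z‖ ^ 2))) z < (r' - r) ^ 2 := by
        have : 0 < r' - r := by linarith
        simp only [sub_self, norm_zero]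
        norm_num
        positivity
      filter_upwards [hc.eventually_lt_const h0, isOpen_unitDisk.mem_nhds hz] with y hy hyD
      have hall : ∀ γ : Γ, r ≤ ‖diskAct (ρ γ) y‖ := by
        intro γ
        have h1 := (norm_diskAct_sub_sq_le (ρ γ) hyD hz).trans_lt hy
        have h2 := lt_of_pow_lt_pow_left₀ 2 (by linarith) h1
        have h3 := norm_le_norm_sub_add (diskAct (ρ γ) z) (diskAct (ρ γ) y)
        rw [norm_sub_rev] at h3
        linarith [h γ]
      rw [hUq y hyD hall]
      exact (hu _ (diskAct_mem_unitDisk _ hyD) (hall 1)).symm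
  · have hγz := diskAct_mem_unitDisk (ρ γ) hz
    have hback : ∀ γ' : Γ, diskAct (ρ (γ' * γ⁻¹)) (diskAct (ρ γ) z) = diskAct (ρ γ') z := by
      intro γ'
      rw [← diskAct_mul _ _ hz, ← map_mul, inv_mul_cancel_right]
    by_cases h : ∃ γ : Γ, ‖diskAct (ρ γ) z‖ < r'
    · obtain ⟨γ', hγ'⟩ := h
      rw [hU z hz γ' hγ', hU _ hγz (γ' * γ⁻¹) (by rwa [hback]), hback]
    · simp only [not_exists, not_lt] at h
      rw [hUq z hz fun γ' => hr.le.trans (h γ'), hUq _ hγz fun γ' => ?_]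
      rw [← diskAct_mul _ _ hz, ← map_mul]
      exact hr.le.trans (h _)
  · have := hU z hz 1 (by rwa [map_one, diskAct_one])
    rwa [map_one, diskAct_one] at this

end Extension

/-! ### A smooth step function -/

section Step

theorem hasDerivAt_expNegInvGlue (x : ℝ) :
    HasDerivAt expNegInvGlue (x⁻¹ ^ 2 * expNegInvGlue x) x := by
  have h := expNegInvGlue.hasDerivAt_polynomial_eval_inv_mul 1 x
  simpa using h

theorem hasDerivAt_deriv_expNegInvGlue (x : ℝ) :
    HasDerivAt (deriv expNegInvGlue) ((x⁻¹ ^ 4 - 2 * x⁻¹ ^ 3) * expNegInvGlue x) x := by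
  have h := expNegInvGlue.hasDerivAt_polynomial_eval_inv_mul (Polynomial.X ^ 2) x
  have e : deriv expNegInvGlue = fun x => x⁻¹ ^ 2 * expNegInvGlue x :=
    funext fun x => (hasDerivAt_expNegInvGlue x).deriv
  rw [e]
  simp only [Polynomial.eval_pow, Polynomial.eval_X, Polynomial.eval_mul, Polynomial.eval_sub,
    Polynomial.derivative_X_pow] at h
  refine h.congr_deriv ?_
  rw [Polynomial.eval_C, show (2 : ℕ) - 1 = 1 from rfl]
  push_cast
  ring

theorem expNegInvGlue_le_one (x : ℝ) : expNegInvGlue x ≤ 1 := by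
  rcases le_or_gt x 0 with hx | hx
  · rw [expNegInvGlue.zero_of_nonpos hx]; exact zero_le_one
  · simp only [expNegInvGlue, not_le.mpr hx, if_false]
    exact Real.exp_le_one_iff.mpr (by simpa using hx.le)

/-- A smooth step function, whose second derivative is bounded below by a negative multiple of the
function itself: near the left end of the step it is `exp (-1 / x)`. -/
theorem exists_smooth_step : ∃ (s : ℝ → ℝ) (C : ℝ), 0 < C ∧ ContDiff ℝ ∞ s ∧
    (∀ x ≤ 0, s x = 0) ∧ (∀ x, 2 ≤ x → s x = 1) ∧ (∀ x, 0 ≤ s x ∧ s x ≤ 1) ∧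
    (∀ x, 0 ≤ deriv s x ∧ deriv s x ≤ C) ∧ (∀ x, |deriv (deriv s) x| ≤ C) ∧
    ∀ x, -(C * s x) ≤ deriv (deriv s) x := by
  set T : ℝ → ℝ := fun x => Real.smoothTransition (x - 1)
  set s : ℝ → ℝ := fun x => 1 - (1 - expNegInvGlue x) * (1 - T x)
  have hT : ContDiff ℝ ∞ T := Real.smoothTransition.contDiff.comp (by fun_prop)
  have hE : ContDiff ℝ ∞ expNegInvGlue := expNegInvGlue.contDiff
  have hs : ContDiff ℝ ∞ s := contDiff_const.sub ((contDiff_const.sub hE).mul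
    (contDiff_const.sub hT))
  have hT0 : ∀ x ≤ 1, T x = 0 := fun x hx => Real.smoothTransition.zero_of_nonpos (by linarith)
  have hTle : ∀ x, T x ≤ 1 := fun x => Real.smoothTransition.le_one _
  have hTnn : ∀ x, 0 ≤ T x := fun x => Real.smoothTransition.nonneg _
  have hTm : Monotone T := Real.smoothTransition.monotone.comp fun a b hab => by linarith
  have hEm := expNegInvGlue.monotone
  have hEle := expNegInvGlue_le_one
  have hEnn := expNegInvGlue.nonneg
  have hs1 : ∀ x ≤ 1, s x = expNegInvGlue x := fun x hx => by simp [s, hT0 x hx]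
  have hs0 : ∀ x ≤ 0, s x = 0 := fun x hx => by
    rw [hs1 x (by linarith), expNegInvGlue.zero_of_nonpos hx]
  have hs2 : ∀ x, 2 ≤ x → s x = 1 := fun x hx => by
    have : T x = 1 := Real.smoothTransition.one_of_one_le (by linarith)
    simp [s, this]
  have hmono : Monotone s := by
    intro a b hab
    have h1 : (1 - expNegInvGlue b) * (1 - T b) ≤ (1 - expNegInvGlue a) * (1 - T a) :=
      mul_le_mul (by linarith [hEm hab]) (by linarith [hTm hab]) (by linarith [hTle b])
        (by linarith [hEle a])
    simp only [s]; linarith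
  have hs01 : ∀ x, 0 ≤ s x ∧ s x ≤ 1 := by
    intro x
    have h1 : (1 - expNegInvGlue x) * (1 - T x) ≤ 1 :=
      mul_le_one₀ (by linarith [hEnn x]) (by linarith [hTle x]) (by linarith [hTnn x])
    have h2 : 0 ≤ (1 - expNegInvGlue x) * (1 - T x) :=
      mul_nonneg (by linarith [hEle x]) (by linarith [hTle x])
    simp only [s]
    constructor <;> linarith
  have hd : ContDiff ℝ ∞ (deriv s) := hs.iterate_deriv 1
  have hdd : Continuous (deriv (deriv s)) := (hs.iterate_deriv 2).continuous
  have hdl : ∀ x < 0, deriv s =ᶠ[𝓝 x] fun _ => 0 := by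
    intro x hx
    filter_upwards [Iio_mem_nhds hx] with y hy
    have : s =ᶠ[𝓝 y] fun _ => 0 := by
      filter_upwards [Iio_mem_nhds hy] with t ht using hs0 t (le_of_lt ht)
    rw [this.deriv_eq, deriv_const]
  have hdr : ∀ x, 2 < x → deriv s =ᶠ[𝓝 x] fun _ => 0 := by
    intro x hx
    filter_upwards [Ioi_mem_nhds hx] with y hy
    have : s =ᶠ[𝓝 y] fun _ => 1 := by
      filter_upwards [Ioi_mem_nhds hy] with t ht using hs2 t (le_of_lt ht)
    rw [this.deriv_eq, deriv_const]
  obtain ⟨C₁, hC₁⟩ := isCompact_Icc.exists_bound_of_continuousOn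
    (s := Icc (0 : ℝ) 2) hd.continuous.continuousOn
  obtain ⟨C₂, hC₂⟩ := isCompact_Icc.exists_bound_of_continuousOn
    (s := Icc (0 : ℝ) 2) hdd.continuousOn
  have hC₁0 : 0 ≤ C₁ := (norm_nonneg _).trans (hC₁ 0 (by simp))
  have hC₂0 : 0 ≤ C₂ := (norm_nonneg _).trans (hC₂ 0 (by simp))
  have hb₁ : ∀ x, deriv s x ≤ C₁ := by
    intro x
    rcases lt_or_ge x 0 with h | h
    · rw [(hdl x h).eq_of_nhds]; exact hC₁0
    rcases lt_or_ge 2 x with h' | h'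
    · rw [(hdr x h').eq_of_nhds]; exact hC₁0
    · exact (le_abs_self _).trans (hC₁ x ⟨h, h'⟩)
  have hb₂ : ∀ x, |deriv (deriv s) x| ≤ C₂ := by
    intro x
    rcases lt_or_ge x 0 with h | h
    · rw [(hdl x h).deriv_eq]; simpa using hC₂0
    rcases lt_or_ge 2 x with h' | h'
    · rw [(hdr x h').deriv_eq]; simpa using hC₂0
    · exact hC₂ x ⟨h, h'⟩
  have hE1 : 0 < expNegInvGlue 1 := expNegInvGlue.pos_of_pos one_pos
  set C := C₁ + C₂ + C₂ / expNegInvGlue 1 + 2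
  have hq : 0 ≤ C₂ / expNegInvGlue 1 := by positivity
  refine ⟨s, C, by positivity, hs, hs0, hs2, hs01,
    fun x => ⟨hmono.deriv_nonneg, (hb₁ x).trans (by simp only [C]; linarith)⟩,
    fun x => (hb₂ x).trans (by simp only [C]; linarith), fun x => ?_⟩
  rcases lt_or_ge x 1 with hx | hx
  · have e1 : s =ᶠ[𝓝 x] expNegInvGlue := by
      filter_upwards [Iio_mem_nhds hx] with t ht using hs1 t (le_of_lt ht)
    rw [e1.deriv.deriv_eq, (hasDerivAt_deriv_expNegInvGlue x).deriv, e1.eq_of_nhds]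
    have h1 : -2 ≤ x⁻¹ ^ 4 - 2 * x⁻¹ ^ 3 := by
      nlinarith [sq_nonneg (x⁻¹ ^ 2 - x⁻¹ - 1), sq_nonneg (x⁻¹ ^ 2 - x⁻¹), sq_nonneg (x⁻¹ - 1)]
    have h2 : -2 * expNegInvGlue x ≤ (x⁻¹ ^ 4 - 2 * x⁻¹ ^ 3) * expNegInvGlue x :=
      mul_le_mul_of_nonneg_right h1 (hEnn x)
    have h3 : 2 * expNegInvGlue x ≤ C * expNegInvGlue x :=
      mul_le_mul_of_nonneg_right (by simp only [C]; linarith) (hEnn x)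
    linarith
  · have h1 : expNegInvGlue 1 ≤ s x := by rw [← hs1 1 le_rfl]; exact hmono hx
    have h2 : C₂ ≤ C * s x := by
      calc C₂ = C₂ / expNegInvGlue 1 * expNegInvGlue 1 := by field_simp
        _ ≤ C * s x := mul_le_mul (by simp only [C]; linarith) h1 hE1.le (by positivity)
    linarith [(abs_le.mp (hb₂ x)).1]

end Step

/-! ### Interpolation with a multiple of the Poincaré metric -/

section Interpolation

open Laplacian

theorem laplacian_interpolation {σ v : ℂ → ℝ} {z : ℂ} (q : ℝ) (hσ : ContDiffAt ℝ 2 σ z)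
    (hv : ContDiffAt ℝ 2 v z) :
    laplacian (fun y => q - (1 - σ y) * (q - v y)) z =
      (1 - σ z) * laplacian v z + (q - v z) * laplacian σ z - 2 * gradInner σ v z := by
  have hsub : ∀ (c : ℝ) (f : ℂ → ℝ), ContDiffAt ℝ 2 f z →
      laplacian (fun y => c - f y) z = -laplacian f z := by
    intro c f hf
    have h := (contDiffAt_const (c := c)).laplacian_sub hf
    have h' : laplacian (fun y => c - f y) z =
      laplacian (fun _ : ℂ => c) z - laplacian f z := h
    rw [h', InnerProductSpace.laplacian_const, Pi.zero_apply, zero_sub]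
  have h1 : ContDiffAt ℝ 2 (fun y => 1 - σ y) z := contDiffAt_const.sub hσ
  have h2 : ContDiffAt ℝ 2 (fun y => q - v y) z := contDiffAt_const.sub hv
  rw [hsub q _ (h1.mul h2), h1.laplacian_mul h2, hsub 1 σ hσ, hsub q v hv, gradInner, gradInner,
    fderiv_const_sub, fderiv_const_sub]
  simp only [neg_apply]
  ring

variable {s : ℝ → ℝ} {δ R : ℝ}

theorem laplacian_step (hs : ContDiff ℝ 2 s) {z : ℂ} (hz : z ∈ unitDisk) :
    laplacian (fun y => s (δ * (hypPotential y - R))) z =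
      (δ * deriv s (δ * (hypPotential z - R)) +
        δ ^ 2 * deriv (deriv s) (δ * (hypPotential z - R)) * ‖z‖ ^ 2) *
          poincareMetric.density z := by
  have hf : ContDiffAt ℝ 2 hypPotential z := contDiffAt_hypPotential hz
  have hd1 : deriv (fun t => s (δ * (t - R))) = fun t => δ * deriv s (δ * (t - R)) := by
    funext t
    have h1 : HasDerivAt (fun t => δ * (t - R)) δ t := by
      simpa using ((hasDerivAt_id t).sub_const R).const_mul δ
    have h2 := ((hs.differentiable (by norm_num) (δ * (t - R))).hasDerivAt.comp t h1).deriv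
    simp only [Function.comp_def] at h2
    rw [h2, mul_comm]
  have hs' : Differentiable ℝ (deriv s) :=
    (ContDiff.iterate_deriv' 1 1 hs).differentiable (by norm_num)
  have hd2 : deriv (fun t => δ * deriv s (δ * (t - R))) =
      fun t => δ ^ 2 * deriv (deriv s) (δ * (t - R)) := by
    funext t
    have h1 : HasDerivAt (fun t => δ * (t - R)) δ t := by
      simpa using ((hasDerivAt_id t).sub_const R).const_mul δ
    have h2 := (((hs' (δ * (t - R))).hasDerivAt.comp t h1).const_mul δ).deriv
    simp only [Function.comp_def] at h2
    rw [h2]; ring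
  have hφ : ContDiff ℝ 2 (fun t => s (δ * (t - R))) := hs.comp (by fun_prop)
  rw [hφ.contDiffAt.laplacian_comp (f := hypPotential) hf, hd1, hd2, gradInner_hypPotential hz,
    laplacian_hypPotential hz]
  ring

theorem gradInner_step (hs : ContDiff ℝ 2 s) (v : ℂ → ℝ) {z : ℂ} (hz : z ∈ unitDisk) :
    gradInner (fun y => s (δ * (hypPotential y - R))) v z =
      δ * deriv s (δ * (hypPotential z - R)) * gradInner hypPotential v z := by
  have hf := ((contDiffAt_hypPotential (n := 1) hz).differentiableAt (by norm_num)).hasFDerivAt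
  have h1 := (hf.sub_const R).const_mul δ
  have h2 := ((hs.differentiable (by norm_num)
    (δ * (hypPotential z - R))).hasDerivAt.comp_hasFDerivAt z h1).fderiv
  simp only [Function.comp_def] at h2
  rw [gradInner, h2, gradInner]
  simp only [smul_apply, smul_eq_mul]
  ring

theorem abs_gradInner_hypPotential_le {v : ℂ → ℝ} {A : ℝ} {z : ℂ} (hz : z ∈ unitDisk)
    (hA : ∀ e : ℂ, ‖e‖ = 1 → |fderiv ℝ v z e| ≤ A * √(poincareMetric.density z)) :
    |gradInner hypPotential v z| ≤ 2 * A * poincareMetric.density z := by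
  have hl := poincareMetric_density_pos hz
  have hsq : √(poincareMetric.density z) * √(poincareMetric.density z) =
    poincareMetric.density z := Real.mul_self_sqrt hl.le
  have key : ∀ e : ℂ, ‖e‖ = 1 → |fderiv ℝ hypPotential z e * fderiv ℝ v z e| ≤
      A * poincareMetric.density z := by
    intro e he
    have h1 : |fderiv ℝ hypPotential z e| ≤ √(poincareMetric.density z) := by
      have := (fderiv ℝ hypPotential z).le_opNorm e
      rw [he, mul_one] at this
      exact this.trans (norm_fderiv_hypPotential_le hz)
    rw [abs_mul]
    calc _ ≤ √(poincareMetric.density z) * (A * √(poincareMetric.density z)) :=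
          mul_le_mul h1 (hA e he) (abs_nonneg _) (Real.sqrt_nonneg _)
      _ = A * poincareMetric.density z := by linear_combination A * hsq
  rw [gradInner]
  refine (abs_add_le _ _).trans ?_
  linarith [key 1 (by simp), key Complex.I (by simp)]

/-- Bounds for the Laplacian of the interpolation, along a slow step in the potential, from `v` to a
large constant. In the lower bound the positive term `(q - v) Δσ` dominates the error that involves
the gradient of `v`. -/
theorem laplacian_interpolation_bounds {C A m Q : ℝ} {v : ℂ → ℝ} {z : ℂ} (hC : 0 < C)
    (hs : ContDiff ℝ 2 s) (hs01 : ∀ x, 0 ≤ s x ∧ s x ≤ 1)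
    (hs1 : ∀ x, 0 ≤ deriv s x ∧ deriv s x ≤ C) (hs2 : ∀ x, |deriv (deriv s) x| ≤ C)
    (hs3 : ∀ x, -(C * s x) ≤ deriv (deriv s) x) (hδ0 : 0 < δ) (hδ1 : δ ≤ 1)
    (hz : z ∈ unitDisk) (hv : ContDiffAt ℝ 2 v z) (hm : |v z| ≤ m)
    (hA : ∀ e : ℂ, ‖e‖ = 1 → |fderiv ℝ v z e| ≤ A * √(poincareMetric.density z))
    (hQ : 4 * A ≤ Q) (hδ : (2 * m + Q) * δ ^ 2 * C ≤ 1) :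
    (1 - s (δ * (hypPotential z - R))) * laplacian v z -
        s (δ * (hypPotential z - R)) * poincareMetric.density z ≤
      laplacian (fun y => m + Q - (1 - s (δ * (hypPotential y - R))) * (m + Q - v y)) z ∧
    laplacian (fun y => m + Q - (1 - s (δ * (hypPotential y - R))) * (m + Q - v y)) z ≤
      (1 - s (δ * (hypPotential z - R))) * laplacian v z +
        δ * ((2 * m + Q) * (2 * C) + 4 * A * C) * poincareMetric.density z := by
  have hl := poincareMetric_density_pos hz
  have hA0 : 0 ≤ A := by
    have h1 := (abs_nonneg _).trans (hA 1 (by simp))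
    exact nonneg_of_mul_nonneg_left h1 (Real.sqrt_pos.mpr hl)
  have hm0 : 0 ≤ m := (abs_nonneg _).trans hm
  have hm' := abs_le.mp hm
  have hσ : ContDiffAt ℝ 2 (fun y => s (δ * (hypPotential y - R))) z :=
    hs.contDiffAt.comp z (contDiffAt_const.mul ((contDiffAt_hypPotential hz).sub contDiffAt_const))
  rw [laplacian_interpolation (m + Q) hσ hv, laplacian_step hs hz, gradInner_step hs v hz]
  have hG := abs_le.mp (abs_gradInner_hypPotential_le hz hA)
  set x := δ * (hypPotential z - R)
  obtain ⟨h10, h1C⟩ := hs1 x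
  obtain ⟨h0, h01⟩ := hs01 x
  have h2 := abs_le.mp (hs2 x)
  have h3 := hs3 x
  have hz1 : ‖z‖ ^ 2 ≤ 1 := by linarith [one_sub_norm_sq_pos hz]
  have hz0 : 0 ≤ ‖z‖ ^ 2 := by positivity
  set G := gradInner hypPotential v z
  set l := poincareMetric.density z
  set g := m + Q - v z
  have hg1 : Q ≤ g := by simp only [g]; linarith
  have hg2 : g ≤ 2 * m + Q := by simp only [g]; linarith
  have hQ0 : 0 ≤ Q := by linarith
  have hg0 : 0 ≤ g := hQ0.trans hg1
  have hδs : 0 ≤ δ * deriv s x := by positivity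
  have hGu : 2 * (δ * deriv s x * G) ≤ δ * deriv s x * (4 * A * l) := by
    have := mul_le_mul_of_nonneg_left hG.2 hδs
    linarith
  have hGl : -(δ * deriv s x * (4 * A * l)) ≤ 2 * (δ * deriv s x * G) := by
    have := mul_le_mul_of_nonneg_left hG.1 hδs
    linarith
  constructor
  · have e1 : -(C * s x) ≤ deriv (deriv s) x * ‖z‖ ^ 2 := by
      have : 0 ≤ C * s x := by positivity
      nlinarith
    have e2 : -s x ≤ g * (δ ^ 2 * (deriv (deriv s) x * ‖z‖ ^ 2)) := by
      have a1 : g * δ ^ 2 * (-(C * s x)) ≤ g * δ ^ 2 * (deriv (deriv s) x * ‖z‖ ^ 2) :=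
        mul_le_mul_of_nonneg_left e1 (by positivity)
      have a2 : g * δ ^ 2 * C ≤ 1 := le_trans (by gcongr) hδ
      have a3 : (g * δ ^ 2 * C) * s x ≤ 1 * s x := mul_le_mul_of_nonneg_right a2 h0
      linarith
    have e3 : δ * deriv s x * (4 * A) ≤ g * (δ * deriv s x) := by
      have : δ * deriv s x * (4 * A) ≤ δ * deriv s x * g :=
        mul_le_mul_of_nonneg_left (by linarith) hδs
      linarith
    have e4 : (-s x + δ * deriv s x * (4 * A)) * l ≤
        (g * (δ ^ 2 * (deriv (deriv s) x * ‖z‖ ^ 2)) + g * (δ * deriv s x)) * l :=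
      mul_le_mul_of_nonneg_right (by linarith) hl.le
    linarith
  · have e1 : deriv (deriv s) x * ‖z‖ ^ 2 ≤ C := by nlinarith
    have e2 : δ ^ 2 * (deriv (deriv s) x * ‖z‖ ^ 2) ≤ δ * C := by
      calc δ ^ 2 * (deriv (deriv s) x * ‖z‖ ^ 2) ≤ δ ^ 2 * C := by gcongr
        _ ≤ δ * C := by
          gcongr
          nlinarith
    have e3 : δ * deriv s x ≤ δ * C := by gcongr
    have e4 : g * (δ * deriv s x + δ ^ 2 * (deriv (deriv s) x * ‖z‖ ^ 2)) ≤
        (2 * m + Q) * (δ * C + δ * C) := by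
      calc _ ≤ g * (δ * C + δ * C) := by gcongr
        _ ≤ _ := by gcongr
    have e5 : δ * deriv s x * (4 * A) ≤ δ * C * (4 * A) := by gcongr
    have e6 : (g * (δ * deriv s x + δ ^ 2 * (deriv (deriv s) x * ‖z‖ ^ 2)) +
        δ * deriv s x * (4 * A)) * l ≤ ((2 * m + Q) * (δ * C + δ * C) + δ * C * (4 * A)) * l :=
      mul_le_mul_of_nonneg_right (by linarith) hl.le
    linarith

end Interpolation

/-! ### Conformal metrics relative to the Poincaré metric -/

section Relative

open Laplacian

/-- The logarithm of the ratio of the densities of `h` and of the Poincaré metric. -/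
noncomputable def ConformalMetric.logRatio (h : ConformalMetric) (z : ℂ) : ℝ :=
  Real.log (h.density z) - Real.log (poincareMetric.density z)

theorem ConformalMetric.contDiffOn_log_density (h : ConformalMetric) :
    ContDiffOn ℝ ∞ (fun z => Real.log (h.density z)) unitDisk :=
  h.smooth.log fun z hz => (h.pos z hz).ne'

theorem ConformalMetric.contDiffOn_logRatio (h : ConformalMetric) :
    ContDiffOn ℝ ∞ h.logRatio unitDisk :=
  h.contDiffOn_log_density.sub poincareMetric.contDiffOn_log_density

theorem ContDiffOn.contDiffAt_two {v : ℂ → ℝ} (hv : ContDiffOn ℝ ∞ v unitDisk) {z : ℂ}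
    (hz : z ∈ unitDisk) : ContDiffAt ℝ 2 v z :=
  (hv.contDiffAt (isOpen_unitDisk.mem_nhds hz)).of_le ENat.LEInfty.out

theorem ConformalMetric.density_eq_exp_logRatio (h : ConformalMetric) {z : ℂ}
    (hz : z ∈ unitDisk) :
    h.density z = Real.exp (h.logRatio z) * poincareMetric.density z := by
  rw [logRatio, Real.exp_sub, Real.exp_log (h.pos z hz), Real.exp_log (poincareMetric.pos z hz),
    div_mul_cancel₀ _ (poincareMetric.pos z hz).ne']

theorem laplacian_log_poincareMetric_density {z : ℂ} (hz : z ∈ unitDisk) :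
    laplacian (fun y => Real.log (poincareMetric.density y)) z =
      2 * poincareMetric.density z := by
  have hf : ContDiffAt ℝ 2 hypPotential z := contDiffAt_hypPotential hz
  have e : (fun y => Real.log (poincareMetric.density y)) =ᶠ[𝓝 z]
      (fun _ => Real.log 4) + (2 : ℝ) • hypPotential := by
    filter_upwards [isOpen_unitDisk.mem_nhds hz] with y hy
    rw [poincareMetric_density_eq_exp hy]
    rfl
  rw [(InnerProductSpace.laplacian_congr_nhds e).eq_of_nhds,
    contDiffAt_const.laplacian_add (f₂ := (2 : ℝ) • hypPotential) (hf.const_smul (2 : ℝ)),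
    InnerProductSpace.laplacian_smul _ hf, InnerProductSpace.laplacian_const,
    laplacian_hypPotential hz]
  simp

/-- The curvature of `e ^ U h₀` in terms of the Laplacian of `U`. -/
theorem ConformalMetric.curvature_eq (h : ConformalMetric) {U : ℂ → ℝ} {z : ℂ} (hz : z ∈ unitDisk)
    (hU : ContDiffAt ℝ 2 U z)
    (hh : ∀ y ∈ unitDisk, h.density y = Real.exp (U y) * poincareMetric.density y) :
    h.curvature z = -(laplacian U z + 2 * poincareMetric.density z) /
      (2 * (Real.exp (U z) * poincareMetric.density z)) := by
  have e : (fun y => Real.log (h.density y)) =ᶠ[𝓝 z]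
      U + fun y => Real.log (poincareMetric.density y) := by
    filter_upwards [isOpen_unitDisk.mem_nhds hz] with y hy
    rw [hh y hy, Real.log_mul (Real.exp_pos _).ne' (poincareMetric.pos y hy).ne', Real.log_exp]
    rfl
  rw [curvature, (InnerProductSpace.laplacian_congr_nhds e).eq_of_nhds,
    hU.laplacian_add (poincareMetric.contDiffOn_log_density.contDiffAt_two hz),
    laplacian_log_poincareMetric_density hz, hh z hz]

theorem ConformalMetric.laplacian_logRatio (h : ConformalMetric) {z : ℂ} (hz : z ∈ unitDisk) :
    laplacian h.logRatio z =
      -(2 * (h.curvature z * Real.exp (h.logRatio z)) + 2) * poincareMetric.density z := by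
  have h1 := h.curvature_eq hz (h.contDiffOn_logRatio.contDiffAt_two hz)
    fun y hy => h.density_eq_exp_logRatio hy
  have hl := poincareMetric.pos z hz
  have hE := Real.exp_pos (h.logRatio z)
  rw [h1]
  field_simp
  ring

/-- For a complete bounded metric of bounded curvature, the logarithm of the ratio to the Poincaré
metric is bounded, together with its gradient and its Laplacian for the Poincaré metric. -/
theorem ConformalMetric.exists_logRatio_bounds {h : ConformalMetric} {B : ℝ}
    (hc : h.IsCompleteMetric) (hb : h.IsBoundedMetric) (hB : 0 < B)
    (hK : ∀ z ∈ unitDisk, |h.curvature z| ≤ B) :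
    ∃ m N A : ℝ, 0 ≤ N ∧ (∀ z ∈ unitDisk, |h.logRatio z| ≤ m) ∧
      (∀ z ∈ unitDisk, |laplacian h.logRatio z| ≤ N * poincareMetric.density z) ∧
      ∀ z ∈ unitDisk, ∀ e : ℂ, ‖e‖ = 1 →
        |fderiv ℝ h.logRatio z e| ≤ A * √(poincareMetric.density z) := by
  obtain ⟨C, hC1, hC⟩ := hb
  have hsm : ∀ z ∈ unitDisk, ContDiffAt ℝ 2 h.logRatio z := fun z hz =>
    h.contDiffOn_logRatio.contDiffAt_two hz
  have hexp : ∀ z ∈ unitDisk, Real.exp (h.logRatio z) ≤ C := by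
    intro z hz
    have h1 := hC z hz
    rw [h.density_eq_exp_logRatio hz] at h1
    exact le_of_mul_le_mul_right h1 (poincareMetric.pos z hz)
  have hle : ∀ z ∈ unitDisk, h.logRatio z ≤ Real.log C := fun z hz =>
    (Real.le_log_iff_exp_le (by linarith)).mpr (hexp z hz)
  set N := 2 * (B * C) + 2
  have hN0 : 0 ≤ N := by positivity
  have hKe : ∀ z ∈ unitDisk, |h.curvature z * Real.exp (h.logRatio z)| ≤
      B * Real.exp (h.logRatio z) := by
    intro z hz
    rw [abs_mul, abs_of_pos (Real.exp_pos _)]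
    exact mul_le_mul_of_nonneg_right (hK z hz) (Real.exp_pos _).le
  have hN : ∀ z ∈ unitDisk, |laplacian h.logRatio z| ≤ N * poincareMetric.density z := by
    intro z hz
    rw [h.laplacian_logRatio hz, abs_mul, abs_of_pos (poincareMetric.pos z hz)]
    refine mul_le_mul_of_nonneg_right ?_ (poincareMetric.pos z hz).le
    have h1 := abs_le.mp (hKe z hz)
    have h2 := mul_le_mul_of_nonneg_left (hexp z hz) hB.le
    rw [abs_neg]
    refine abs_le.mpr ⟨?_, ?_⟩ <;> simp only [N] <;> linarith
  have hlow : ∀ z ∈ unitDisk, -h.logRatio z ≤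
      6 * Real.log C + 3 * N + 4 * |Real.log (2 * B)| := fun z hz =>
    bddAbove_of_isCompleteMetric (w := fun z => -h.logRatio z) hc (fun y hy => (hsm y hy).neg)
      (fun y hy => by rw [neg_neg]; exact h.density_eq_exp_logRatio hy)
      (Real.log_nonneg hC1.le) (fun y hy => neg_le_neg (hle y hy))
      (fun y hy => by
        have : laplacian (fun z => -h.logRatio z) y = -laplacian h.logRatio y := by
          have := congrFun (InnerProductSpace.laplacian_neg (f := h.logRatio)) y
          exact this
        rw [this, abs_neg]; exact hN y hy)
      (fun y hy hWy => by
        have : laplacian (fun z => -h.logRatio z) y = -laplacian h.logRatio y := by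
          have := congrFun (InnerProductSpace.laplacian_neg (f := h.logRatio)) y
          exact this
        rw [this, h.laplacian_logRatio hy]
        have h1 := abs_le.mp (hKe y hy)
        have h2 : B * Real.exp (h.logRatio y) ≤ 1 / 2 := by
          have h3 := Real.exp_le_exp.mpr hWy
          rw [Real.exp_log (by positivity), Real.exp_neg] at h3
          have hE := Real.exp_pos (h.logRatio y)
          have h4 := mul_le_mul_of_nonneg_right h3 hE.le
          rw [inv_mul_cancel₀ hE.ne'] at h4
          linarith
        have h5 : 1 * poincareMetric.density y ≤
            (2 * (h.curvature y * Real.exp (h.logRatio y)) + 2) * poincareMetric.density y :=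
          mul_le_mul_of_nonneg_right (by linarith) (poincareMetric.pos y hy).le
        linarith) hz
  set m := 6 * Real.log C + 3 * N + 4 * |Real.log (2 * B)|
  have hlogC := Real.log_nonneg hC1.le
  have hm : ∀ z ∈ unitDisk, |h.logRatio z| ≤ m := fun z hz => by
    refine abs_le.mpr ⟨by linarith [hlow z hz], (hle z hz).trans ?_⟩
    simp only [m]
    linarith [abs_nonneg (Real.log (2 * B))]
  exact ⟨m, N, 2 * (4 * m + 4 * N + 1), hN0, hm, hN, fun z hz e he =>
    abs_fderiv_le_sqrt_density hsm hm hN hz he⟩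

end Relative

/-! ### Invariant metrics and their convergence -/

section Invariant

open Laplacian

variable {Γ : Type*} [Group Γ] {ρ : Γ →* PSL(2, ℝ)} {P : Set ℂ} {τ q : ℝ} {u : ℂ → ℝ}

theorem exists_extension_of_isFundDomain (hP : IsFundDomain ρ P) (hsub : closedHypDisk τ ⊆ P)
    (hout : ∀ z ∈ unitDisk, Real.log (max τ 4 / 4) ≤ hypPotential z → u z = q) :
    ∃ U : ℂ → ℝ, (∀ z ∈ unitDisk, ∃ γ : Γ, U =ᶠ[𝓝 z] fun y => u (diskAct (ρ γ) y)) ∧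
      (∀ γ : Γ, ∀ z ∈ unitDisk, U (diskAct (ρ γ) z) = U z) ∧
      ∀ z ∈ unitDisk, hypPotential z < Real.log (max τ 4 / 4) → U z = u z := by
  rcases le_or_gt τ 4 with hτ | hτ
  · -- the function is constant, and the empty ball serves
    rw [max_eq_right hτ, div_self (by norm_num), Real.log_one] at hout ⊢
    obtain ⟨U, h1, h2, -⟩ := exists_equivariant_extension (ρ := ρ) (r := -1) (r' := 0) (q := q)
      (u := u) (by norm_num) (fun z hz _ => hout z hz (hypPotential_nonneg hz))
      (fun γ _ => by simp)
    exact ⟨U, h1, h2, fun z hz h => absurd (hypPotential_nonneg hz) (not_le.mpr h)⟩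
  · rw [max_eq_left hτ.le] at hout ⊢
    have hτ0 : 0 < τ := by linarith
    have h4 : 4 / τ < 1 := (div_lt_one hτ0).mpr hτ
    have h24 : 2 / τ < 4 / τ := by gcongr; norm_num
    have hball : Metric.ball (0 : ℂ) √(1 - 2 / τ) ⊆ interior P := by
      refine interior_maximal (fun z hz => hsub ?_) Metric.isOpen_ball
      rw [mem_ball_zero_iff, Real.lt_sqrt (norm_nonneg z)] at hz
      have h2τ : 0 < 2 / τ := by positivity
      have hzD : z ∈ unitDisk := by
        rw [mem_unitDisk_iff, ← sq_lt_one_iff₀ (norm_nonneg z)]; linarith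
      refine mem_closedHypDisk_of_le hzD ?_
      rw [div_le_iff₀ (one_sub_norm_sq_pos hzD)]
      have : 2 / τ ≤ 1 - ‖z‖ ^ 2 := by linarith
      rw [div_le_iff₀ hτ0] at this
      linarith
    have hlog : ∀ z ∈ unitDisk,
        (Real.log (τ / 4) ≤ hypPotential z ↔ 1 - ‖z‖ ^ 2 ≤ 4 / τ) := by
      intro z hz
      have h0 := one_sub_norm_sq_pos hz
      rw [hypPotential, le_neg, ← Real.log_inv, inv_div,
        Real.log_le_log_iff h0 (by positivity)]
    obtain ⟨U, h1, h2, h3⟩ := exists_equivariant_extension (ρ := ρ) (r := √(1 - 4 / τ))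
      (r' := √(1 - 2 / τ)) (q := q) (u := u) (Real.sqrt_lt_sqrt (by linarith) (by linarith))
      (fun z hz hr => hout z hz ((hlog z hz).mpr (by
        rw [Real.sqrt_le_left (norm_nonneg z)] at hr
        linarith)))
      (fun γ hγ => (hP.disjoint γ hγ).mono hball (image_mono hball))
    refine ⟨U, h1, h2, fun z hz h => h3 z hz ?_⟩
    rw [Real.lt_sqrt (norm_nonneg z)]
    rw [← not_le, hlog z hz, not_le] at h
    linarith

/-- From a function that is constant outside a ball contained in a fundamental domain, an invariant
complete metric; its curvature takes the values that the function prescribes. -/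
theorem exists_invariant_metric {b : ℝ} {I : Set ℝ} (hP : IsFundDomain ρ P)
    (hsub : closedHypDisk τ ⊆ P) (hu : ContDiffOn ℝ ∞ u unitDisk)
    (hlow : ∀ z ∈ unitDisk, b ≤ u z)
    (hout : ∀ z ∈ unitDisk, Real.log (max τ 4 / 4) ≤ hypPotential z → u z = q)
    (hcurv : ∀ z ∈ unitDisk, -(laplacian u z + 2 * poincareMetric.density z) /
      (2 * (Real.exp (u z) * poincareMetric.density z)) ∈ I) :
    ∃ H : ConformalMetric, (H.IsCompleteMetric ∧ H.IsInvariant ρ ∧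
      ∀ z ∈ unitDisk, H.curvature z ∈ I) ∧
      ∀ z ∈ unitDisk, hypPotential z < Real.log (max τ 4 / 4) →
        H.density z = Real.exp (u z) * poincareMetric.density z := by
  obtain ⟨U, h1, h2, h3⟩ := exists_extension_of_isFundDomain hP hsub hout
  have hloc : ∀ z ∈ unitDisk, ContDiffAt ℝ ∞ U z := by
    intro z hz
    obtain ⟨γ, hγ⟩ := h1 z hz
    refine ContDiffAt.congr_of_eventuallyEq ?_ hγ
    have ha : ContDiffAt ℝ ∞ (diskAct (ρ γ)) z :=
      ((analyticAt_diskAct (ρ γ) hz).contDiffAt (n := ∞)).restrict_scalars ℝ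
    exact ContDiffAt.comp z
      (hu.contDiffAt (isOpen_unitDisk.mem_nhds (diskAct_mem_unitDisk (ρ γ) hz))) ha
  have hUlow : ∀ z ∈ unitDisk, b ≤ U z := by
    intro z hz
    obtain ⟨γ, hγ⟩ := h1 z hz
    rw [hγ.eq_of_nhds]
    exact hlow _ (diskAct_mem_unitDisk _ hz)
  let H : ConformalMetric :=
    { density := fun z => Real.exp (U z) * poincareMetric.density z
      smooth := ContDiffOn.mul (fun z hz => (hloc z hz).exp.contDiffWithinAt) poincareMetric.smooth
      pos := fun z hz => mul_pos (Real.exp_pos _) (poincareMetric.pos z hz) }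
  refine ⟨H, ⟨?_, fun γ z hz => ?_, fun z hz => ?_⟩, fun z hz hlt => ?_⟩
  · refine ConformalMetric.isCompleteMetric_of_le (Real.exp_pos b) fun z hz => ?_
    exact mul_le_mul_of_nonneg_right (Real.exp_le_exp.mpr (hUlow z hz)) (poincareMetric.pos z hz).le
  · change Real.exp (U _) * poincareMetric.density _ * _ = Real.exp (U z) * poincareMetric.density z
    rw [h2 γ z hz, mul_assoc, density_diskAct _ hz]
  · obtain ⟨γ, hγ⟩ := h1 z hz
    have hγz := diskAct_mem_unitDisk (ρ γ) hz
    rw [H.curvature_eq hz ((hloc z hz).of_le ENat.LEInfty.out) fun y _ => rfl,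
      (InnerProductSpace.laplacian_congr_nhds hγ).eq_of_nhds,
      (hu.contDiffAt_two hγz).laplacian_comp_holomorphic (analyticAt_diskAct (ρ γ) hz),
      hγ.eq_of_nhds]
    convert hcurv _ hγz using 1
    rw [← density_diskAct (ρ γ) hz]
    have hne : ‖deriv (diskAct (ρ γ)) z‖ ^ 2 ≠ 0 := by
      intro h0
      have := density_diskAct (ρ γ) hz
      rw [h0, mul_zero] at this
      exact (poincareMetric.pos z hz).ne this
    rw [← mul_div_mul_right (-(laplacian u (diskAct (ρ γ) z) + _)) _ hne]
    congr 1 <;> ring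
  · change Real.exp (U z) * _ = _
    rw [h3 z hz hlt]

theorem smoothlyConverges_of_eq {H : ℕ → ConformalMetric} {h : ConformalMetric} {R : ℕ → ℝ}
    (hR : Tendsto R atTop atTop)
    (heq : ∀ n, ∀ z ∈ unitDisk, hypPotential z < R n → (H n).density z = h.density z) :
    ConformalMetric.SmoothlyConverges H h := by
  intro K hK hKD k
  obtain ⟨F, hF⟩ := (hK.image_of_continuousOn
    ((contDiffOn_hypPotential (n := 0)).continuousOn.mono hKD)).bddAbove
  intro V hV
  filter_upwards [hR.eventually_gt_atTop F] with n hn z hz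
  have hzF : hypPotential z < R n := (hF ⟨z, hz, rfl⟩).trans_lt hn
  have hev : (H n).density =ᶠ[𝓝 z] h.density := by
    filter_upwards [isOpen_unitDisk.mem_nhds (hKD hz),
      (contDiffAt_hypPotential (n := 0) (hKD hz)).continuousAt.eventually_lt_const hzF] with y hy hyR
    exact heq n y hy hyR
  rw [(hev.iteratedFDeriv ℝ k).eq_of_nhds]
  exact refl_mem_uniformity hV

end Invariant

/-! ### The approximation theorem -/

section Approximation

open Laplacian

theorem exists_small_parameter {a b c : ℝ} (ha : 0 ≤ a) (hb : 0 ≤ b) (hc : 0 < c) :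
    ∃ δ : ℝ, 0 < δ ∧ δ ≤ 1 ∧ a * δ ≤ 1 ∧ δ * b ≤ c := by
  refine ⟨min 1 (min (1 / (a + 1)) (c / (b + 1))), by positivity, min_le_left _ _, ?_, ?_⟩
  · calc a * min 1 (min (1 / (a + 1)) (c / (b + 1))) ≤ a * (1 / (a + 1)) := by
          gcongr
          exact (min_le_right _ _).trans (min_le_left _ _)
      _ ≤ 1 := by rw [mul_one_div, div_le_one (by positivity)]; linarith
  · calc min 1 (min (1 / (a + 1)) (c / (b + 1))) * b ≤ c / (b + 1) * b := by
          gcongr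
          exact (min_le_right _ _).trans (min_le_right _ _)
      _ ≤ c := by
          rw [div_mul_eq_mul_div, div_le_iff₀ (by positivity)]
          nlinarith

/-- Interpolation in the exponent between a metric and a large multiple of the Poincaré metric. The
curvature condition is expressed at a point through the parameter `σ` of the interpolation, and the
value `U` and the Laplacian `L`, divided by the Poincaré density, of the interpolated logarithm. -/
theorem exists_invariant_sequence {h : ConformalMetric} {m A Q η : ℝ} {I : Set ℝ}
    (hm : ∀ z ∈ unitDisk, |h.logRatio z| ≤ m)
    (hA : ∀ z ∈ unitDisk, ∀ e : ℂ, ‖e‖ = 1 →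
      |fderiv ℝ h.logRatio z e| ≤ A * √(poincareMetric.density z))
    (hQ : 4 * A ≤ Q) (hη : 0 < η) (g : ℕ → ℕ)
    (ρ : ∀ n, SurfaceGroup (g n) →* PSL(2, ℝ)) (τ : ℕ → ℝ) (hτ : Tendsto τ atTop atTop)
    (hP : ∀ n, ∃ P : Set ℂ, IsFundDomain (ρ n) P ∧ closedHypDisk (τ n) ⊆ P)
    (hI : ∀ z ∈ unitDisk, ∀ σ U L : ℝ, 0 ≤ σ → σ ≤ 1 → h.logRatio z + σ * Q ≤ U →
      -(1 - σ) * (2 * (h.curvature z * Real.exp (h.logRatio z)) + 2) - σ ≤ L →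
      L ≤ -(1 - σ) * (2 * (h.curvature z * Real.exp (h.logRatio z)) + 2) + η →
      -(L + 2) / (2 * Real.exp U) ∈ I) :
    ∃ H : ℕ → ConformalMetric,
      (∀ n, (H n).IsCompleteMetric ∧ (H n).IsInvariant (ρ n) ∧
        ∀ z ∈ unitDisk, (H n).curvature z ∈ I) ∧
      ConformalMetric.SmoothlyConverges H h := by
  obtain ⟨s, C, hC, hs, hs0, hs2, hs01, hd1, hd2, hd3⟩ := exists_smooth_step
  have h0D : (0 : ℂ) ∈ unitDisk := by simp [unitDisk]
  have hm0 : 0 ≤ m := (abs_nonneg _).trans (hm 0 h0D)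
  have hA0 : 0 ≤ A := by
    have h1 := (abs_nonneg _).trans (hA 0 h0D 1 (by simp))
    exact nonneg_of_mul_nonneg_left h1 (Real.sqrt_pos.mpr (poincareMetric.pos 0 h0D))
  have hQ0 : 0 ≤ Q := by linarith
  obtain ⟨δ, hδ0, hδ1, hδa, hδb⟩ := exists_small_parameter (a := (2 * m + Q) * C)
    (b := (2 * m + Q) * (2 * C) + 4 * A * C) (by positivity) (by positivity) hη
  have hδ2 : (2 * m + Q) * δ ^ 2 * C ≤ 1 := by
    calc (2 * m + Q) * δ ^ 2 * C = (2 * m + Q) * C * δ * δ := by ring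
      _ ≤ 1 * 1 := by gcongr
      _ = 1 := one_mul 1
  set R : ℕ → ℝ := fun n => Real.log (max (τ n) 4 / 4) - 2 / δ
  set u : ℕ → ℂ → ℝ := fun n z =>
    m + Q - (1 - s (δ * (hypPotential z - R n))) * (m + Q - h.logRatio z)
  have hR : Tendsto R atTop atTop := by
    have h1 : Tendsto (fun n => max (τ n) 4 / 4) atTop atTop :=
      (tendsto_atTop_mono (fun n => le_max_left _ _) hτ).atTop_div_const (by norm_num)
    exact tendsto_atTop_add_const_right _ _ (Real.tendsto_log_atTop.comp h1)
  have hRlt : ∀ n, R n ≤ Real.log (max (τ n) 4 / 4) := fun n => by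
    have : 0 ≤ 2 / δ := by positivity
    simp only [R]; linarith
  have hu : ∀ n, ContDiffOn ℝ ∞ (u n) unitDisk := fun n =>
    contDiffOn_const.sub ((contDiffOn_const.sub (hs.comp_contDiffOn
      (contDiffOn_const.mul (contDiffOn_hypPotential.sub contDiffOn_const)))).mul
      (contDiffOn_const.sub h.contDiffOn_logRatio))
  have hulow : ∀ n, ∀ z ∈ unitDisk,
      h.logRatio z + s (δ * (hypPotential z - R n)) * Q ≤ u n z := by
    intro n z hz
    have h1 := mul_nonneg (hs01 (δ * (hypPotential z - R n))).1
      (show 0 ≤ m - h.logRatio z by linarith [(abs_le.mp (hm z hz)).2])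
    simp only [u]
    linarith
  have hmetric : ∀ n, ∃ H : ConformalMetric, (H.IsCompleteMetric ∧ H.IsInvariant (ρ n) ∧
      ∀ z ∈ unitDisk, H.curvature z ∈ I) ∧
      ∀ z ∈ unitDisk, hypPotential z < Real.log (max (τ n) 4 / 4) →
        H.density z = Real.exp (u n z) * poincareMetric.density z := by
    intro n
    obtain ⟨P, hP1, hP2⟩ := hP n
    refine exists_invariant_metric (b := -m) (q := m + Q) hP1 hP2 (hu n) (fun z hz => ?_)
      (fun z hz hle => ?_) fun z hz => ?_
    · have h1 := mul_nonneg (hs01 (δ * (hypPotential z - R n))).1 hQ0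
      linarith [hulow n z hz, (abs_le.mp (hm z hz)).1]
    · have h1 : 2 ≤ δ * (hypPotential z - R n) := by
        have : 2 / δ ≤ hypPotential z - R n := by simp only [R]; linarith
        rwa [div_le_iff₀' hδ0] at this
      simp [u, hs2 _ h1]
    · have hl := poincareMetric.pos z hz
      obtain ⟨hlo, hup⟩ := laplacian_interpolation_bounds (R := R n) hC (hs.of_le ENat.LEInfty.out)
        hs01 hd1 hd2 hd3 hδ0 hδ1 hz (h.contDiffOn_logRatio.contDiffAt_two hz) (hm z hz) (hA z hz)
        hQ hδ2
      rw [h.laplacian_logRatio hz] at hlo hup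
      set σ := s (δ * (hypPotential z - R n))
      set κ := 2 * (h.curvature z * Real.exp (h.logRatio z)) + 2
      change _ ≤ laplacian (u n) z at hlo
      change laplacian (u n) z ≤ _ at hup
      have key := hI z hz σ (u n z) (laplacian (u n) z / poincareMetric.density z)
        (hs01 _).1 (hs01 _).2 (hulow n z hz)
        (by rw [le_div_iff₀ hl]; linarith)
        (by
          rw [div_le_iff₀ hl]
          have := mul_le_mul_of_nonneg_right hδb hl.le
          linarith)
      convert key using 1
      field_simp
  choose H hH1 hH2 using hmetric
  refine ⟨H, hH1, smoothlyConverges_of_eq hR fun n z hz hlt => ?_⟩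
  have h1 : s (δ * (hypPotential z - R n)) = 0 :=
    hs0 _ (mul_nonpos_of_nonneg_of_nonpos hδ0.le (by linarith))
  rw [hH2 n z hz (hlt.trans_le (hRlt n)), h.density_eq_exp_logRatio hz]
  simp [u, h1]

end Approximation

theorem proposition5p9
    (ε : ℝ) (hε : 0 < ε)
    (h : ConformalMetric) (hcomplete : h.IsCompleteMetric) (hbounded : h.IsBoundedMetric)
    (g : ℕ → ℕ) (hg : ∀ n, 2 ≤ g n)
    (ρ : ∀ n, SurfaceGroup (g n) →* PSL(2, ℝ)) (hρ : ∀ n, IsFuchsianRep (ρ n))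
    (τ : ℕ → ℝ) (hτmono : StrictMono τ) (hτ : Tendsto τ atTop atTop)
    (hP : ∀ n, ∃ P : Set ℂ, IsFundDomain (ρ n) P ∧ closedHypDisk (τ n) ⊆ P) :
    ((∀ z ∈ unitDisk, h.curvature z ∈ Icc (-(1 / ε)) 0) →
      ∃ ε' : ℝ, 0 < ε' ∧ ∃ hn : ℕ → ConformalMetric,
        (∀ n, (hn n).IsCompleteMetric ∧ (hn n).IsInvariant (ρ n) ∧
          ∀ z ∈ unitDisk, (hn n).curvature z ∈ Icc (-(1 / ε')) 0) ∧
        ConformalMetric.SmoothlyConverges hn h) ∧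
    ((∀ z ∈ unitDisk, h.curvature z ∈ Icc (-1 + ε) (1 / ε)) →
      ∃ ε' : ℝ, 0 < ε' ∧ ∃ hn : ℕ → ConformalMetric,
        (∀ n, (hn n).IsCompleteMetric ∧ (hn n).IsInvariant (ρ n) ∧
          ∀ z ∈ unitDisk, (hn n).curvature z ∈ Icc (-1 + ε') (1 / ε')) ∧
        ConformalMetric.SmoothlyConverges hn h) := by
  have hε1 : 0 < 1 / ε := by positivity
  constructor
  · intro hK
    obtain ⟨m, N, A, hN0, hm, hN, hA⟩ := ConformalMetric.exists_logRatio_bounds hcomplete hbounded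
      hε1 fun z hz => abs_le.mpr ⟨(hK z hz).1, (hK z hz).2.trans hε1.le⟩
    have hem := Real.exp_pos (-m)
    refine ⟨2 * Real.exp (-m) / (N + 3), by positivity, exists_invariant_sequence
      (Q := max (4 * A) 0) (η := 1) hm hA (le_max_left _ _) one_pos g ρ τ hτ hP ?_⟩
    intro z hz σ U L hσ0 hσ1 hU hL1 hL2
    have hl := poincareMetric.pos z hz
    have hmU : Real.exp (-m) ≤ Real.exp U := Real.exp_le_exp.mpr (by
      have := mul_nonneg hσ0 (le_max_right (4 * A) 0)
      linarith [(abs_le.mp (hm z hz)).1])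
    have hNz := hN z hz
    rw [h.laplacian_logRatio hz, abs_mul, abs_of_pos hl, abs_neg] at hNz
    have hκ := abs_le.mp (le_of_mul_le_mul_right hNz hl)
    have hκ0 : h.curvature z * Real.exp (h.logRatio z) ≤ 0 :=
      mul_nonpos_of_nonpos_of_nonneg (hK z hz).2 (Real.exp_pos _).le
    set κ := h.curvature z * Real.exp (h.logRatio z)
    constructor
    · rw [le_div_iff₀ (by positivity), one_div, inv_div]
      have h1 : L ≤ N + 1 := by nlinarith
      have h2 : N + 3 ≤ (N + 3) / (2 * Real.exp (-m)) * (2 * Real.exp U) := by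
        rw [div_mul_eq_mul_div, le_div_iff₀ (by positivity)]
        gcongr
      linarith
    · refine div_nonpos_of_nonpos_of_nonneg ?_ (by positivity)
      -- at `σ = 0` the bound is that of `h`, and at `σ = 1` there is room to spare
      nlinarith [mul_nonneg (sub_nonneg.mpr hσ1) (neg_nonneg.mpr hκ0)]
  · intro hK
    obtain ⟨m, N, A, hN0, hm, hN, hA⟩ := ConformalMetric.exists_logRatio_bounds (B := 1 + 1 / ε)
      hcomplete hbounded (by positivity) fun z hz => abs_le.mpr
        ⟨by linarith [(hK z hz).1], by linarith [(hK z hz).2]⟩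
    have hem := Real.exp_pos (-m)
    set ε₁ := min ε (1 / 2)
    have hε₁ : 0 < ε₁ := by positivity
    have hε₁ε : ε₁ ≤ ε := min_le_left _ _
    have hε₁2 : ε₁ ≤ 1 / 2 := min_le_right _ _
    set Q := max (4 * A) (2 * Real.exp m)
    have hQm : 2 * Real.exp m ≤ Q := le_max_right _ _
    have hQ0 : 0 ≤ Q := (by positivity : 0 ≤ 2 * Real.exp m).trans hQm
    refine ⟨min (ε₁ / 2) (2 * Real.exp (-m) / (N + 1)), by positivity, exists_invariant_sequence
      (Q := Q) (η := ε₁ * Real.exp (-m)) hm hA (le_max_left _ _) (by positivity) g ρ τ hτ hP ?_⟩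
    intro z hz σ U L hσ0 hσ1 hU hL1 hL2
    have hl := poincareMetric.pos z hz
    have hmv := abs_le.mp (hm z hz)
    have hmU : Real.exp (-m) ≤ Real.exp U := Real.exp_le_exp.mpr (by
      have := mul_nonneg hσ0 hQ0
      linarith)
    have hNz := hN z hz
    rw [h.laplacian_logRatio hz, abs_mul, abs_of_pos hl, abs_neg] at hNz
    have hκ := abs_le.mp (le_of_mul_le_mul_right hNz hl)
    set y := (1 - ε₁) * Real.exp (h.logRatio z) with hy_def
    have hκy : -(h.curvature z * Real.exp (h.logRatio z)) ≤ y := by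
      have := mul_le_mul_of_nonneg_right (show -h.curvature z ≤ 1 - ε₁ by linarith [(hK z hz).1])
        (Real.exp_pos (h.logRatio z)).le
      linarith
    have hy1 : 1 ≤ (1 + Q) * y := by
      have h1 : Real.exp (-m) ≤ Real.exp (h.logRatio z) := Real.exp_le_exp.mpr hmv.1
      calc (1 : ℝ) = 2 * Real.exp m * (1 / 2 * Real.exp (-m)) := by
            rw [Real.exp_neg]; field_simp
        _ ≤ (1 + Q) * y := by
            refine mul_le_mul (by linarith) ?_ (by positivity) (by positivity)
            exact mul_le_mul (by linarith) h1 hem.le (by linarith)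
    have hyU : y * (1 + σ * Q) ≤ (1 - ε₁) * Real.exp U := by
      have h1 : Real.exp (h.logRatio z) * (1 + σ * Q) ≤ Real.exp U := by
        calc Real.exp (h.logRatio z) * (1 + σ * Q)
            ≤ Real.exp (h.logRatio z) * Real.exp (σ * Q) := by
              gcongr
              linarith [Real.add_one_le_exp (σ * Q)]
          _ = Real.exp (h.logRatio z + σ * Q) := (Real.exp_add _ _).symm
          _ ≤ Real.exp U := Real.exp_le_exp.mpr hU
      have := mul_le_mul_of_nonneg_left h1 (show 0 ≤ 1 - ε₁ by linarith)
      linarith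
    have hε'1 : min (ε₁ / 2) (2 * Real.exp (-m) / (N + 1)) ≤ ε₁ / 2 := min_le_left _ _
    have hε'2 : min (ε₁ / 2) (2 * Real.exp (-m) / (N + 1)) ≤ 2 * Real.exp (-m) / (N + 1) :=
      min_le_right _ _
    have hε'0 : 0 < min (ε₁ / 2) (2 * Real.exp (-m) / (N + 1)) := by positivity
    set ε' := min (ε₁ / 2) (2 * Real.exp (-m) / (N + 1))
    set κ := h.curvature z * Real.exp (h.logRatio z)
    constructor
    · rw [le_div_iff₀ (by positivity)]
      -- the multiple `Q` compensates for the loss of the factor `1 - σ`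
      have h1 : (1 - σ) * (y - 1) + 1 ≤ y * (1 + σ * Q) := by
        have := mul_le_mul_of_nonneg_left hy1 hσ0
        linarith
      have h2 : (1 - σ) * (-κ - 1) ≤ (1 - σ) * (y - 1) :=
        mul_le_mul_of_nonneg_left (by linarith) (by linarith)
      have h3 : ε₁ * Real.exp (-m) ≤ ε₁ * Real.exp U := by gcongr
      have h4 : ε' * Real.exp U ≤ ε₁ / 2 * Real.exp U := by gcongr
      linarith
    · rw [div_le_iff₀ (by positivity)]
      have h1 : -(L + 2) ≤ N + 1 := by nlinarith
      have h2 : N + 1 ≤ 1 / ε' * (2 * Real.exp U) := by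
        rw [one_div, inv_mul_eq_div, le_div_iff₀ hε'0]
        calc (N + 1) * ε' ≤ (N + 1) * (2 * Real.exp (-m) / (N + 1)) := by gcongr
          _ = 2 * Real.exp (-m) := by field_simp
          _ ≤ 2 * Real.exp U := by gcongr
      linarith
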